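/- **Theorem (Weak stability of $q$ with respect to the discontinuous velocity $v$, the velocity $V$ and the initial datum $q_0$).** Let $T>0$, $\underline v>0$, and let $q_0\in L^\infty(\mathbb R)$, $\gamma\in BV(\mathbb R;\mathbb R_{\ge 0})$ (that is, $\gamma\in L^1(\mathbb R)$, $\gamma\ge0$ a.e., with finite total variation), $V\in W^{1,\infty}_{\mathrm{loc}}(\mathbb R)$ (continuous representative) and $v\in L^\infty(\mathbb R)$ with $v\ge\underline v$ a.e. For $S\in(0,T]$, a weak solution on $[0,S]$ of $$\partial_t q(t,x)+\partial_x\Big(v(x)\,V\big((\gamma*q(t,\cdot))(x)\big)\,q(t,x)\Big)=0,\qquad q(0,x)=q_0(x), \tag{1}$$ is a function $q\in C([0,S];L^1_{\mathrm{loc}}(\mathbb R))\cap L^\infty((0,S);L^\infty(\mathbb R))$ such that for all $\phi\in C^1_c((-42,S)\times\mathbb R)$ $$\iint_{(0,S)\times\mathbb R} q\,\Big(\phi_t+v(x)V\big((\gamma*q(t,\cdot))(x)\big)\phi_x\Big)\,dx\,dt+\int_{\mathbb R}\phi(0,x)q_0(x)\,dx=0 .$$ For $\varepsilon>0$ let $v_\varepsilon=\phi_\varepsilon*v$,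 $V_\varepsilon=\phi_\varepsilon*V$, $q_{0,\varepsilon}=\phi_\varepsilon*q_0$, where $\phi_\varepsilon(x)=\varepsilon^{-1}\phi(x/\varepsilon)$ is the standard mollifier, $\phi(x)=c\,e^{-1/(1-x^2)}$ for $|x|<1$, $\phi(x)=0$ otherwise, $\int\phi=1$; and let $(1)_\varepsilon$ be problem $(1)$ with $v,V,q_0$ replaced by $v_\varepsilon,V_\varepsilon,q_{0,\varepsilon}$. Let $\varepsilon_0>0$ be arbitrary. Then: 1. There are a time horizon $T^*\in(0,T]$ and a constant $K$ such that $(1)$ and all the problems $(1)_\varepsilon$, $0<\varepsilon\le\varepsilon_0$, have a unique weak solution on $[0,T^*]$, and all these solutions are bounded by $K$ in $L^\infty((0,T^*);L^\infty(\mathbb R))$. 2. For $T^*$ as in 1, and more generally for every $T^*\in(0,T]$ such that $(1)$ has a weak solution $q$ on $[0,T^*]$ and $(1)_\varepsilon$, $0<\varepsilon\le\varepsilon_0$, have weak solutions $q_\varepsilon$ on $[0,T^*]$ that are bounded in $L^\infty((0,T^*);L^\infty(\mathbb R))$ uniformly in $\varepsilon$, one has for every continuous compactly supported $g:\mathbb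 R\to\mathbb R$ $$\lim_{\varepsilon\to0^+}\ \max_{t\in[0,T^*]}\bigg|\int_{\mathbb R}\big(q(t,x)-q_\varepsilon(t,x)\big)g(x)\,dx\bigg|=0 ,$$ and the maximum is attained. -/

import Mathlib

open MeasureTheory Set Filter Topology

noncomputable section

/-- The (unnormalised) standard bump `exp (-1 / (1 - x ^ 2))` on `(-1, 1)`, extended by zero. -/
def stdBump (x : ℝ) : ℝ :=
  if |x| < 1 then Real.exp (-(1 / (1 - x ^ 2))) else 0

/-- The standard mollifier `φ_ε(x) = ε⁻¹ φ(x / ε)`, where `φ` is the bump normalised to have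
integral one. -/
def stdMollifier (ε x : ℝ) : ℝ :=
  ε⁻¹ * (stdBump (x / ε) / ∫ y, stdBump y)

/-- Convolution of real functions on the line, `(f ∗ g)(x) = ∫ f y * g (x - y) dy`. -/
def realConv (f g : ℝ → ℝ) : ℝ → ℝ :=
  convolution f g (ContinuousLinearMap.mul ℝ ℝ) volume

/-- The mollification `φ_ε ∗ f`. -/
def mollify (ε : ℝ) (f : ℝ → ℝ) : ℝ → ℝ :=
  realConv (stdMollifier ε) f

/-- `W` is a weak derivative of `V` on the real line. -/
def IsWeakDeriv (V W : ℝ → ℝ) : Prop :=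
  ∀ φ : ℝ → ℝ, ContDiff ℝ (⊤ : ℕ∞) φ → HasCompactSupport φ →
    ∫ x, V x * deriv φ x = -∫ x, W x * φ x

/-- `f` belongs to `L^∞_loc(ℝ)`. -/
def MemLinftyLoc (f : ℝ → ℝ) : Prop :=
  ∀ R : ℝ, MemLp f ⊤ (volume.restrict (Icc (-R) R))

/-- `V` is the continuous representative of an element of `W^{1,∞}_loc(ℝ)`. -/
structure MemW1InftyLoc (V : ℝ → ℝ) : Prop where
  continuous : Continuous V
  weakDeriv : ∃ W : ℝ → ℝ, MemLinftyLoc W ∧ IsWeakDeriv V W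

/-- `γ` belongs to `BV(ℝ)`: it is integrable and has a representative whose total variation on
the real line is finite. -/
structure MemBV (γ : ℝ → ℝ) : Prop where
  integrable : Integrable γ
  variation : ∃ γ' : ℝ → ℝ, γ' =ᵐ[volume] γ ∧ BoundedVariationOn γ' univ

/-- `q ∈ C([0,S]; L¹_loc(ℝ))`. -/
structure MemCL1Loc (S : ℝ) (q : ℝ → ℝ → ℝ) : Prop where
  locallyIntegrable : ∀ t ∈ Icc 0 S, LocallyIntegrable (q t)
  tendsto : ∀ R : ℝ, ∀ s ∈ Icc 0 S,
    Tendsto (fun t => ∫ x in Icc (-R) R, |q t x - q s x|) (𝓝[Icc 0 S] s) (𝓝 0)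

/-- `‖q‖ ≤ K` in `L^∞((0,S); L^∞(ℝ))`. -/
def LinftyBound (S K : ℝ) (q : ℝ → ℝ → ℝ) : Prop :=
  ∀ᵐ t ∂(volume.restrict (Ioo 0 S)), ∀ᵐ x, |q t x| ≤ K

/-- `q` is a weak solution on `(0,S) × ℝ` of
`∂ₜ q + ∂ₓ (v(x) V((γ ∗ q(t,·))(x)) q) = 0` with initial datum `q₀`.
Test functions are `C¹` with compact support in `(-42, S) × ℝ`. -/
structure IsWeakSolution (S : ℝ) (γ q₀ v V : ℝ → ℝ) (q : ℝ → ℝ → ℝ) : Prop where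
  memCL1Loc : MemCL1Loc S q
  aestronglyMeasurable :
    AEStronglyMeasurable (fun p : ℝ × ℝ => q p.1 p.2) (volume.restrict (Ioo 0 S ×ˢ univ))
  bounded : ∃ K : ℝ, LinftyBound S K q
  weak : ∀ φ : ℝ × ℝ → ℝ, ContDiff ℝ 1 φ → HasCompactSupport φ →
    tsupport φ ⊆ Ioo (-42) S ×ˢ univ →
    (∫ p in Ioo 0 S ×ˢ (univ : Set ℝ),
        q p.1 p.2 * (deriv (fun t => φ (t, p.2)) p.1
          + v p.2 * V (realConv γ (q p.1) p.2) * deriv (fun x => φ (p.1, x)) p.2))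
      + ∫ x, φ (0, x) * q₀ x = 0

/-- `q` is the weak solution on `[0,S]`: every weak solution on `[0,S]` agrees with it, as an
element of `C([0,S]; L¹_loc(ℝ))`. -/
structure IsUniqueWeakSolution (S : ℝ) (γ q₀ v V : ℝ → ℝ) (q : ℝ → ℝ → ℝ) : Prop where
  isWeakSolution : IsWeakSolution S γ q₀ v V q
  unique : ∀ q' : ℝ → ℝ → ℝ, IsWeakSolution S γ q₀ v V q' →
    ∀ t ∈ Icc 0 S, q' t =ᵐ[volume] q t

end

-- The velocity `v(x) V(w(t,x))`, with `w = γ * q`, is only measurable in `x`, so its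
-- characteristics cannot be obtained directly from an ODE theorem. The travel time `A(x) = ∫₀ˣ 1/v`
-- is bi-Lipschitz, with inverse `B`, and in the coordinate `y = A(x)` the equation `X' = v(X)
-- V(w(t,X))` becomes `Y' = V(w(t, B Y))`. A BV kernel convolved with a bounded density is
-- Lipschitz, hence so is this field, and it has a classical flow `Φ`. The characteristics are `X_t
-- = B ∘ Φ 0 t ∘ A`, and the solution is the density of the image of `q₀ dz`, that is, `∫ q(t) g = ∫
-- q₀ g(X_t)`.
--
-- Every weak solution has this form (`ae_eq_transportedDensity_of_weak`): its pairing with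
-- functions transported by the flow is constant in time. Such functions are merely Lipschitz, which
-- is why the weak formulation is extended in `weak_formulation_lipschitz`. Consequently the
-- nonlocal term along a characteristic is `∫ γ(X_t z - X_t ζ) q₀(ζ) dζ`; the density disappears and
-- `IsCharFlow` is a closed system for `X`. Existence, on a time depending only on bounds for the
-- data, is a contraction argument on `w` (`exists_isWeakSolution`).
--
-- Stability compares two flows through `A(X) - A'(X')`, whose time derivative no longer contains
-- the discontinuous velocities. They enter only through `A - A'`, which is locally uniformly small
-- when `v - v'` is small in `L¹_loc`. The difference of the nonlocal terms is controlled by the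
-- variation of `γ`, because the maps `X_t` have Lipschitz inverses. Nonlocality obstructs a direct
-- Gronwall argument: an estimate for `|z| ≤ R` needs closeness on a larger interval, up to tails of
-- `γ`. With an exponential weight in time, each such enlargement halves the main error
-- (`IsCharFlow.abs_sub_le_half`). Iteration from the trivial bound given by finite displacement
-- yields locally uniform convergence of characteristics, hence convergence of the pairings with
-- `g`. Uniqueness is stability for a constant family, and mollification preserves all bounds on the
-- data while converging to them.

/-! ### Expanding maps of the line and Lebesgue measure -/

/-- `T` is expanding with constant `c`: `|x - y| ≤ c |T x - T y|`. -/
def ExpandsWith (c : ℝ) (T : ℝ → ℝ) : Prop :=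
  0 ≤ c ∧ ∀ x y, |x - y| ≤ c * |T x - T y|

namespace ExpandsWith

variable {c : ℝ} {T : ℝ → ℝ}

theorem antilipschitz (h : ExpandsWith c T) : AntilipschitzWith c.toNNReal T :=
  AntilipschitzWith.of_le_mul_dist fun x y => by
    simpa [Real.dist_eq, Real.coe_toNNReal _ h.1] using h.2 x y

/-- On the line Lebesgue measure is one-dimensional Hausdorff measure, whose behaviour under
antilipschitz preimages needs no differentiability of `T`. -/
theorem volume_preimage_le (h : ExpandsWith c T) (s : Set ℝ) :
    volume (T ⁻¹' s) ≤ ENNReal.ofReal c * volume s := by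
  have := h.antilipschitz.hausdorffMeasure_preimage_le (d := 1) zero_le_one s
  rwa [hausdorffMeasure_real, ENNReal.rpow_one] at this

theorem quasiMeasurePreserving (h : ExpandsWith c T) (hT : Measurable T) :
    Measure.QuasiMeasurePreserving T volume volume := by
  refine ⟨hT, Measure.AbsolutelyContinuous.mk fun s hs h0 => ?_⟩
  rw [Measure.map_apply hT hs]
  have := h.volume_preimage_le s
  rwa [h0, mul_zero, nonpos_iff_eq_zero] at this

theorem map_le (h : ExpandsWith c T) (hT : Measurable T) :
    Measure.map T volume ≤ ENNReal.ofReal c • volume :=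
  Measure.le_iff.2 fun s hs => by
    rw [Measure.map_apply hT hs]; exact h.volume_preimage_le s

theorem lintegral_comp_le (h : ExpandsWith c T) (hT : Measurable T) {f : ℝ → ENNReal}
    (hf : AEMeasurable f) :
    ∫⁻ z, f (T z) ≤ ENNReal.ofReal c * ∫⁻ x, f x := by
  rw [← lintegral_map' (hf.mono_ac (h.quasiMeasurePreserving hT).absolutelyContinuous)
    hT.aemeasurable, ← smul_eq_mul, ← lintegral_smul_measure]
  exact lintegral_mono' (h.map_le hT) le_rfl

theorem integrable_comp (h : ExpandsWith c T) (hT : Measurable T) {f : ℝ → ℝ}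
    (hf : Integrable f) : Integrable fun z => f (T z) := by
  refine ⟨hf.1.comp_quasiMeasurePreserving (h.quasiMeasurePreserving hT), ?_⟩
  refine (h.lintegral_comp_le hT hf.1.enorm).trans_lt ?_
  exact ENNReal.mul_lt_top ENNReal.ofReal_lt_top hf.2

theorem integral_abs_comp_le (h : ExpandsWith c T) (hT : Measurable T) {f : ℝ → ℝ}
    (hf : Integrable f) : ∫ z, |f (T z)| ≤ c * ∫ x, |f x| := by
  have h1 := h.lintegral_comp_le hT hf.1.enorm
  simp_rw [← Real.norm_eq_abs]
  rw [integral_norm_eq_lintegral_enorm (h.integrable_comp hT hf).1,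
    integral_norm_eq_lintegral_enorm hf.1]
  have := ENNReal.toReal_mono (ENNReal.mul_ne_top ENNReal.ofReal_ne_top hf.2.ne) h1
  rwa [ENNReal.toReal_mul, ENNReal.toReal_ofReal h.1] at this

theorem ae_comp (h : ExpandsWith c T) (hT : Measurable T) {p : ℝ → Prop} (hp : ∀ᵐ x, p x) :
    ∀ᵐ z, p (T z) :=
  (h.quasiMeasurePreserving hT).ae hp

theorem comp {c' : ℝ} {T' : ℝ → ℝ} (h : ExpandsWith c T) (h' : ExpandsWith c' T') :
    ExpandsWith (c' * c) (T ∘ T') :=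
  ⟨mul_nonneg h'.1 h.1, fun x y => (h'.2 x y).trans <| by
    rw [mul_assoc]; exact mul_le_mul_of_nonneg_left (h.2 _ _) h'.1⟩

theorem const_sub (h : ExpandsWith c T) (x : ℝ) : ExpandsWith c fun z => x - T z :=
  ⟨h.1, fun a b => (h.2 a b).trans_eq <| by
    rw [abs_sub_comm]; congr 2; ring⟩

theorem injective (h : ExpandsWith c T) : Function.Injective T := h.antilipschitz.injective

end ExpandsWith

/-- The image of a null set under a Lipschitz map of the line is null. -/
theorem LipschitzWith.volume_image_eq_zero {K : NNReal} {S : ℝ → ℝ} (hS : LipschitzWith K S)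
    {s : Set ℝ} (hs : volume s = 0) : volume (S '' s) = 0 := by
  have := hS.hausdorffMeasure_image_le (d := 1) zero_le_one s
  rw [hausdorffMeasure_real, hs, mul_zero] at this
  exact nonpos_iff_eq_zero.1 this

/-- Change of variables for a monotone Lipschitz surjection of the line. -/
theorem LipschitzWith.integral_comp_mul_deriv_of_monotone {K : NNReal} {S : ℝ → ℝ}
    (hS : LipschitzWith K S) (hm : Monotone S) (hsurj : Function.Surjective S) (h : ℝ → ℝ) :
    ∫ x, h (S x) * deriv S x = ∫ z, h z := by
  set s : Set ℝ := {x | DifferentiableAt ℝ S x} with hs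
  have hsm : MeasurableSet s := measurableSet_of_differentiableAt ℝ S
  have hnull : volume sᶜ = 0 := by
    have : ∀ᵐ x, DifferentiableAt ℝ S x := hS.ae_differentiableAt_of_real
    rwa [ae_iff] at this
  -- The formula holds on the set of differentiability for arbitrary `h`. That set is conull by
  -- Rademacher, and so is its image, since a Lipschitz map sends null sets to null sets.
  have h1 := integral_image_eq_integral_deriv_smul_of_monotoneOn (f := S) (f' := deriv S) hsm
    (fun x hx => (DifferentiableAt.hasDerivAt hx).hasDerivWithinAt) (hm.monotoneOn s) h
  have e1 : s =ᵐ[volume] (univ : Set ℝ) := by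
    rw [ae_eq_univ]; exact hnull
  have e2 : (S '' s) =ᵐ[volume] (univ : Set ℝ) := by
    rw [ae_eq_univ]
    refine measure_mono_null ?_ (hS.volume_image_eq_zero hnull)
    intro y hy
    obtain ⟨x, rfl⟩ := hsurj y
    exact ⟨x, fun hx => hy ⟨x, hx, rfl⟩, rfl⟩
  rw [setIntegral_congr_set e1, setIntegral_congr_set e2, setIntegral_univ, setIntegral_univ] at h1
  rw [h1]
  simp [mul_comm]

theorem integrable_indicator_Icc_of_locallyIntegrable {f : ℝ → ℝ} (hf : LocallyIntegrable f)
    (R : ℝ) : Integrable ((Icc (-R) R).indicator f) :=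
  (integrable_indicator_iff measurableSet_Icc).2 (hf.integrableOn_isCompact isCompact_Icc)

/-- Composition with expanding maps tending to the identity is continuous in `L¹_loc`. -/
theorem tendsto_setIntegral_abs_comp_sub {ι : Type*} {l : Filter ι} {c : ℝ} {T : ι → ℝ → ℝ}
    {f : ℝ → ℝ} (hf : LocallyIntegrable f) {R : ℝ}
    (hexp : ∀ᶠ i in l, ExpandsWith c (T i)) (hmeas : ∀ᶠ i in l, Measurable (T i))
    (hT : ∀ η > 0, ∀ᶠ i in l, ∀ x ∈ Icc (-R) R, |T i x - x| ≤ η) :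
    Tendsto (fun i => ∫ x in Icc (-R) R, |f (T i x) - f x|) l (𝓝 0) := by
  -- The sign of `c` is known only eventually along `l`, so the constants are built from `|c|`.
  have hc' : 0 < |c| + 2 := by positivity
  -- The margin 1 keeps `T i x` inside the truncation interval once `T i` is within distance 1 of
  -- the identity.
  set F := (Icc (-(R + 1)) (R + 1)).indicator f with hF
  have hFi : Integrable F := integrable_indicator_Icc_of_locallyIntegrable hf _
  rw [Metric.tendsto_nhds]
  intro η hη
  obtain ⟨g, hgs, hgF, hgc, hgi⟩ := hFi.exists_hasCompactSupport_integral_sub_le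
    (ε := η / (2 * (|c| + 2))) (by positivity)
  have huc : UniformContinuous g := hgs.uniformContinuous_of_continuous hgc
  rw [Metric.uniformContinuous_iff] at huc
  have hvol : 0 < η / (4 * (2 * |R| + 1)) := by positivity
  obtain ⟨δ, hδ, hgδ⟩ := huc _ hvol
  filter_upwards [hexp, hmeas, hT (min (δ / 2) 1) (by positivity)] with i he hm hi
  have hFgi : Integrable fun x => F x - g x := hFi.sub hgi
  have hcomp : Integrable fun x => F (T i x) - g (T i x) := he.integrable_comp hm hFgi
  have hIg : IntegrableOn (fun x => |g (T i x) - g x|) (Icc (-R) R) :=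
    ((((he.integrable_comp hm hgi).sub hgi).abs)).integrableOn
  -- The outer terms are small by `L¹` approximation, the first one after composition with an
  -- expanding map; the middle term is small by uniform continuity of `g`.
  have key : ∀ x ∈ Icc (-R) R, |f (T i x) - f x| ≤
      |F (T i x) - g (T i x)| + |g (T i x) - g x| + |F x - g x| := by
    intro x hx
    have h1 := hi x hx
    have h2 := abs_le.1 (h1.trans (min_le_right _ _))
    have hx1 : F x = f x := indicator_of_mem (by constructor <;> linarith [hx.1, hx.2]) _
    have hx2 : F (T i x) = f (T i x) :=
      indicator_of_mem (by constructor <;> linarith [hx.1, hx.2]) _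
    rw [← hx1, ← hx2]
    calc |F (T i x) - F x| = |(F (T i x) - g (T i x)) + (g (T i x) - g x) - (F x - g x)| := by
          ring_nf
      _ ≤ _ := (abs_sub _ _).trans (add_le_add_left (abs_add_le _ _) _)
  have hnn : ∀ a : ℝ → ℝ, 0 ≤ᵐ[volume] fun x => |a x| := fun a => ae_of_all _ fun x => abs_nonneg _
  have b1 : ∫ x in Icc (-R) R, |F (T i x) - g (T i x)| ≤ c * (η / (2 * (|c| + 2))) :=
    (setIntegral_le_integral hcomp.abs (hnn _)).trans <|
      (he.integral_abs_comp_le hm hFgi).trans (mul_le_mul_of_nonneg_left hgF he.1)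
  have b3 : ∫ x in Icc (-R) R, |F x - g x| ≤ η / (2 * (|c| + 2)) :=
    (setIntegral_le_integral hFgi.abs (hnn _)).trans hgF
  have b2 : ∫ x in Icc (-R) R, |g (T i x) - g x| ≤ 2 * |R| * (η / (4 * (2 * |R| + 1))) := by
    refine (setIntegral_mono_on hIg (integrableOn_const (by simp)) measurableSet_Icc
      (g := fun _ => η / (4 * (2 * |R| + 1))) fun x hx => ?_).trans ?_
    · have := (hi x hx).trans (min_le_left _ _)
      have h3 := hgδ (a := T i x) (b := x) (by rw [Real.dist_eq]; linarith)
      rw [Real.dist_eq] at h3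
      exact h3.le
    · rw [setIntegral_const, smul_eq_mul]
      refine mul_le_mul_of_nonneg_right ?_ hvol.le
      rw [Measure.real, Real.volume_Icc, ENNReal.toReal_ofReal']
      refine max_le ?_ (by positivity)
      linarith [le_abs_self R]
  have hle : ∫ x in Icc (-R) R, |f (T i x) - f x| ≤
      c * (η / (2 * (|c| + 2))) + 2 * |R| * (η / (4 * (2 * |R| + 1))) + η / (2 * (|c| + 2)) := by
    refine (integral_mono_of_nonneg (ae_of_all _ fun x => abs_nonneg _)
      ((hcomp.abs.integrableOn.add hIg).add hFgi.abs.integrableOn)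
      ((ae_restrict_iff' measurableSet_Icc).2 (ae_of_all _ key))).trans ?_
    rw [integral_add' (hcomp.abs.integrableOn.add hIg) hFgi.abs.integrableOn,
      integral_add' hcomp.abs.integrableOn hIg]
    linarith
  have e1 : c * (η / (2 * (|c| + 2))) + η / (2 * (|c| + 2)) < η / 2 := by
    rw [abs_of_nonneg he.1] 
    have : 0 < c + 2 := by linarith [he.1]
    rw [← sub_pos]; field_simp; nlinarith
  have e2 : 2 * |R| * (η / (4 * (2 * |R| + 1))) < η / 2 := by
    have := abs_nonneg R
    rw [← sub_pos]; field_simp; nlinarith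
  rw [Real.dist_eq, sub_zero, abs_of_nonneg (integral_nonneg fun x => abs_nonneg _)]
  linarith

/-! ### Kernels of bounded variation -/

/-- On `(-n, n)` the two shifted integrals cancel except on two end intervals of length `2δ`, where
`|p| ≤ b`. The resulting bound does not depend on `n`. -/
theorem Monotone.lintegral_shift_sub_le {p : ℝ → ℝ} (hp : Monotone p) {b : ℝ}
    (hb : ∀ x, |p x| ≤ b) {δ : ℝ} (hδ : 0 ≤ δ) :
    ∫⁻ x, ENNReal.ofReal (p (x + δ) - p (x - δ)) ≤ ENNReal.ofReal (4 * b * δ) := by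
  have hm1 : Measurable fun x => p (x + δ) := hp.measurable.comp (measurable_id.add_const δ)
  have hm2 : Measurable fun x => p (x - δ) := hp.measurable.comp (measurable_id.sub_const δ)
  have hcov : AECover (volume : Measure ℝ) atTop fun n : ℕ => Ioc (-(n : ℝ)) n :=
    aecover_Ioc (tendsto_neg_atTop_atBot.comp tendsto_natCast_atTop_atTop)
      tendsto_natCast_atTop_atTop
  refine le_of_tendsto' (hcov.lintegral_tendsto_of_countably_generated
    (hm1.sub hm2).ennreal_ofReal.aemeasurable) fun n => ?_
  have hI : ∀ a b : ℝ, IntervalIntegrable p volume a b := fun a b =>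
    (hp.monotoneOn _).intervalIntegrable
  have hi1 : IntervalIntegrable (fun x => p (x + δ)) volume (-n) n :=
    Monotone.intervalIntegrable fun x y h => hp (by linarith)
  have hi2 : IntervalIntegrable (fun x => p (x - δ)) volume (-n) n :=
    Monotone.intervalIntegrable fun x y h => hp (by linarith)
  have hn : (-(n : ℝ)) ≤ n := by linarith [n.cast_nonneg (α := ℝ)]
  rw [← ofReal_integral_eq_lintegral_ofReal
      ((intervalIntegrable_iff_integrableOn_Ioc_of_le hn).1 (hi1.sub hi2))
      (ae_of_all _ fun x => sub_nonneg.2 (hp (by linarith))),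
    ← intervalIntegral.integral_of_le hn, intervalIntegral.integral_sub hi1 hi2,
    intervalIntegral.integral_comp_add_right, intervalIntegral.integral_comp_sub_right]
  refine ENNReal.ofReal_le_ofReal ?_
  rw [intervalIntegral.integral_interval_sub_interval_comm (hI _ _) (hI _ _) (hI _ _)]
  have h1 := intervalIntegral.norm_integral_le_of_norm_le_const (f := p) (C := b)
    (a := -(n : ℝ) + δ) (b := -n - δ) fun x _ => hb x
  have h2 := intervalIntegral.norm_integral_le_of_norm_le_const (f := p) (C := b)
    (a := (n : ℝ) + δ) (b := n - δ) fun x _ => hb x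
  have e1 : |(-(n : ℝ) - δ - (-n + δ))| = 2 * δ := by
    rw [show (-(n : ℝ) - δ - (-n + δ)) = -(2 * δ) by ring, abs_neg, abs_of_nonneg (by linarith)]
  have e2 : |((n : ℝ) - δ - (n + δ))| = 2 * δ := by
    rw [show ((n : ℝ) - δ - (n + δ)) = -(2 * δ) by ring, abs_neg, abs_of_nonneg (by linarith)]
  rw [e1] at h1
  rw [e2] at h2
  rw [Real.norm_eq_abs] at h1 h2
  linarith [(abs_le.1 h1).2, (abs_le.1 h2).1]

/-- An integrable kernel, bounded by `G`, whose `L¹` modulus of continuity along expanding maps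
is controlled by `κ`. -/
structure IsBVKernel (γ : ℝ → ℝ) (G κ : ℝ) : Prop where
  measurable : Measurable γ
  integrable : Integrable γ
  bound : ∀ x, |γ x| ≤ G
  nonneg : 0 ≤ κ
  lintegral_comp_sub_le : ∀ (c δ : ℝ) (F H : ℝ → ℝ) (E : Set ℝ), ExpandsWith c F → Measurable F →
    MeasurableSet E → 0 ≤ δ → (∀ z ∈ E, |F z - H z| ≤ δ) →
    ∫⁻ z in E, ‖γ (F z) - γ (H z)‖ₑ ≤ ENNReal.ofReal (c * κ * δ)

/-- With `p` the variation function of `γ`, the difference at points of distance at most `δ` is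
bounded by `p (F z + δ) - p (F z - δ)`. This involves `F` alone, so only `F` has to be expanding for
the change of variables. -/
theorem BoundedVariationOn.isBVKernel {γ : ℝ → ℝ} (hbv : BoundedVariationOn γ univ)
    (hi : Integrable γ) : ∃ G κ, IsBVKernel γ G κ := by
  have hloc := hbv.locallyBoundedVariationOn
  set b := (eVariationOn γ univ).toReal
  set p := variationOnFromTo γ univ 0 with hp
  have hpm : Monotone p := monotoneOn_univ.1 (variationOnFromTo.monotoneOn hloc (mem_univ _))
  have hpb : ∀ x, |p x| ≤ b := fun x => variationOnFromTo.abs_le_eVariationOn hbv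
  refine ⟨|γ 0| + b, 4 * b, ?_, hi, fun x => ?_, by positivity, ?_⟩
  -- Measurability: `γ` is the difference of the monotone functions `p` and `p - γ`.
  · have h2 : Monotone (p - γ) :=
      monotoneOn_univ.1 (variationOnFromTo.sub_self_monotoneOn hloc (mem_univ _))
    have := hpm.measurable.sub h2.measurable
    rwa [sub_sub_cancel] at this
  · have := hbv.dist_le (mem_univ x) (mem_univ (0 : ℝ))
    rw [Real.dist_eq] at this
    calc |γ x| = |γ 0 + (γ x - γ 0)| := by ring_nf
      _ ≤ _ := (abs_add_le _ _).trans (by linarith)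
  · intro c δ F H E hF hFm hE hδ hFH
    have key : ∀ z ∈ E, ‖γ (F z) - γ (H z)‖ₑ ≤ ENNReal.ofReal (p (F z + δ) - p (F z - δ)) := by
      intro z hz
      rw [← ofReal_norm, Real.norm_eq_abs]
      refine ENNReal.ofReal_le_ofReal ?_
      have hz' := abs_le.1 (hFH z hz)
      have m1 := hpm (show F z - δ ≤ H z by linarith)
      have m2 := hpm (show H z ≤ F z + δ by linarith)
      have m3 := hpm (show F z - δ ≤ F z by linarith)
      have m4 := hpm (show F z ≤ F z + δ by linarith)
      rcases le_total (F z) (H z) with h | h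
      · rw [abs_sub_comm]
        have := variationOnFromTo.abs_sub_le_sub_of_le hloc (mem_univ (0:ℝ)) (mem_univ _)
          (mem_univ _) h
        linarith
      · have := variationOnFromTo.abs_sub_le_sub_of_le hloc (mem_univ (0:ℝ)) (mem_univ _)
          (mem_univ _) h
        linarith
    have hmeas : Measurable fun x => ENNReal.ofReal (p (x + δ) - p (x - δ)) :=
      ((hpm.measurable.comp (measurable_id.add_const δ)).sub
        (hpm.measurable.comp (measurable_id.sub_const δ))).ennreal_ofReal
    calc ∫⁻ z in E, ‖γ (F z) - γ (H z)‖ₑ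
        ≤ ∫⁻ z in E, ENNReal.ofReal (p (F z + δ) - p (F z - δ)) := setLIntegral_mono' hE key
      _ ≤ ∫⁻ z, ENNReal.ofReal (p (F z + δ) - p (F z - δ)) := setLIntegral_le_lintegral _ _
      _ ≤ ENNReal.ofReal c * ∫⁻ x, ENNReal.ofReal (p (x + δ) - p (x - δ)) :=
          hF.lintegral_comp_le hFm hmeas.aemeasurable
      _ ≤ ENNReal.ofReal c * ENNReal.ofReal (4 * b * δ) := by
          gcongr; exact hpm.lintegral_shift_sub_le hpb hδ
      _ = _ := by rw [← ENNReal.ofReal_mul hF.1]; ring_nf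

namespace IsBVKernel

variable {γ : ℝ → ℝ} {G κ c c' δ : ℝ} {F H : ℝ → ℝ} {E : Set ℝ}

theorem setIntegral_abs_comp_sub_le (h : IsBVKernel γ G κ) (hF : ExpandsWith c F)
    (hFm : Measurable F) (hHm : Measurable H) (hE : MeasurableSet E) (hδ : 0 ≤ δ)
    (hFH : ∀ z ∈ E, |F z - H z| ≤ δ) :
    ∫ z in E, |γ (F z) - γ (H z)| ≤ c * κ * δ := by
  have hm : Measurable fun z => γ (F z) - γ (H z) :=
    (h.measurable.comp hFm).sub (h.measurable.comp hHm)
  simp_rw [← Real.norm_eq_abs]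
  rw [integral_norm_eq_lintegral_enorm hm.aestronglyMeasurable]
  refine ENNReal.toReal_le_of_le_ofReal (mul_nonneg (mul_nonneg hF.1 h.nonneg) hδ) ?_
  exact h.lintegral_comp_sub_le c δ F H E hF hFm hE hδ hFH

theorem abs_integral_comp_sub_le (h : IsBVKernel γ G κ) (hF : ExpandsWith c F)
    (hFm : Measurable F) (hH : ExpandsWith c' H) (hHm : Measurable H) (hδ : 0 ≤ δ)
    (hFH : ∀ z, |F z - H z| ≤ δ) {f : ℝ → ℝ} {N : ℝ} (hN : ∀ z, |f z| ≤ N) (hf : Measurable f) :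
    |(∫ z, γ (F z) * f z) - ∫ z, γ (H z) * f z| ≤ N * (c * κ * δ) := by
  have hN0 : 0 ≤ N := (abs_nonneg _).trans (hN 0)
  have i1 : ∀ {a : ℝ → ℝ} {k : ℝ}, ExpandsWith k a → Measurable a →
      Integrable fun z => γ (a z) * f z := fun ha hm =>
    (ha.integrable_comp hm h.integrable).mul_bdd (c := N) hf.aestronglyMeasurable
      (ae_of_all _ hN)
  have hd : Integrable fun z => γ (F z) - γ (H z) :=
    (hF.integrable_comp hFm h.integrable).sub (hH.integrable_comp hHm h.integrable)
  rw [← integral_sub (i1 hF hFm) (i1 hH hHm)]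
  refine (abs_integral_le_integral_abs).trans ?_
  have h1 := h.setIntegral_abs_comp_sub_le hF hFm hHm MeasurableSet.univ hδ fun z _ => hFH z
  rw [setIntegral_univ] at h1
  refine le_trans ?_ (mul_le_mul_of_nonneg_left h1 hN0)
  rw [← integral_const_mul]
  refine integral_mono_of_nonneg (ae_of_all _ fun z => abs_nonneg _) (hd.abs.const_mul N)
    (ae_of_all _ fun z => ?_)
  simp only
  rw [← sub_mul, abs_mul, mul_comm]
  exact mul_le_mul_of_nonneg_right (hN z) (abs_nonneg _)

theorem abs_integral_comp_le (h : IsBVKernel γ G κ) (hF : ExpandsWith c F)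
    (hFm : Measurable F) {f : ℝ → ℝ} {N : ℝ} (hN : ∀ z, |f z| ≤ N) :
    |∫ z, γ (F z) * f z| ≤ N * (c * ∫ x, |γ x|) := by
  have hN0 : 0 ≤ N := (abs_nonneg _).trans (hN 0)
  refine (abs_integral_le_integral_abs).trans ?_
  refine le_trans ?_ (mul_le_mul_of_nonneg_left (hF.integral_abs_comp_le hFm h.integrable) hN0)
  rw [← integral_const_mul]
  refine integral_mono_of_nonneg (ae_of_all _ fun z => abs_nonneg _)
    ((hF.integrable_comp hFm h.integrable).abs.const_mul N) (ae_of_all _ fun z => ?_)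
  simp only
  rw [abs_mul, mul_comm]
  exact mul_le_mul_of_nonneg_right (hN z) (abs_nonneg _)

end IsBVKernel

/-! ### Flows of bounded Lipschitz fields on the line -/

/-- A time-dependent field on the line, continuous in time, uniformly `K`-Lipschitz in space and
bounded by `C`. -/
structure IsLipschitzField (K : NNReal) (C : ℝ) (μ : ℝ → ℝ → ℝ) : Prop where
  lipschitz : ∀ t, LipschitzWith K (μ t)
  bound : ∀ t x, |μ t x| ≤ C
  continuous : ∀ x, Continuous fun t => μ t x

/-- `Φ s t z` is the position at time `t` of the trajectory through `z` at time `s`. -/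
structure IsFlow (μ : ℝ → ℝ → ℝ) (Φ : ℝ → ℝ → ℝ → ℝ) : Prop where
  self : ∀ s z, Φ s s z = z
  hasDerivAt : ∀ s t z, HasDerivAt (fun t => Φ s t z) (μ t (Φ s t z)) t

namespace IsLipschitzField

variable {K : NNReal} {C : ℝ} {μ : ℝ → ℝ → ℝ}

theorem C_nonneg (h : IsLipschitzField K C μ) : 0 ≤ C := (abs_nonneg _).trans (h.bound 0 0)

theorem eq_of_eq (h : IsLipschitzField K C μ) {f g : ℝ → ℝ} {a b s : ℝ} (hs : s ∈ Ioo a b)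
    (hf : ∀ t ∈ Ioo a b, HasDerivAt f (μ t (f t)) t)
    (hg : ∀ t ∈ Ioo a b, HasDerivAt g (μ t (g t)) t) (heq : f s = g s) :
    EqOn f g (Ioo a b) :=
  ODE_solution_unique_of_mem_Ioo (v := μ) (s := fun _ => univ) (K := K)
    (fun t _ => (h.lipschitz t).lipschitzOnWith) hs (fun t ht => ⟨hf t ht, trivial⟩)
    (fun t ht => ⟨hg t ht, trivial⟩) heq

theorem exists_local (h : IsLipschitzField K C μ) (s z : ℝ) (n : ℕ) :
    ∃ α : ℝ → ℝ, α s = z ∧ ∀ t ∈ Ioo (s - (n + 1)) (s + (n + 1)), HasDerivAt α (μ t (α t)) t := by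
  have hn : (0 : ℝ) < n + 1 := by positivity
  have hs : s ∈ Icc (s - (n + 1)) (s + (n + 1)) := ⟨by linarith, by linarith⟩
  -- The field is bounded by `C` everywhere, so a ball of radius `C * (n + 1)` cannot be left within
  -- time `n + 1`.
  have hpl : IsPicardLindelof μ (⟨s, hs⟩ : Icc (s - (n + 1)) (s + (n + 1))) z
      (C.toNNReal * (n + 1)) 0 C.toNNReal K := by
    refine ⟨fun t _ => (h.lipschitz t).lipschitzOnWith, fun x _ => (h.continuous x).continuousOn,
      fun t _ x _ => ?_, ?_⟩
    · rw [Real.coe_toNNReal _ h.C_nonneg]; exact h.bound t x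
    · simp
  obtain ⟨α, h0, hα⟩ := hpl.exists_eq_forall_mem_Icc_hasDerivWithinAt₀
  exact ⟨α, h0, fun t ht => (hα t (Ioo_subset_Icc_self ht)).hasDerivAt (Icc_mem_nhds ht.1 ht.2)⟩

theorem exists_global (h : IsLipschitzField K C μ) (s z : ℝ) :
    ∃ α : ℝ → ℝ, α s = z ∧ ∀ t, HasDerivAt α (μ t (α t)) t := by
  choose α h0 hα using h.exists_local s z
  have hcons : ∀ m n : ℕ, m ≤ n → EqOn (α m) (α n) (Ioo (s - (m + 1)) (s + (m + 1))) := by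
    intro m n hmn
    have hm : (m : ℝ) ≤ n := by exact_mod_cast hmn
    have hm0 : (0 : ℝ) ≤ m := m.cast_nonneg
    refine h.eq_of_eq (s := s) ⟨by linarith, by linarith⟩ (hα m) (fun t ht => hα n t ?_) ?_
    · exact ⟨by linarith [ht.1], by linarith [ht.2]⟩
    · rw [h0, h0]
  -- At time `t` the local solution of index `⌈|t - s|⌉₊` is used; its open interval reaches one
  -- unit further and so contains a neighbourhood of `t`, where all later local solutions agree with
  -- it.
  set N : ℝ → ℕ := fun t => ⌈|t - s|⌉₊ with hN
  have hmem : ∀ t, t ∈ Ioo (s - (N t + 1)) (s + (N t + 1)) := by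
    intro t
    have h1 : |t - s| ≤ N t := Nat.le_ceil _
    have h2 := abs_le.1 h1
    constructor <;> linarith
  refine ⟨fun t => α (N t) t, h0 _, fun t => ?_⟩
  have heq : (fun t' => α (N t') t') =ᶠ[𝓝 t] α (N t) := by
    filter_upwards [Ioo_mem_nhds (hmem t).1 (hmem t).2] with t' ht'
    rcases le_total (N t) (N t') with hle | hle
    · exact (hcons _ _ hle ht').symm
    · exact hcons _ _ hle (hmem t')
  exact (hα (N t) t (hmem t)).congr_of_eventuallyEq heq

theorem exists_flow (h : IsLipschitzField K C μ) : ∃ Φ, IsFlow μ Φ := by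
  choose Φ h0 hΦ using h.exists_global
  exact ⟨fun s t z => Φ s z t, h0, fun s t z => hΦ s z t⟩

theorem unique (h : IsLipschitzField K C μ) {f g : ℝ → ℝ} {s : ℝ}
    (hf : ∀ t, HasDerivAt f (μ t (f t)) t) (hg : ∀ t, HasDerivAt g (μ t (g t)) t)
    (heq : f s = g s) : f = g :=
  ODE_solution_unique_univ (v := μ) (s := fun _ => univ) (K := K)
    (fun t => (h.lipschitz t).lipschitzOnWith) (fun t => ⟨hf t, trivial⟩)
    (fun t => ⟨hg t, trivial⟩) heq

end IsLipschitzField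

namespace IsFlow

variable {K : NNReal} {C : ℝ} {μ : ℝ → ℝ → ℝ} {Φ : ℝ → ℝ → ℝ → ℝ}

theorem comp (h : IsFlow μ Φ) (hμ : IsLipschitzField K C μ) (r s t z : ℝ) :
    Φ s t (Φ r s z) = Φ r t z :=
  congrFun (hμ.unique (s := s) (fun t => h.hasDerivAt s t _) (fun t => h.hasDerivAt r t z)
    (h.self s _)) t

theorem inverse (h : IsFlow μ Φ) (hμ : IsLipschitzField K C μ) (s t z : ℝ) :
    Φ t s (Φ s t z) = z := by rw [h.comp hμ, h.self]

theorem continuous_time (h : IsFlow μ Φ) (s z : ℝ) : Continuous fun t => Φ s t z :=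
  continuous_iff_continuousAt.2 fun t => (h.hasDerivAt s t z).continuousAt

theorem abs_sub_le (h : IsFlow μ Φ) (hμ : IsLipschitzField K C μ) (s t x y : ℝ) :
    |Φ s t x - Φ s t y| ≤ Real.exp (K * |t - s|) * |x - y| := by
  rcases le_total s t with hst | hst
  · have := dist_le_of_trajectories_ODE (v := μ) (K := K) (f := fun t => Φ s t x)
      (g := fun t => Φ s t y) (a := s) (b := t) (δ := |x - y|) hμ.lipschitz
      (h.continuous_time s x).continuousOn (fun t _ => (h.hasDerivAt s t x).hasDerivWithinAt)
      (h.continuous_time s y).continuousOn (fun t _ => (h.hasDerivAt s t y).hasDerivWithinAt)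
      (by simp [h.self, Real.dist_eq]) t ⟨hst, le_rfl⟩
    rw [abs_of_nonneg (sub_nonneg.2 hst), mul_comm]
    simpa [Real.dist_eq] using this
  -- For `t ≤ s` time is reversed, which turns `μ` into a field with the same Lipschitz constant.
  · have hd : ∀ z τ, HasDerivAt (fun τ => Φ s (-τ) z) (-μ (-τ) (Φ s (-τ) z)) τ := by
      intro z τ
      have := (h.hasDerivAt s (-τ) z).scomp τ (hasDerivAt_neg τ)
      simpa using! this
    have hc : ∀ z, Continuous fun τ => Φ s (-τ) z := fun z =>
      (h.continuous_time s z).comp continuous_neg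
    have := dist_le_of_trajectories_ODE (v := fun τ x => -μ (-τ) x) (K := K)
      (f := fun τ => Φ s (-τ) x)
      (g := fun τ => Φ s (-τ) y) (a := -s) (b := -t) (δ := |x - y|)
      (fun τ => (hμ.lipschitz (-τ)).neg)
      (hc x).continuousOn (fun t _ => (hd x t).hasDerivWithinAt)
      (hc y).continuousOn (fun t _ => (hd y t).hasDerivWithinAt)
      (by simp [h.self, Real.dist_eq]) (-t) ⟨neg_le_neg hst, le_rfl⟩
    rw [abs_of_nonpos (sub_nonpos.2 hst), mul_comm]
    have e : -(t - s) = -t - -s := by ring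
    rw [e]
    simpa [Real.dist_eq] using this

theorem lipschitz (h : IsFlow μ Φ) (hμ : IsLipschitzField K C μ) (s t : ℝ) :
    LipschitzWith (Real.exp (K * |t - s|)).toNNReal (Φ s t) :=
  LipschitzWith.of_dist_le_mul fun x y => by
    rw [Real.coe_toNNReal _ (Real.exp_pos _).le]
    exact h.abs_sub_le hμ s t x y

theorem continuous (h : IsFlow μ Φ) (hμ : IsLipschitzField K C μ) (s t : ℝ) :
    Continuous (Φ s t) := (h.lipschitz hμ s t).continuous

/-- The inverse of `Φ s t` is `Φ t s`, which has the same Lipschitz constant. -/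
theorem expandsWith (h : IsFlow μ Φ) (hμ : IsLipschitzField K C μ) (s t : ℝ) :
    ExpandsWith (Real.exp (K * |t - s|)) (Φ s t) := by
  refine ⟨(Real.exp_pos _).le, fun x y => ?_⟩
  have := h.abs_sub_le hμ t s (Φ s t x) (Φ s t y)
  rwa [h.inverse hμ, h.inverse hμ, abs_sub_comm s t] at this

theorem abs_sub_time_le (h : IsFlow μ Φ) (hμ : IsLipschitzField K C μ) (s t t' z : ℝ) :
    |Φ s t z - Φ s t' z| ≤ C * |t - t'| := by
  have := convex_univ.norm_image_sub_le_of_norm_hasDerivWithin_le (f := fun t => Φ s t z)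
    (f' := fun t => μ t (Φ s t z)) (C := C) (x := t') (y := t)
    (fun τ _ => (h.hasDerivAt s τ z).hasDerivWithinAt) (fun τ _ => hμ.bound _ _) trivial trivial
  simpa using this

theorem abs_sub_self_le (h : IsFlow μ Φ) (hμ : IsLipschitzField K C μ) (s t z : ℝ) :
    |Φ s t z - z| ≤ C * |t - s| := by
  simpa [h.self] using h.abs_sub_time_le hμ s t s z

theorem surjective (h : IsFlow μ Φ) (hμ : IsLipschitzField K C μ) (s t : ℝ) :
    Function.Surjective (Φ s t) := fun y => ⟨Φ t s y, h.inverse hμ t s y⟩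

/-- A continuous injection of the line is strictly monotone, and a decreasing one would move some
point by more than the maximal displacement `C * |t - s|`. -/
theorem strictMono (h : IsFlow μ Φ) (hμ : IsLipschitzField K C μ) (s t : ℝ) :
    StrictMono (Φ s t) := by
  rcases (h.continuous hμ s t).strictMono_of_inj (h.expandsWith hμ s t).injective with hm | hm
  · exact hm
  · exfalso
    have hC := hμ.C_nonneg
    have hp : 0 ≤ C * |t - s| := by positivity
    have h1 := hm (show (0 : ℝ) < 2 * (C * |t - s|) + 1 by linarith)
    have h2 := abs_le.1 (h.abs_sub_self_le hμ s t 0)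
    have h3 := abs_le.1 (h.abs_sub_self_le hμ s t (2 * (C * |t - s|) + 1))
    linarith [h2.2, h3.1]

/-- Used to show that the spatial derivative of `Φ s t` tends to 1 uniformly as the two times
approach each other. -/
theorem lipschitz_sub_id (h : IsFlow μ Φ) (hμ : IsLipschitzField K C μ) (s t : ℝ) :
    LipschitzWith (K * Real.exp (K * |t - s|) * |t - s|).toNNReal fun z => Φ s t z - z := by
  refine LipschitzWith.of_dist_le_mul fun x y => ?_
  rw [Real.coe_toNNReal _ (by positivity)]
  have := (convex_uIcc s t).norm_image_sub_le_of_norm_hasDerivWithin_le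
    (f := fun t => Φ s t x - Φ s t y)
    (f' := fun t => μ t (Φ s t x) - μ t (Φ s t y))
    (C := K * (Real.exp (K * |t - s|) * |x - y|)) (x := s) (y := t)
    (fun τ _ => ((h.hasDerivAt s τ x).sub (h.hasDerivAt s τ y)).hasDerivWithinAt)
    (fun τ hτ => ?_) left_mem_uIcc right_mem_uIcc
  · rw [Real.dist_eq, Real.dist_eq]
    simp only [h.self, Real.norm_eq_abs] at this
    calc _ = |Φ s t x - Φ s t y - (x - y)| := by ring_nf
      _ ≤ _ := this.trans_eq (by ring)
  · have h1 := (hμ.lipschitz τ).dist_le_mul (Φ s τ x) (Φ s τ y)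
    rw [Real.dist_eq, Real.dist_eq] at h1
    refine h1.trans (mul_le_mul_of_nonneg_left ((h.abs_sub_le hμ s τ x y).trans ?_) K.2)
    refine mul_le_mul_of_nonneg_right (Real.exp_le_exp.2 ?_) (abs_nonneg _)
    refine mul_le_mul_of_nonneg_left ?_ K.2
    exact abs_sub_left_of_mem_uIcc hτ

theorem abs_sub_initial_le (h : IsFlow μ Φ) (hμ : IsLipschitzField K C μ) (r s t x y : ℝ) :
    |Φ s r x - Φ t r y| ≤ Real.exp (K * |r - s|) * (|x - y| + C * |s - t|) := by
  have e : Φ t r y = Φ s r (Φ t s y) := (h.comp hμ t s r y).symm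
  rw [e]
  refine (h.abs_sub_le hμ s r _ _).trans (mul_le_mul_of_nonneg_left ?_ (Real.exp_pos _).le)
  have := h.abs_sub_self_le hμ t s y
  calc |x - Φ t s y| = |(x - y) - (Φ t s y - y)| := by ring_nf
    _ ≤ _ := (abs_sub _ _).trans (by linarith)

theorem continuous_initial (h : IsFlow μ Φ) (hμ : IsLipschitzField K C μ) (r : ℝ) :
    Continuous fun p : ℝ × ℝ => Φ p.1 r p.2 := by
  rw [continuous_iff_continuousAt]
  rintro ⟨s, x⟩
  refine tendsto_iff_dist_tendsto_zero.2 ?_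
  refine squeeze_zero (fun _ => dist_nonneg)
    (g := fun p : ℝ × ℝ => Real.exp (K * |r - s|) * (|x - p.2| + C * |s - p.1|)) (fun p => ?_) ?_
  · rw [Real.dist_eq, abs_sub_comm]; exact h.abs_sub_initial_le hμ r s p.1 x p.2
  · have : Continuous fun p : ℝ × ℝ =>
        Real.exp (K * |r - s|) * (|x - p.2| + C * |s - p.1|) := by fun_prop
    simpa using this.tendsto (s, x)

end IsFlow

/-! ### Straightening a discontinuous velocity -/

/-- The travel time from `0` to `x` with velocity `v`. -/
noncomputable def travelTime (v : ℝ → ℝ) (x : ℝ) : ℝ := ∫ s in (0 : ℝ)..x, (v s)⁻¹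

/-- The velocity `v` is positive, bounded by `M`, with reciprocal bounded by `a`, and `A`, `B` are
mutually inverse coordinates straightening it. -/
structure Straightens (a M : NNReal) (v A B : ℝ → ℝ) : Prop where
  measurable : Measurable v
  pos : ∀ x, 0 < v x
  le : ∀ x, v x ≤ M
  left_inv : ∀ x, B (A x) = x
  right_inv : ∀ y, A (B y) = y
  lipschitz : LipschitzWith a A
  lipschitz_inv : LipschitzWith M B
  mono : Monotone A
  mono_inv : Monotone B
  ae_hasDerivAt : ∀ᵐ x, HasDerivAt A (v x)⁻¹ x

/-- The derivative of the travel time lies between `M⁻¹` and `a`, so it is a bi-Lipschitz bijection;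
Lebesgue differentiation gives its derivative almost everywhere. -/
theorem exists_straightens {a M : NNReal} {v : ℝ → ℝ} (hv : Measurable v) (hpos : ∀ x, 0 < v x)
    (hle : ∀ x, v x ≤ M) (hinv : ∀ x, (v x)⁻¹ ≤ a) : ∃ B, Straightens a M v (travelTime v) B := by
  have hM : (0 : ℝ) < M := (hpos 0).trans_le (hle 0)
  have hn : ∀ s, ‖(v s)⁻¹‖ ≤ ‖(a : ℝ)‖ := fun s => by
    rw [Real.norm_eq_abs, abs_of_pos (inv_pos.2 (hpos s)), Real.norm_eq_abs, abs_of_nonneg a.coe_nonneg]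
    exact hinv s
  have hloc : ∀ x y : ℝ, IntervalIntegrable (fun s => (v s)⁻¹) volume x y := fun x y =>
    (intervalIntegrable_const (c := (a : ℝ))).mono_fun hv.inv.aestronglyMeasurable
      (ae_of_all _ hn)
  have hsub : ∀ x y, travelTime v y - travelTime v x = ∫ s in x..y, (v s)⁻¹ := fun x y =>
    intervalIntegral.integral_interval_sub_left (hloc _ _) (hloc _ _)
  have hlow : ∀ x y, x ≤ y → (M : ℝ)⁻¹ * (y - x) ≤ travelTime v y - travelTime v x := by
    intro x y hxy
    rw [hsub]
    have := intervalIntegral.integral_mono_on hxy (intervalIntegrable_const (c := (M : ℝ)⁻¹))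
      (hloc x y) fun s _ => inv_anti₀ (hpos s) (hle s)
    rwa [intervalIntegral.integral_const, smul_eq_mul, mul_comm] at this
  have hup : ∀ x y, x ≤ y → travelTime v y - travelTime v x ≤ a * (y - x) := by
    intro x y hxy
    rw [hsub]
    have := intervalIntegral.integral_mono_on hxy (hloc x y)
      (intervalIntegrable_const (c := (a : ℝ))) fun s _ => hinv s
    rwa [intervalIntegral.integral_const, smul_eq_mul, mul_comm] at this
  have hmono : StrictMono (travelTime v) := fun x y hxy => by
    have := hlow x y hxy.le
    have h2 : 0 < (M : ℝ)⁻¹ * (y - x) := mul_pos (inv_pos.2 hM) (sub_pos.2 hxy)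
    linarith
  have hLip : LipschitzWith a (travelTime v) := LipschitzWith.of_dist_le_mul fun x y => by
    wlog hxy : x ≤ y generalizing x y
    · rw [dist_comm, dist_comm x]; exact this y x (le_of_not_ge hxy)
    rw [Real.dist_eq, Real.dist_eq, abs_sub_comm, abs_of_nonneg (sub_nonneg.2 (hmono.monotone hxy)),
      abs_sub_comm, abs_of_nonneg (sub_nonneg.2 hxy)]
    exact hup x y hxy
  have htop : Tendsto (travelTime v) atTop atTop := by
    refine tendsto_atTop_mono' atTop ?_ (tendsto_id.const_mul_atTop (inv_pos.2 hM))
    filter_upwards [eventually_ge_atTop 0] with x hx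
    have := hlow 0 x hx
    simpa [travelTime] using this
  have hbot : Tendsto (travelTime v) atBot atBot := by
    refine tendsto_atBot_mono' atBot ?_ (tendsto_id.const_mul_atBot (inv_pos.2 hM))
    filter_upwards [eventually_le_atBot 0] with x hx
    have := hlow x 0 hx
    have h0 : travelTime v 0 = 0 := by simp [travelTime]
    rw [h0] at this
    simp only [id]
    linarith
  have hsurj := hLip.continuous.surjective htop hbot
  choose B hB using hsurj
  have hBA : ∀ x, B (travelTime v x) = x := fun x => hmono.injective (hB _)
  have hBm : Monotone B := fun x y hxy => by
    rw [← hmono.le_iff_le, hB, hB]; exact hxy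
  refine ⟨B, hv, hpos, hle, hBA, hB, hLip, ?_, hmono.monotone, hBm, ?_⟩
  · refine LipschitzWith.of_dist_le_mul fun x y => ?_
    wlog hxy : x ≤ y generalizing x y
    · rw [dist_comm, dist_comm x]; exact this y x (le_of_not_ge hxy)
    rw [Real.dist_eq, Real.dist_eq, abs_sub_comm, abs_of_nonneg (sub_nonneg.2 (hBm hxy)),
      abs_sub_comm, abs_of_nonneg (sub_nonneg.2 hxy)]
    have := hlow _ _ (hBm hxy)
    rw [hB, hB] at this
    rwa [inv_mul_le_iff₀ hM] at this
  · have hli : LocallyIntegrable fun s => (v s)⁻¹ :=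
      (locallyIntegrable_const (a : ℝ)).mono hv.inv.aestronglyMeasurable (ae_of_all _ hn)
    filter_upwards [LocallyIntegrable.ae_hasDerivAt_integral hli] with x hx using hx 0

namespace Straightens

variable {a M : NNReal} {v A B : ℝ → ℝ}

theorem expandsWith (h : Straightens a M v A B) : ExpandsWith M A :=
  ⟨M.2, fun x y => by simpa [h.left_inv, Real.dist_eq] using h.lipschitz_inv.dist_le_mul (A x) (A y)⟩

theorem expandsWith_inv (h : Straightens a M v A B) : ExpandsWith a B :=
  ⟨a.2, fun x y => by simpa [h.right_inv, Real.dist_eq] using h.lipschitz.dist_le_mul (B x) (B y)⟩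

theorem surjective (h : Straightens a M v A B) : Function.Surjective A := fun y => ⟨B y, h.right_inv y⟩

theorem surjective_inv (h : Straightens a M v A B) : Function.Surjective B :=
  fun x => ⟨A x, h.left_inv x⟩

theorem hasDerivAt_inv (h : Straightens a M v A B) {x : ℝ} (hx : HasDerivAt A (v x)⁻¹ x) :
    HasDerivAt B (v x) (A x) := by
  have hx' : HasDerivAt A (v x)⁻¹ (B (A x)) := by rwa [h.left_inv]
  have := HasDerivAt.of_local_left_inverse h.lipschitz_inv.continuous.continuousAt hx'
    (inv_ne_zero (h.pos x).ne') (Eventually.of_forall h.right_inv)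
  rwa [inv_inv] at this

end Straightens

/-! ### Characteristics and transported densities -/

/-- The characteristic starting at `z`. -/
def charCurve (A B : ℝ → ℝ) (Φ : ℝ → ℝ → ℝ → ℝ) (t z : ℝ) : ℝ := B (Φ 0 t (A z))

/-- The density of the image of `q₀ dz` under the characteristic flow, in straightened
coordinates. -/
noncomputable def straightDensity (q₀ B : ℝ → ℝ) (Φ : ℝ → ℝ → ℝ → ℝ) (t y : ℝ) : ℝ :=
  q₀ (B (Φ t 0 y)) * deriv B (Φ t 0 y) * deriv (Φ t 0) y

/-- The density of the image of `q₀ dz` under the characteristic flow. -/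
noncomputable def transportedDensity (q₀ A B : ℝ → ℝ) (Φ : ℝ → ℝ → ℝ → ℝ) (t x : ℝ) : ℝ :=
  straightDensity q₀ B Φ t (A x) * deriv A x

section Transport

variable {a M K : NNReal} {C N : ℝ} {v A B q₀ : ℝ → ℝ} {μ : ℝ → ℝ → ℝ} {Φ : ℝ → ℝ → ℝ → ℝ}

/-- Three monotone changes of variables: `y = A x`, then `η = Φ t 0 y`, then `η = A z`. No
regularity or integrability of `g` is required, so kernels and discontinuous integrands may be
inserted. -/
theorem integral_transportedDensity_mul (hc : Straightens a M v A B) (hμ : IsLipschitzField K C μ)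
    (hΦ : IsFlow μ Φ) (q₀ g : ℝ → ℝ) (t : ℝ) :
    ∫ x, transportedDensity q₀ A B Φ t x * g x = ∫ z, q₀ z * g (charCurve A B Φ t z) := by
  have h1 := hc.lipschitz.integral_comp_mul_deriv_of_monotone hc.mono hc.surjective
    fun y => straightDensity q₀ B Φ t y * g (B y)
  have h2 := (hΦ.lipschitz hμ t 0).integral_comp_mul_deriv_of_monotone
    (hΦ.strictMono hμ t 0).monotone (hΦ.surjective hμ t 0)
    fun η => q₀ (B η) * deriv B η * g (B (Φ 0 t η))
  have h3 := hc.lipschitz_inv.integral_comp_mul_deriv_of_monotone hc.mono_inv hc.surjective_inv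
    fun z => q₀ z * g (charCurve A B Φ t z)
  rw [← h3]
  calc _ = ∫ x, straightDensity q₀ B Φ t (A x) * g (B (A x)) * deriv A x := by
        refine integral_congr_ae (ae_of_all _ fun x => ?_)
        simp only [transportedDensity, hc.left_inv]; ring
    _ = ∫ y, straightDensity q₀ B Φ t y * g (B y) := h1
    _ = ∫ y, q₀ (B (Φ t 0 y)) * deriv B (Φ t 0 y) * g (B (Φ 0 t (Φ t 0 y))) * deriv (Φ t 0) y := by
        refine integral_congr_ae (ae_of_all _ fun x => ?_)
        simp only [straightDensity, hΦ.inverse hμ]; ring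
    _ = ∫ η, q₀ (B η) * deriv B η * g (B (Φ 0 t η)) := h2
    _ = _ := by
        refine integral_congr_ae (ae_of_all _ fun x => ?_)
        simp only [charCurve, hc.right_inv]; ring

theorem abs_straightDensity_le (hc : Straightens a M v A B) (hμ : IsLipschitzField K C μ)
    (hΦ : IsFlow μ Φ) (hN : ∀ z, |q₀ z| ≤ N) (t y : ℝ) :
    |straightDensity q₀ B Φ t y| ≤ N * M * Real.exp (K * |t|) := by
  have hN0 : 0 ≤ N := (abs_nonneg _).trans (hN 0)
  have h1 := norm_deriv_le_of_lipschitz hc.lipschitz_inv (x₀ := Φ t 0 y)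
  have h2 := norm_deriv_le_of_lipschitz (hΦ.lipschitz hμ t 0) (x₀ := y)
  rw [Real.coe_toNNReal _ (Real.exp_pos _).le, zero_sub, abs_neg] at h2
  rw [straightDensity, abs_mul, abs_mul]
  exact mul_le_mul (mul_le_mul (hN _) h1 (abs_nonneg _) hN0) h2 (abs_nonneg _)
    (mul_nonneg hN0 M.2)

theorem abs_transportedDensity_le (hc : Straightens a M v A B) (hμ : IsLipschitzField K C μ)
    (hΦ : IsFlow μ Φ) (hN : ∀ z, |q₀ z| ≤ N) (t x : ℝ) :
    |transportedDensity q₀ A B Φ t x| ≤ N * M * Real.exp (K * |t|) * a := by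
  rw [transportedDensity, abs_mul]
  have hN0 : 0 ≤ N := (abs_nonneg _).trans (hN 0)
  exact mul_le_mul (abs_straightDensity_le hc hμ hΦ hN _ _)
    (norm_deriv_le_of_lipschitz hc.lipschitz) (abs_nonneg _) (by positivity)

theorem measurable_straightDensity (hc : Straightens a M v A B) (hμ : IsLipschitzField K C μ)
    (hΦ : IsFlow μ Φ) (hq : Measurable q₀) :
    Measurable fun p : ℝ × ℝ => straightDensity q₀ B Φ p.1 p.2 := by
  have h1 : Measurable fun p : ℝ × ℝ => Φ p.1 0 p.2 := (hΦ.continuous_initial hμ 0).measurable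
  have h2 : Measurable fun p : ℝ × ℝ => deriv (Φ p.1 0) p.2 :=
    measurable_deriv_with_param (f := fun t y => Φ t 0 y) (hΦ.continuous_initial hμ 0)
  exact ((hq.comp (hc.lipschitz_inv.continuous.measurable.comp h1)).mul
    ((measurable_deriv B).comp h1)).mul h2

theorem measurable_transportedDensity (hc : Straightens a M v A B) (hμ : IsLipschitzField K C μ)
    (hΦ : IsFlow μ Φ) (hq : Measurable q₀) :
    Measurable fun p : ℝ × ℝ => transportedDensity q₀ A B Φ p.1 p.2 := by
  refine Measurable.mul ?_ ((measurable_deriv A).comp measurable_snd)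
  exact (measurable_straightDensity hc hμ hΦ hq).comp
    (measurable_fst.prodMk (hc.lipschitz.continuous.measurable.comp measurable_snd))

theorem expandsWith_charCurve (hc : Straightens a M v A B) (hμ : IsLipschitzField K C μ)
    (hΦ : IsFlow μ Φ) (t : ℝ) :
    ExpandsWith (M * Real.exp (K * |t|) * a) (charCurve A B Φ t) := by
  have := (hc.expandsWith_inv.comp (hΦ.expandsWith hμ 0 t)).comp hc.expandsWith
  rw [sub_zero] at this
  rw [mul_assoc]
  exact this

theorem continuous_charCurve (hc : Straightens a M v A B) (hμ : IsLipschitzField K C μ)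
    (hΦ : IsFlow μ Φ) : Continuous fun p : ℝ × ℝ => charCurve A B Φ p.1 p.2 := by
  have h1 : Continuous fun p : ℝ × ℝ => Φ 0 p.1 p.2 := by
    rw [continuous_iff_continuousAt]
    rintro ⟨s, x⟩
    refine tendsto_iff_dist_tendsto_zero.2 ?_
    refine squeeze_zero (fun _ => dist_nonneg)
      (g := fun p : ℝ × ℝ => C * |p.1 - s| + Real.exp (K * |s|) * |p.2 - x|) (fun p => ?_) ?_
    · refine (dist_triangle _ (Φ 0 s p.2) _).trans ?_
      rw [Real.dist_eq, Real.dist_eq]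
      have := hΦ.abs_sub_le hμ 0 s p.2 x
      rw [sub_zero] at this
      exact add_le_add (hΦ.abs_sub_time_le hμ 0 p.1 s p.2) this
    · have : Continuous fun p : ℝ × ℝ => C * |p.1 - s| + Real.exp (K * |s|) * |p.2 - x| := by
        fun_prop
      simpa using this.tendsto (s, x)
  exact hc.lipschitz_inv.continuous.comp
    (h1.comp (continuous_fst.prodMk (hc.lipschitz.continuous.comp continuous_snd)))

theorem abs_charCurve_sub_le (hc : Straightens a M v A B) (hμ : IsLipschitzField K C μ)
    (hΦ : IsFlow μ Φ) (t t' z : ℝ) :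
    |charCurve A B Φ t z - charCurve A B Φ t' z| ≤ M * C * |t - t'| := by
  have := hc.lipschitz_inv.dist_le_mul (Φ 0 t (A z)) (Φ 0 t' (A z))
  rw [Real.dist_eq, Real.dist_eq] at this
  rw [mul_assoc]
  exact this.trans (mul_le_mul_of_nonneg_left (hΦ.abs_sub_time_le hμ _ _ _ _) M.2)

theorem charCurve_zero (hc : Straightens a M v A B) (hΦ : IsFlow μ Φ) (z : ℝ) :
    charCurve A B Φ 0 z = z := by rw [charCurve, hΦ.self, hc.left_inv]

end Transport

section Transport

variable {a M K : NNReal} {C N : ℝ} {v A B q₀ : ℝ → ℝ} {μ : ℝ → ℝ → ℝ} {Φ : ℝ → ℝ → ℝ → ℝ}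

theorem locallyIntegrable_of_bdd {f : ℝ → ℝ} (hf : Measurable f) (hb : ∀ x, |f x| ≤ C) :
    LocallyIntegrable f :=
  (locallyIntegrable_const C).mono hf.aestronglyMeasurable
    (ae_of_all _ fun x => (hb x).trans (le_abs_self C))

/-- Chain rule for `Φ t 0 = Φ s 0 ∘ Φ t s`; the exceptional null set of `Φ s 0` pulls back to a null
set because `Φ t s` is expanding. Densities at different times can thus be compared through a map
close to the identity. -/
theorem straightDensity_ae_eq (hμ : IsLipschitzField K C μ) (hΦ : IsFlow μ Φ) (s t : ℝ) :
    ∀ᵐ y, straightDensity q₀ B Φ t y =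
      straightDensity q₀ B Φ s (Φ t s y) * deriv (Φ t s) y := by
  have h1 : ∀ᵐ y, DifferentiableAt ℝ (Φ t s) y := (hΦ.lipschitz hμ t s).ae_differentiableAt_of_real
  have h2 : ∀ᵐ y, DifferentiableAt ℝ (Φ s 0) y := (hΦ.lipschitz hμ s 0).ae_differentiableAt_of_real
  have h3 := (hΦ.expandsWith hμ t s).ae_comp (hΦ.continuous hμ t s).measurable h2
  filter_upwards [h1, h3] with y hy1 hy3
  have e : Φ t 0 = Φ s 0 ∘ Φ t s := funext fun z => (hΦ.comp hμ t s 0 z).symm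
  simp only [straightDensity]
  rw [hΦ.comp hμ t s 0 y]
  rw [e, deriv_comp y hy3 hy1]
  ring

theorem tendsto_straightDensity (hc : Straightens a M v A B) (hμ : IsLipschitzField K C μ)
    (hΦ : IsFlow μ Φ) (hq : Measurable q₀) (hN : ∀ z, |q₀ z| ≤ N) (R s : ℝ) :
    Tendsto (fun t => ∫ y in Icc (-R) R, |straightDensity q₀ B Φ t y - straightDensity q₀ B Φ s y|)
      (𝓝 s) (𝓝 0) := by
  set u := straightDensity q₀ B Φ with hu
  have hum : ∀ t, Measurable (u t) := fun t =>
    (measurable_straightDensity hc hμ hΦ hq).comp measurable_prodMk_left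
  set D := N * M * Real.exp (K * |s|) with hD
  have hub : ∀ y, |u s y| ≤ D := fun y => abs_straightDensity_le hc hμ hΦ hN s y
  have hD0 : 0 ≤ D := (abs_nonneg _).trans (hub 0)
  have hloc := locallyIntegrable_of_bdd (hum s) hub
  have hlim := tendsto_setIntegral_abs_comp_sub (l := 𝓝 s) (c := Real.exp K)
    (T := fun t => Φ t s) hloc (R := R) ?_ ?_ ?_
  · have hg : Continuous fun t : ℝ => K * Real.exp (K * |s - t|) * |s - t| := by fun_prop
    have hg0 := (hg.tendsto s)
    have hlim2 := ((Real.continuous_exp.comp (continuous_const.mul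
      ((continuous_const.sub continuous_id).abs)) :
      Continuous fun t => Real.exp (K * |s - t|)).tendsto s).mul hlim
    have hlim3 := hlim2.add ((hg0.const_mul D).mul_const (2 * |R|))
    simp only [sub_self, abs_zero, mul_zero, Real.exp_zero, add_zero, zero_mul] at hlim3
    refine squeeze_zero (fun t => integral_nonneg fun y => abs_nonneg _) (fun t => ?_) hlim3
    set e := Real.exp (K * |s - t|)
    set d := K * e * |s - t|
    have hd0 : 0 ≤ d := by positivity
    have hexp := hΦ.expandsWith hμ t s
    have hTm := (hΦ.continuous hμ t s).measurable
    have hint : IntegrableOn (fun y => |u s (Φ t s y) - u s y|) (Icc (-R) R) := by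
      have := (locallyIntegrable_of_bdd (C := D + D) ((hum s).comp hTm |>.sub (hum s))
        fun y => (abs_sub _ _).trans (add_le_add (hub _) (hub _)))
      exact (this.integrableOn_isCompact isCompact_Icc).abs
    have hb1 : ∀ᵐ y, |u t y - u s y| ≤ e * |u s (Φ t s y) - u s y| + D * d := by
      -- The difference splits into the composition error, which tends to zero in `L¹_loc`, and the
      -- error `deriv (Φ t s) - 1`, which tends to zero uniformly.
      filter_upwards [straightDensity_ae_eq (q₀ := q₀) (B := B) hμ hΦ s t,
        (hΦ.lipschitz hμ t s).ae_differentiableAt_of_real] with y hy hdiff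
      rw [hu, hy, ← hu]
      have h1 := norm_deriv_le_of_lipschitz (hΦ.lipschitz hμ t s) (x₀ := y)
      rw [Real.coe_toNNReal _ (Real.exp_pos _).le, Real.norm_eq_abs] at h1
      have h2 := norm_deriv_le_of_lipschitz (hΦ.lipschitz_sub_id hμ t s) (x₀ := y)
      rw [Real.coe_toNNReal _ (by positivity), Real.norm_eq_abs,
        (hdiff.hasDerivAt.fun_sub (hasDerivAt_id' y)).deriv] at h2
      calc |u s (Φ t s y) * deriv (Φ t s) y - u s y|
          = |deriv (Φ t s) y * (u s (Φ t s y) - u s y) + u s y * (deriv (Φ t s) y - 1)| := by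
            ring_nf
        _ ≤ |deriv (Φ t s) y| * |u s (Φ t s y) - u s y| + |u s y| * |deriv (Φ t s) y - 1| := by
            rw [← abs_mul, ← abs_mul]; exact abs_add_le _ _
        _ ≤ _ := by gcongr; exact hub y
    refine (integral_mono_of_nonneg (ae_of_all _ fun x => abs_nonneg _)
      ((hint.const_mul e).add (integrableOn_const (by simp))) (ae_restrict_of_ae hb1)).trans ?_
    rw [integral_add' (hint.const_mul e) (integrableOn_const (by simp)), integral_const_mul,
      setIntegral_const, smul_eq_mul]
    refine add_le_add le_rfl ?_
    rw [mul_comm]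
    refine mul_le_mul_of_nonneg_left ?_ (by positivity)
    rw [Measure.real, Real.volume_Icc, ENNReal.toReal_ofReal']
    exact max_le (by linarith [le_abs_self R]) (by positivity)
  · filter_upwards [Metric.ball_mem_nhds s one_pos] with t ht
    have := hΦ.expandsWith hμ t s
    refine ⟨(Real.exp_pos _).le, fun x y => (this.2 x y).trans ?_⟩
    refine mul_le_mul_of_nonneg_right (Real.exp_le_exp.2 ?_) (abs_nonneg _)
    rw [Metric.mem_ball, Real.dist_eq, abs_sub_comm] at ht
    exact mul_le_of_le_one_right K.2 ht.le
  · exact Eventually.of_forall fun t => (hΦ.continuous hμ t s).measurable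
  · intro η hη
    have : Tendsto (fun t => C * |s - t|) (𝓝 s) (𝓝 0) := by
      have : Continuous fun t => C * |s - t| := by fun_prop
      simpa using this.tendsto s
    filter_upwards [this.eventually (ge_mem_nhds hη)] with t ht x _
    exact (hΦ.abs_sub_self_le hμ t s x).trans ht

/-- The factor `deriv A` is the Jacobian of `y = A x`, so the `L¹` distance on `[-R, R]` is bounded
by that of the straightened densities on the interval `[-R', R']` containing the image. -/
theorem memCL1Loc_transportedDensity (hc : Straightens a M v A B) (hμ : IsLipschitzField K C μ)
    (hΦ : IsFlow μ Φ) (hq : Measurable q₀) (hN : ∀ z, |q₀ z| ≤ N) (S : ℝ) :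
    MemCL1Loc S (transportedDensity q₀ A B Φ) := by
  set u := straightDensity q₀ B Φ with hu
  have hum : ∀ t, Measurable (u t) := fun t =>
    (measurable_straightDensity hc hμ hΦ hq).comp measurable_prodMk_left
  refine ⟨fun t _ => locallyIntegrable_of_bdd
    ((measurable_transportedDensity hc hμ hΦ hq).comp measurable_prodMk_left)
    (abs_transportedDensity_le hc hμ hΦ hN t), fun R s _ => ?_⟩
  refine Tendsto.mono_left ?_ nhdsWithin_le_nhds
  set R' := |A 0| + a * |R| with hR'
  refine squeeze_zero (fun t => integral_nonneg fun y => abs_nonneg _) (fun t => ?_)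
    (tendsto_straightDensity hc hμ hΦ hq hN R' s)
  set h : ℝ → ℝ := (Icc (-R') R').indicator fun y => |u t y - u s y| with hh
  have hmap : ∀ x ∈ Icc (-R) R, A x ∈ Icc (-R') R' := by
    intro x hx
    have h1 := hc.lipschitz.dist_le_mul x 0
    rw [Real.dist_eq, Real.dist_eq, sub_zero] at h1
    have h2 : |x| ≤ |R| := (abs_le.2 hx).trans (le_abs_self R)
    have h3 : |A x| ≤ R' := by
      calc |A x| = |A 0 + (A x - A 0)| := by ring_nf
        _ ≤ |A 0| + |A x - A 0| := abs_add_le _ _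
        _ ≤ _ := by rw [hR']; gcongr; exact h1.trans (by gcongr)
    exact abs_le.1 h3
  have hA0 : ∀ x, 0 ≤ deriv A x := fun x => hc.mono.deriv_nonneg
  have hhn : ∀ y, 0 ≤ h y := fun y => indicator_nonneg (fun _ _ => abs_nonneg _) _
  have e1 : ∀ x ∈ Icc (-R) R, |transportedDensity q₀ A B Φ t x - transportedDensity q₀ A B Φ s x| =
      h (A x) * deriv A x := by
    intro x hx
    rw [hh, indicator_of_mem (hmap x hx), transportedDensity, transportedDensity, ← sub_mul,
      abs_mul, abs_of_nonneg (hA0 x)]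
  rw [setIntegral_congr_fun measurableSet_Icc e1]
  have hhm : Measurable h := ((hum t).sub (hum s)).abs.indicator measurableSet_Icc
  have hint : Integrable fun x => h (A x) * deriv A x := by
    have hi : Integrable h := by
      have := locallyIntegrable_of_bdd ((hum t).sub (hum s)) fun y => (abs_sub _ _).trans
        (add_le_add (abs_straightDensity_le hc hμ hΦ hN t y)
          (abs_straightDensity_le hc hμ hΦ hN s y))
      exact integrable_indicator_Icc_of_locallyIntegrable
        (f := fun y => |u t y - u s y|) (fun x => (this x).norm) _
    exact (hc.expandsWith.integrable_comp hc.lipschitz.continuous.measurable hi).mul_bdd (c := a)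
      (measurable_deriv A).aestronglyMeasurable
      (ae_of_all _ fun x => norm_deriv_le_of_lipschitz hc.lipschitz)
  calc _ ≤ ∫ x, h (A x) * deriv A x :=
        setIntegral_le_integral hint (ae_of_all _ fun x => mul_nonneg (hhn _) (hA0 _))
    _ = ∫ y, h y := hc.lipschitz.integral_comp_mul_deriv_of_monotone hc.mono hc.surjective h
    _ = _ := integral_indicator measurableSet_Icc

end Transport

/-! ### The weak formulation for transported densities -/

theorem integrableOn_strip {f : ℝ × ℝ → ℝ} {S c R : ℝ}
    (hf : AEStronglyMeasurable f (volume.restrict (Ioo 0 S ×ˢ univ)))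
    (hb : ∀ᵐ p ∂(volume.restrict (Ioo 0 S ×ˢ (univ : Set ℝ))), |f p| ≤ c)
    (h0 : ∀ p : ℝ × ℝ, p.1 ∈ Ioo 0 S → R < |p.2| → f p = 0) :
    IntegrableOn f (Ioo 0 S ×ˢ univ) := by
  have h1 : IntegrableOn f (Ioo 0 S ×ˢ Icc (-R) R) := by
    refine IntegrableOn.of_bound (C := c) ?_ (hf.mono_set (prod_mono le_rfl (subset_univ _))) ?_
    · rw [Measure.volume_eq_prod, Measure.prod_prod]
      exact ENNReal.mul_lt_top (by simp) (by simp)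
    · exact ae_restrict_of_ae_restrict_of_subset (prod_mono le_rfl (subset_univ _)) hb
  refine h1.of_forall_sdiff_eq_zero (measurableSet_Ioo.prod MeasurableSet.univ) fun p hp => ?_
  refine h0 p hp.1.1 ?_
  by_contra hcon
  exact hp.2 ⟨hp.1.1, abs_le.1 (not_lt.1 hcon)⟩

theorem DifferentiableAt.deriv_slice_fst {φ : ℝ × ℝ → ℝ} {p : ℝ × ℝ} (h : DifferentiableAt ℝ φ p) :
    deriv (fun t => φ (t, p.2)) p.1 = fderiv ℝ φ p (1, 0) := by
  have h1 : HasDerivAt (fun t : ℝ => (t, p.2)) ((1 : ℝ), (0 : ℝ)) p.1 :=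
    (hasDerivAt_id _).prodMk (hasDerivAt_const _ _)
  exact (HasFDerivAt.comp_hasDerivAt p.1 (f := fun t : ℝ => (t, p.2)) h.hasFDerivAt h1).deriv

theorem DifferentiableAt.deriv_slice_snd {φ : ℝ × ℝ → ℝ} {p : ℝ × ℝ} (h : DifferentiableAt ℝ φ p) :
    deriv (fun x => φ (p.1, x)) p.2 = fderiv ℝ φ p (0, 1) := by
  have h1 : HasDerivAt (fun x : ℝ => (p.1, x)) ((0 : ℝ), (1 : ℝ)) p.2 :=
    (hasDerivAt_const _ _).prodMk (hasDerivAt_id _)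
  exact (HasFDerivAt.comp_hasDerivAt p.2 (f := fun x : ℝ => (p.1, x)) h.hasFDerivAt h1).deriv

theorem exists_abs_le_of_mem_tsupport {φ : ℝ × ℝ → ℝ} (hφ : HasCompactSupport φ) :
    ∃ R, 0 ≤ R ∧ ∀ p ∈ tsupport φ, |p.1| ≤ R ∧ |p.2| ≤ R := by
  obtain ⟨R, hR⟩ := hφ.isCompact.isBounded.exists_norm_le
  refine ⟨max R 0, le_max_right _ _, fun p hp => ?_⟩
  have := (hR p hp).trans (le_max_left R 0)
  rw [Prod.norm_def] at this
  exact ⟨(le_max_left _ _).trans this, (le_max_right _ _).trans this⟩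

section Transport

variable {a M K : NNReal} {C N : ℝ} {v A B q₀ : ℝ → ℝ} {μ : ℝ → ℝ → ℝ} {Φ : ℝ → ℝ → ℝ → ℝ}

/-- The chain rule can fail only when the characteristic meets the null set where `A` lacks the
derivative `1/v`. At each fixed time this happens for a null set of labels, since the characteristic
map is expanding; Fubini exchanges the quantifiers, so almost every characteristic does so only at a
null set of times. -/
theorem Straightens.ae_hasDerivAt_charCurve (hc : Straightens a M v A B)
    (hμ : IsLipschitzField K C μ) (hΦ : IsFlow μ Φ) :
    ∀ᵐ z, ∀ᵐ t, HasDerivAt (fun t => charCurve A B Φ t z)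
      (v (charCurve A B Φ t z) * μ t (A (charCurve A B Φ t z))) t := by
  set X := charCurve A B Φ
  obtain ⟨P, hPsub, hPm, hPnull⟩ := exists_measurable_superset_of_null (ae_iff.1 hc.ae_hasDerivAt)
  have hXc : Continuous fun p : ℝ × ℝ => X p.1 p.2 := continuous_charCurve hc hμ hΦ
  have hms : MeasurableSet {p : ℝ × ℝ | X p.1 p.2 ∉ P} := (hXc.measurable hPm).compl
  have h1 : ∀ᵐ t : ℝ, ∀ᵐ z : ℝ, X t z ∉ P := ae_of_all _ fun t =>
    (expandsWith_charCurve hc hμ hΦ t).ae_comp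
      ((hXc.comp (continuous_const.prodMk continuous_id)).measurable) (compl_mem_ae_iff.2 hPnull)
  have h2 := (Measure.ae_ae_comm (μ := (volume : Measure ℝ)) (ν := (volume : Measure ℝ))
    (p := fun t z => X t z ∉ P) hms).1 h1
  filter_upwards [h2] with z hz
  filter_upwards [hz] with t ht
  have hd : HasDerivAt A (v (X t z))⁻¹ (X t z) := by
    by_contra hcon; exact ht (hPsub hcon)
  have hB := hc.hasDerivAt_inv hd
  have hAX : A (X t z) = Φ 0 t (A z) := hc.right_inv _
  rw [hAX] at hB ⊢
  exact hB.comp t (hΦ.hasDerivAt 0 t (A z))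

/-- In Lagrangian labels the integrand becomes `q₀ z` times the time derivative of `φ` along the
characteristic of `z`. Since `φ` vanishes at time `S`, this integrates to `-φ (0, z) * q₀ z`. -/
theorem weak_transportedDensity (hc : Straightens a M v A B) (hμ : IsLipschitzField K C μ)
    (hΦ : IsFlow μ Φ) (hμm : Measurable fun p : ℝ × ℝ => μ p.1 p.2) (hq : Measurable q₀)
    (hN : ∀ z, |q₀ z| ≤ N) {S : ℝ} (hS : 0 < S) {φ : ℝ × ℝ → ℝ} (hφ : ContDiff ℝ 1 φ)
    (hφc : HasCompactSupport φ) (hφs : tsupport φ ⊆ Ioo (-42) S ×ˢ univ) :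
    (∫ p in Ioo 0 S ×ˢ (univ : Set ℝ), transportedDensity q₀ A B Φ p.1 p.2 *
        (deriv (fun t => φ (t, p.2)) p.1
          + v p.2 * μ p.1 (A p.2) * deriv (fun x => φ (p.1, x)) p.2))
      + ∫ x, φ (0, x) * q₀ x = 0 := by
  have hN0 : 0 ≤ N := (abs_nonneg _).trans (hN 0)
  set X := charCurve A B Φ
  set q := transportedDensity q₀ A B Φ
  have hXc : Continuous fun p : ℝ × ℝ => X p.1 p.2 := continuous_charCurve hc hμ hΦ
  have hdiff : Differentiable ℝ φ := hφ.differentiable one_ne_zero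
  have hfc : Continuous (fderiv ℝ φ) := hφ.continuous_fderiv one_ne_zero
  obtain ⟨D, hD⟩ := (hfc.bounded_above_of_compact_support (hφc.fderiv ℝ))
  obtain ⟨R, hR0, hR⟩ := exists_abs_le_of_mem_tsupport hφc
  set ψ : ℝ × ℝ → ℝ := fun p => fderiv ℝ φ p (1, 0) + v p.2 * μ p.1 (A p.2) * fderiv ℝ φ p (0, 1)
    with hψ
  have hAm : Measurable A := hc.lipschitz.continuous.measurable
  have hψm : Measurable ψ :=
    (hfc.clm_apply continuous_const).measurable.add
      (((hc.measurable.comp measurable_snd).mul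
        (hμm.comp (measurable_fst.prodMk (hAm.comp measurable_snd)))).mul
        (hfc.clm_apply continuous_const).measurable)
  have hψ0 : ∀ p, p ∉ tsupport φ → ψ p = 0 := by
    intro p hp
    have : fderiv ℝ φ p = 0 := by
      by_contra hcon
      exact hp (support_fderiv_subset ℝ hcon)
    simp [hψ, this]
  have hone : ∀ w : ℝ × ℝ, ‖w‖ ≤ 1 → ∀ p, |fderiv ℝ φ p w| ≤ D := fun w hw p =>
    (ContinuousLinearMap.le_of_opNorm_le_of_le _ (hD p) hw).trans_eq (mul_one _)
  have hψb : ∀ p, |ψ p| ≤ D + M * C * D := by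
    intro p
    refine (abs_add_le _ _).trans (add_le_add (hone _ (by simp [Prod.norm_def]) p) ?_)
    rw [abs_mul, abs_mul]
    refine mul_le_mul (mul_le_mul ?_ (hμ.bound _ _) (abs_nonneg _) M.2)
      (hone _ (by simp [Prod.norm_def]) p) (abs_nonneg _) (mul_nonneg M.2 hμ.C_nonneg)
    rw [abs_of_pos (hc.pos _)]; exact hc.le _
  have hqm : Measurable fun p : ℝ × ℝ => q p.1 p.2 := measurable_transportedDensity hc hμ hΦ hq
  have hqb : ∀ p : ℝ × ℝ, p.1 ∈ Ioo 0 S → |q p.1 p.2| ≤ N * M * Real.exp (K * S) * a := by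
    intro p hp
    refine (abs_transportedDensity_le hc hμ hΦ hN _ _).trans ?_
    rw [abs_of_pos hp.1]
    gcongr
    exact hp.2.le
  have hmsS : MeasurableSet (Ioo 0 S ×ˢ (univ : Set ℝ)) := measurableSet_Ioo.prod MeasurableSet.univ
  have hD0 : 0 ≤ D + M * C * D := (abs_nonneg _).trans (hψb 0)
  have hi1 : IntegrableOn (fun p : ℝ × ℝ => q p.1 p.2 * ψ p) (Ioo 0 S ×ˢ univ) := by
    refine integrableOn_strip (c := N * M * Real.exp (K * S) * a * (D + M * C * D)) (R := R)
      (hqm.mul hψm).aestronglyMeasurable ?_ ?_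
    · refine (ae_restrict_iff' hmsS).2 (ae_of_all _ fun p hp => ?_)
      rw [abs_mul]
      exact mul_le_mul (hqb p hp.1) (hψb p) (abs_nonneg _) (by positivity)
    · intro p _ hp
      rw [hψ0 p fun h => absurd (hR p h).2 (not_le.2 hp), mul_zero]
  have hi2 : IntegrableOn (fun p : ℝ × ℝ => q₀ p.2 * ψ (p.1, X p.1 p.2)) (Ioo 0 S ×ˢ univ) := by
    refine integrableOn_strip (c := N * (D + M * C * D)) (R := R + M * C * S) ?_ ?_ ?_
    · exact ((hq.comp measurable_snd).mul
        (hψm.comp (measurable_fst.prodMk hXc.measurable))).aestronglyMeasurable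
    · refine (ae_restrict_iff' hmsS).2 (ae_of_all _ fun p hp => ?_)
      rw [abs_mul]
      exact mul_le_mul (hN _) (hψb _) (abs_nonneg _) hN0
    · intro p hpS hp
      rw [hψ0 _ fun h => ?_, mul_zero]
      have h1 := (hR _ h).2
      have h2 := abs_charCurve_sub_le hc hμ hΦ p.1 0 p.2
      rw [charCurve_zero hc hΦ, sub_zero, abs_of_pos hpS.1] at h2
      have h3 : (M : ℝ) * C * p.1 ≤ M * C * S :=
        mul_le_mul_of_nonneg_left hpS.2.le (mul_nonneg M.2 hμ.C_nonneg)
      have h4 : |p.2| ≤ |X p.1 p.2| + |X p.1 p.2 - p.2| := by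
        calc |p.2| = |X p.1 p.2 - (X p.1 p.2 - p.2)| := by ring_nf
          _ ≤ _ := abs_sub _ _
      linarith
  have hcurve : ∀ᵐ z : ℝ, ∫ t in Ioo 0 S, ψ (t, X t z) = -φ (0, z) := by
    filter_upwards [hc.ae_hasDerivAt_charCurve hμ hΦ] with z hz
    have hlip : LipschitzWith (max 1 (M * C.toNNReal)) fun t => (t, X t z) := by
      refine LipschitzWith.prodMk LipschitzWith.id (LipschitzWith.of_dist_le_mul fun t t' => ?_)
      rw [NNReal.coe_mul, Real.coe_toNNReal _ hμ.C_nonneg, Real.dist_eq, Real.dist_eq]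
      exact abs_charCurve_sub_le hc hμ hΦ t t' z
    -- The derivative along the curve exists only almost everywhere, so absolute continuity is what
    -- justifies the fundamental theorem.
    obtain ⟨Q, hQ⟩ := hφ.lipschitzWith_of_hasCompactSupport hφc one_ne_zero
    have hac := (hQ.comp hlip).lipschitzOnWith (s := uIcc 0 S) |>.absolutelyContinuousOnInterval
    have hftc := hac.integral_deriv_eq_sub
    have hend : φ (S, X S z) = 0 := image_eq_zero_of_notMem_tsupport fun h =>
      (lt_irrefl S) (hφs h).1.2
    have hX0 : X 0 z = z := charCurve_zero hc hΦ z
    simp only [Function.comp_apply] at hftc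
    rw [hend, hX0, zero_sub] at hftc
    rw [← hftc, intervalIntegral.integral_of_le hS.le, integral_Ioc_eq_integral_Ioo]
    refine integral_congr_ae (ae_restrict_of_ae ?_)
    filter_upwards [hz] with t ht
    have hp : HasDerivAt (fun t => (t, X t z)) (1, v (X t z) * μ t (A (X t z))) t :=
      (hasDerivAt_id t).prodMk ht
    have hcomp := HasFDerivAt.comp_hasDerivAt t (f := fun t => (t, X t z))
      (hdiff (t, X t z)).hasFDerivAt hp
    refine Eq.trans ?_ hcomp.deriv.symm
    have e : ((1 : ℝ), v (X t z) * μ t (A (X t z))) =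
        ((1 : ℝ), (0 : ℝ)) + (v (X t z) * μ t (A (X t z))) • ((0 : ℝ), (1 : ℝ)) := by simp
    rw [e, map_add, map_smul, smul_eq_mul]
  have hstep : ∫ p in Ioo 0 S ×ˢ (univ : Set ℝ), q p.1 p.2 * ψ p = - ∫ x, φ (0, x) * q₀ x := by
    rw [Measure.volume_eq_prod] at hi1 hi2 ⊢
    rw [setIntegral_prod _ hi1]
    have e1 : ∀ t, ∫ x in univ, q t x * ψ (t, x) = ∫ z in univ, q₀ z * ψ (t, X t z) := by
      intro t
      rw [setIntegral_univ, setIntegral_univ]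
      exact integral_transportedDensity_mul hc hμ hΦ q₀ (fun x => ψ (t, x)) t
    simp only [e1]
    have hsw := setIntegral_prod_swap (μ := (volume : Measure ℝ)) (ν := (volume : Measure ℝ))
      (Ioo 0 S) univ (fun p : ℝ × ℝ => q₀ p.2 * ψ (p.1, X p.1 p.2))
    rw [← setIntegral_prod (fun p : ℝ × ℝ => q₀ p.2 * ψ (p.1, X p.1 p.2)) hi2, ← hsw,
      setIntegral_prod (fun p : ℝ × ℝ => q₀ p.swap.2 * ψ (p.swap.1, X p.swap.1 p.swap.2)) hi2.swap,
      setIntegral_univ, ← integral_neg]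
    refine integral_congr_ae ?_
    filter_upwards [hcurve] with z hz
    simp only [Prod.fst_swap, Prod.snd_swap]
    rw [integral_const_mul, hz]
    ring
  rw [← sub_neg_eq_add, sub_eq_zero, ← hstep]
  refine integral_congr_ae (ae_of_all _ fun p => ?_)
  simp only [hψ, (hdiff p).deriv_slice_fst, (hdiff p).deriv_slice_snd]

end Transport

/-! ### Smooth approximation of Lipschitz test functions -/

/-- Mollification: the gradient of the mollified function is the mollified almost-everywhere
gradient. It keeps the bound `L` and converges at Lebesgue points, which is enough for dominated
convergence. -/
theorem LipschitzWith.exists_smooth_approx {L : NNReal} {φ : ℝ × ℝ → ℝ} (hφ : LipschitzWith L φ)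
    (hφc : HasCompactSupport φ) {U : Set (ℝ × ℝ)} (hU : IsOpen U) (hφU : tsupport φ ⊆ U) :
    ∃ k : Set (ℝ × ℝ), IsCompact k ∧ ∃ f : ℕ → ℝ × ℝ → ℝ,
      (∀ n, ContDiff ℝ 1 (f n)) ∧ (∀ n, tsupport (f n) ⊆ k) ∧ k ⊆ U ∧
      (∀ n p, ‖fderiv ℝ (f n) p‖ ≤ L) ∧ (∀ p, Tendsto (fun n => f n p) atTop (𝓝 (φ p))) ∧
      ∀ᵐ p, Tendsto (fun n => fderiv ℝ (f n) p) atTop (𝓝 (fderiv ℝ φ p)) := by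
  obtain ⟨δ, hδ, hδU⟩ := hφc.isCompact.exists_cthickening_subset_open hU hφU
  set r : ℕ → ℝ := fun n => δ / (n + 1)
  have hr : ∀ n, 0 < r n := fun n => by positivity
  -- The ratio 2 of outer to inner radius is fixed, as the Lebesgue point argument at the end
  -- requires.
  set ρ : ℕ → ContDiffBump (0 : ℝ × ℝ) := fun n =>
    ⟨r n / 2, r n, half_pos (hr n), half_lt_self (hr n)⟩ with hρ
  have hr0 : Tendsto (fun n => (ρ n).rOut) atTop (𝓝 0) :=
    ((tendsto_const_div_atTop_nhds_zero_nat δ).comp (tendsto_add_atTop_nat 1)).congr fun n => by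
      simp [hρ, r]
  have hrδ : ∀ n, r n ≤ δ := fun n => div_le_self hδ.le (by linarith [n.cast_nonneg (α := ℝ)])
  set f : ℕ → ℝ × ℝ → ℝ := fun n =>
    convolution ((ρ n).normed volume) φ (ContinuousLinearMap.lsmul ℝ ℝ) volume with hf
  have hcd : ∀ n, ContDiff ℝ 1 (f n) := fun n =>
    ((ρ n).hasCompactSupport_normed).contDiff_convolution_left (n := 1) _
      ((ρ n).contDiff_normed) hφ.continuous.locallyIntegrable
  have hsupp : ∀ n p, p ∉ Metric.thickening (r n) (tsupport φ) → f n p = 0 := by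
    intro n p hp
    have hz : ∀ x ∈ Metric.ball p (r n), φ x = 0 := by
      intro x hx
      refine image_eq_zero_of_notMem_tsupport fun hxs => hp ?_
      exact Metric.mem_thickening_iff.2 ⟨x, hxs, by rwa [Metric.mem_ball, dist_comm] at hx⟩
    have := ContDiffBump.normed_convolution_eq_right (φ := ρ n) (μ := volume) (g := φ) (x₀ := p)
      fun x hx => by rw [hz x hx, hz p (Metric.mem_ball_self (hr n))]
    rw [hf]
    exact this.trans (hz p (Metric.mem_ball_self (hr n)))
  have hdiff : ∀ᵐ p, DifferentiableAt ℝ φ p := hφ.ae_differentiableAt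
  have hfm : Measurable (fderiv ℝ φ) := measurable_fderiv ℝ φ
  have hfb : ∀ p, ‖fderiv ℝ φ p‖ ≤ L := fun p => norm_fderiv_le_of_lipschitz ℝ hφ
  -- The derivative is put on `φ`, not on the bump; differentiation under the integral needs only a
  -- Lipschitz integrand differentiable at almost every `y`.
  have hder : ∀ n p, HasFDerivAt (f n)
      (convolution ((ρ n).normed volume) (fderiv ℝ φ) (ContinuousLinearMap.lsmul ℝ ℝ) volume p)
      p := by
    intro n p
    have hρc : Continuous ((ρ n).normed volume) := (ρ n).continuous_normed
    have hρi : Integrable ((ρ n).normed volume) volume := (ρ n).integrable_normed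
    refine (hasFDerivAt_integral_of_dominated_loc_of_lip (μ := volume) (s := univ)
      (F := fun p y => (ρ n).normed volume y * φ (p - y)) (x₀ := p)
      (F' := fun y => (ρ n).normed volume y • fderiv ℝ φ (p - y))
      (bound := fun y => (ρ n).normed volume y * L) univ_mem ?_ ?_ ?_ ?_ (hρi.mul_const _) ?_).2
    · exact Eventually.of_forall fun x =>
        (hρc.mul (hφ.continuous.comp (continuous_const.sub continuous_id))).aestronglyMeasurable
    · refine Continuous.integrable_of_hasCompactSupport
        (hρc.mul (hφ.continuous.comp (continuous_const.sub continuous_id))) ?_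
      exact ((ρ n).hasCompactSupport_normed).mul_right
    · exact (hρc.measurable.aemeasurable.smul
        (hfm.comp (measurable_const.sub measurable_id)).aemeasurable).aestronglyMeasurable
    · refine ae_of_all _ fun y => LipschitzOnWith.of_dist_le_mul fun x _ z _ => ?_
      rw [Real.coe_nnabs, abs_of_nonneg (a := (ρ n).normed volume y * (L : ℝ)) (mul_nonneg ((ρ n).nonneg_normed y) L.2), Real.dist_eq,
        ← mul_sub, abs_mul, abs_of_nonneg ((ρ n).nonneg_normed y), mul_assoc]
      refine mul_le_mul_of_nonneg_left ?_ ((ρ n).nonneg_normed y)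
      have := hφ.dist_le_mul (x - y) (z - y)
      rwa [Real.dist_eq, dist_sub_right] at this
    · have : ∀ᵐ y, DifferentiableAt ℝ φ (p - y) :=
        (Measure.measurePreserving_sub_left volume p).quasiMeasurePreserving.ae hdiff
      filter_upwards [this] with y hy
      have h1 : HasFDerivAt (fun x => φ (x - y)) (fderiv ℝ φ (p - y)) p := by
        have := hy.hasFDerivAt.comp p ((hasFDerivAt_id p).sub_const y)
        simpa using! this
      exact h1.const_mul _
  have hli : LocallyIntegrable (fderiv ℝ φ) volume :=
    (locallyIntegrable_const (L : ℝ)).mono hfm.aestronglyMeasurable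
      (ae_of_all _ fun p => (hfb p).trans (le_abs_self _))
  refine ⟨Metric.cthickening δ (tsupport φ), hφc.isCompact.cthickening, f, hcd, fun n => ?_, hδU,
    fun n p => ?_, fun p => ?_, ?_⟩
  · refine closure_minimal (fun p hp => ?_) Metric.isClosed_cthickening
    by_contra hcon
    exact hp (hsupp n p fun h =>
      hcon (Metric.thickening_subset_cthickening_of_le (hrδ n) _ h))
  · rw [(hder n p).fderiv]
    have hb := norm_integral_le_of_norm_le (μ := volume) (f := fun y =>
      ContinuousLinearMap.lsmul ℝ ℝ ((ρ n).normed volume y) (fderiv ℝ φ (p - y)))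
      (((ρ n).integrable_normed (μ := volume)).mul_const (L : ℝ)) (ae_of_all _ fun y => by
        rw [ContinuousLinearMap.lsmul_apply, norm_smul, Real.norm_eq_abs,
          abs_of_nonneg ((ρ n).nonneg_normed y)]
        exact mul_le_mul_of_nonneg_left (hfb _) ((ρ n).nonneg_normed y))
    rw [integral_mul_const, (ρ n).integral_normed, one_mul] at hb
    exact hb
  · exact ContDiffBump.convolution_tendsto_right_of_continuous hr0 hφ.continuous p
  · have := ContDiffBump.ae_convolution_tendsto_right_of_locallyIntegrable (φ := ρ) (K := 2)
      (μ := volume) hr0 (Eventually.of_forall fun n => by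
        change r n ≤ 2 * (r n / 2); linarith) hli
    filter_upwards [this] with p hp
    exact hp.congr fun n => (hder n p).fderiv.symm

/-- A weak formulation tested against `C¹` functions extends to Lipschitz test functions. -/
theorem weak_formulation_lipschitz {q b : ℝ × ℝ → ℝ} {q₀ : ℝ → ℝ} {S Q D N : ℝ}
    (hqm : AEStronglyMeasurable q (volume.restrict (Ioo 0 S ×ˢ univ)))
    (hqb : ∀ᵐ p ∂(volume.restrict (Ioo 0 S ×ˢ (univ : Set ℝ))), |q p| ≤ Q)
    (hbm : AEStronglyMeasurable b (volume.restrict (Ioo 0 S ×ˢ univ)))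
    (hbb : ∀ᵐ p ∂(volume.restrict (Ioo 0 S ×ˢ (univ : Set ℝ))), |b p| ≤ D)
    (hq0 : Measurable q₀) (hN : ∀ x, |q₀ x| ≤ N)
    (hweak : ∀ φ : ℝ × ℝ → ℝ, ContDiff ℝ 1 φ → HasCompactSupport φ →
      tsupport φ ⊆ Ioo (-42) S ×ˢ univ →
      (∫ p in Ioo 0 S ×ˢ (univ : Set ℝ), q p * (deriv (fun t => φ (t, p.2)) p.1
          + b p * deriv (fun x => φ (p.1, x)) p.2)) + ∫ x, φ (0, x) * q₀ x = 0)
    {L : NNReal} {φ : ℝ × ℝ → ℝ} (hφ : LipschitzWith L φ) (hφc : HasCompactSupport φ)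
    (hφs : tsupport φ ⊆ Ioo (-42) S ×ˢ univ) :
    (∫ p in Ioo 0 S ×ˢ (univ : Set ℝ), q p * (fderiv ℝ φ p (1, 0) + b p * fderiv ℝ φ p (0, 1)))
      + ∫ x, φ (0, x) * q₀ x = 0 := by
  obtain ⟨k, hk, f, hfc, hfk, hkU, hfb, hfl, hfd⟩ :=
    hφ.exists_smooth_approx hφc (isOpen_Ioo.prod isOpen_univ) hφs
  obtain ⟨R, hR⟩ := hk.isBounded.exists_norm_le
  have hR2 : ∀ n p, R < |p.2| → p ∉ tsupport (f n) := fun n p hp h =>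
    absurd ((le_max_right _ _).trans (Prod.norm_def p ▸ hR p (hfk n h))) (not_le.2 hp)
  have hcs : ∀ n, HasCompactSupport (f n) := fun n =>
    hk.of_isClosed_subset (isClosed_tsupport _) (hfk n)
  -- The strip has infinite measure; the cut-off to the common spatial support makes the dominating
  -- function integrable.
  set χ : ℝ × ℝ → ℝ := fun p => (Icc (-R) R).indicator (fun _ => (1 : ℝ)) p.2 with hχ
  have hχm : Measurable χ := (measurable_const.indicator measurableSet_Icc).comp measurable_snd
  have hχ1 : ∀ p : ℝ × ℝ, |p.2| ≤ R → χ p = 1 := fun p hp => indicator_of_mem (show p.2 ∈ Icc (-R) R from abs_le.1 hp) _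
  have hχ0 : ∀ p : ℝ × ℝ, R < |p.2| → χ p = 0 := fun p hp =>
    indicator_of_notMem (fun h : p.2 ∈ Icc (-R) R => absurd (abs_le.2 h) (not_le.2 hp)) _
  have hχn : ∀ p, 0 ≤ χ p := fun p => indicator_nonneg (fun _ _ => zero_le_one) _
  have hχle : ∀ p, χ p ≤ 1 := fun p => indicator_le_self' (fun _ _ => zero_le_one) _
  have hone : ∀ (n : ℕ) (w : ℝ × ℝ), ‖w‖ ≤ 1 → ∀ p, |fderiv ℝ (f n) p w| ≤ L := fun n w hw p =>
    (ContinuousLinearMap.le_of_opNorm_le_of_le _ (hfb n p) hw).trans_eq (mul_one _)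
  have hf0 : ∀ n p, R < |p.2| → fderiv ℝ (f n) p = 0 := by
    intro n p hp
    by_contra hcon
    exact hR2 n p hp (support_fderiv_subset ℝ hcon)
  have hlim1 : Tendsto (fun n => ∫ p in Ioo 0 S ×ˢ (univ : Set ℝ),
      q p * (fderiv ℝ (f n) p (1, 0) + b p * fderiv ℝ (f n) p (0, 1))) atTop
      (𝓝 (∫ p in Ioo 0 S ×ˢ (univ : Set ℝ),
        q p * (fderiv ℝ φ p (1, 0) + b p * fderiv ℝ φ p (0, 1)))) := by
    refine tendsto_integral_of_dominated_convergence (fun p => |Q| * (L + |D| * L) * χ p)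
      (fun n => ?_) ?_ (fun n => ?_) ?_
    · have hc := (hfc n).continuous_fderiv one_ne_zero
      exact hqm.mul ((hc.clm_apply continuous_const).aestronglyMeasurable.add
        (hbm.mul (hc.clm_apply continuous_const).aestronglyMeasurable))
    · refine integrableOn_strip (c := |Q| * (L + |D| * L)) (R := R)
        (measurable_const.mul hχm).aestronglyMeasurable (ae_of_all _ fun p => ?_)
        (fun p _ hp => by rw [hχ0 p hp, mul_zero])
      rw [abs_of_nonneg (mul_nonneg (by positivity) (hχn p))]
      exact mul_le_of_le_one_right (by positivity) (hχle p)
    · filter_upwards [hqb, hbb] with p hp1 hp2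
      rcases le_or_gt |p.2| R with h | h
      · rw [hχ1 p h, mul_one, Real.norm_eq_abs, abs_mul]
        refine mul_le_mul (hp1.trans (le_abs_self _)) ?_ (abs_nonneg _) (abs_nonneg _)
        refine (abs_add_le _ _).trans (add_le_add (hone n _ (by simp [Prod.norm_def]) p) ?_)
        rw [abs_mul]
        exact mul_le_mul (hp2.trans (le_abs_self _)) (hone n _ (by simp [Prod.norm_def]) p)
          (abs_nonneg _) (abs_nonneg _)
      · rw [hχ0 p h, hf0 n p h]; simp
    · filter_upwards [ae_restrict_of_ae hfd] with p hp
      have hw : ∀ w : ℝ × ℝ, Tendsto (fun n => fderiv ℝ (f n) p w) atTop (𝓝 (fderiv ℝ φ p w)) :=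
        fun w => ((ContinuousLinearMap.apply ℝ ℝ w).continuous.tendsto _).comp hp
      exact ((hw _).add ((hw _).const_mul _)).const_mul _
  have hlip : ∀ n, LipschitzWith L (f n) := fun n =>
    lipschitzWith_of_nnnorm_fderiv_le ((hfc n).differentiable one_ne_zero) fun p => hfb n p
  have hbd : ∀ n x, |f n (0, x)| ≤ L * (2 * |R| + 1) := by
    intro n x
    rcases le_or_gt |x| R with h | h
    -- The second point lies outside the support, so the Lipschitz constant bounds the value at the
    -- first uniformly in `n`.
    · have h1 := (hlip n).dist_le_mul (0, x) (0, x + (2 * |R| + 1))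
      have h2 : f n (0, x + (2 * |R| + 1)) = 0 := by
        refine image_eq_zero_of_notMem_tsupport (hR2 n _ ?_)
        have := abs_le.1 h
        have h4 := le_abs_self R
        have h3 := abs_nonneg R
        exact lt_of_lt_of_le (by linarith) (le_abs_self _)
      rw [h2, Real.dist_eq, sub_zero, Prod.dist_eq, Real.dist_eq, Real.dist_eq, sub_self, abs_zero,
        sub_add_cancel_left, abs_neg, abs_of_nonneg (by positivity : 0 ≤ 2 * |R| + 1),
        max_eq_right (by positivity)] at h1
      exact h1
    · rw [image_eq_zero_of_notMem_tsupport (hR2 n (0, x) h), abs_zero]; positivity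
  have hN0 : 0 ≤ N := (abs_nonneg _).trans (hN 0)
  have hlim2 : Tendsto (fun n => ∫ x, f n (0, x) * q₀ x) atTop (𝓝 (∫ x, φ (0, x) * q₀ x)) := by
    refine tendsto_integral_of_dominated_convergence
      (fun x => (Icc (-R) R).indicator (fun _ => L * (2 * |R| + 1) * N) x) (fun n => ?_) ?_
      (fun n => ae_of_all _ fun x => ?_) (ae_of_all _ fun x => (hfl (0, x)).mul_const _)
    · exact ((hfc n).continuous.comp (continuous_const.prodMk continuous_id)).aestronglyMeasurable.mul
        hq0.aestronglyMeasurable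
    · exact (integrable_indicator_iff measurableSet_Icc).2 (integrableOn_const (by simp))
    · rcases le_or_gt |x| R with h | h
      · rw [indicator_of_mem (show x ∈ Icc (-R) R from abs_le.1 h), Real.norm_eq_abs, abs_mul]
        exact mul_le_mul (hbd n x) (hN x) (abs_nonneg _) (by positivity)
      · rw [image_eq_zero_of_notMem_tsupport (hR2 n (0, x) h), zero_mul, norm_zero]
        exact indicator_nonneg (fun _ _ => by positivity) _
  refine tendsto_nhds_unique (hlim1.add hlim2) (tendsto_const_nhds.congr fun n => ?_)
  refine (hweak (f n) (hfc n) (hcs n) ((hfk n).trans hkU)).symm.trans ?_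
  congr 1
  refine integral_congr_ae (ae_of_all _ fun p => ?_)
  have hd := (hfc n).differentiable one_ne_zero p
  simp only [hd.deriv_slice_fst, hd.deriv_slice_snd]

/-! ### Weak solutions are transported densities -/

/-- The bound holds at a dense set of times and is closed under `L¹_loc` limits, so continuity in
time gives it at every time, the endpoints included. -/
theorem MemCL1Loc.ae_abs_le {S Q : ℝ} {q : ℝ → ℝ → ℝ} (hq : MemCL1Loc S q) (hS : 0 < S)
    (hb : LinftyBound S Q q) : ∀ s ∈ Icc 0 S, ∀ᵐ x, |q s x| ≤ Q := by
  intro s hs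
  have hae : ∀ᵐ t : ℝ, t ∈ Ioo 0 S → ∀ᵐ x, |q t x| ≤ Q :=
    (ae_restrict_iff' measurableSet_Ioo).1 hb
  have hdense : Dense {t : ℝ | t ∈ Ioo 0 S → ∀ᵐ x, |q t x| ≤ Q} := Measure.dense_of_ae hae
  have hcl : s ∈ closure (Ioo 0 S ∩ {t : ℝ | t ∈ Ioo 0 S → ∀ᵐ x, |q t x| ≤ Q}) := by
    have h1 := closure_minimal (hdense.open_subset_closure_inter (isOpen_Ioo (a := (0 : ℝ)) (b := S)))
      isClosed_closure
    rw [closure_Ioo hS.ne] at h1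
    exact h1 hs
  have hloc : ∀ n : ℕ, ∀ᵐ x, x ∈ Icc (-(n : ℝ)) n → |q s x| ≤ Q := by
    intro n
    rw [← ae_restrict_iff' measurableSet_Icc]
    -- At a good time `t` this excess is dominated by `|q t x - q s x|`, whose integral can be made
    -- arbitrarily small.
    set f : ℝ → ℝ := fun x => max (|q s x| - Q) 0
    have hfi : IntegrableOn f (Icc (-(n : ℝ)) n) :=
      (((hq.locallyIntegrable s hs).integrableOn_isCompact isCompact_Icc).abs.sub
        (integrableOn_const (by simp))).pos_part
    have hf0 : ∀ x, 0 ≤ f x := fun x => le_max_right _ _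
    have hle : ∫ x in Icc (-(n : ℝ)) n, f x ≤ 0 := by
      refine le_of_forall_pos_le_add fun η hη => ?_
      have hev := (hq.tendsto n s hs).eventually (ge_mem_nhds hη)
      have hev' := eventually_nhdsWithin_iff.1 hev
      obtain ⟨t, ⟨ht1, ht2⟩, ht3⟩ := ((mem_closure_iff_frequently.1 hcl).and_eventually hev').exists
      have htI : t ∈ Icc 0 S := Ioo_subset_Icc_self ht1
      have hti := (hq.locallyIntegrable t htI).integrableOn_isCompact
        (isCompact_Icc (a := -(n : ℝ)) (b := n))
      have hsi := (hq.locallyIntegrable s hs).integrableOn_isCompact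
        (isCompact_Icc (a := -(n : ℝ)) (b := n))
      rw [zero_add]
      refine le_trans ?_ (ht3 htI)
      refine integral_mono_of_nonneg (ae_of_all _ hf0) (hti.sub hsi).abs
        (ae_restrict_of_ae ?_)
      filter_upwards [ht2 ht1] with x hx
      refine max_le ?_ (abs_nonneg _)
      have := abs_sub_abs_le_abs_sub (q s x) (q t x)
      rw [abs_sub_comm] at this
      linarith
    have h0 := (integral_eq_zero_iff_of_nonneg hf0 hfi).1
      (le_antisymm hle (integral_nonneg hf0))
    filter_upwards [h0] with x hx
    have := le_max_left (|q s x| - Q) 0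
    have hx' : max (|q s x| - Q) 0 = 0 := hx
    linarith
  filter_upwards [ae_all_iff.2 hloc] with x hx
  obtain ⟨n, hn⟩ := exists_nat_ge |x|
  exact hx n (abs_le.1 hn)

/-- Passing from slices to the product measure needs a measurable exceptional set, hence the
strongly measurable representative. -/
theorem LinftyBound.ae_strip {S Q : ℝ} {q : ℝ → ℝ → ℝ} (hb : LinftyBound S Q q)
    (hqm : AEStronglyMeasurable (fun p : ℝ × ℝ => q p.1 p.2) (volume.restrict (Ioo 0 S ×ˢ univ))) :
    ∀ᵐ p ∂(volume.restrict (Ioo 0 S ×ˢ (univ : Set ℝ))), |q p.1 p.2| ≤ Q := by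
  have e : (volume.restrict (Ioo 0 S ×ˢ (univ : Set ℝ)) : Measure (ℝ × ℝ)) =
      (volume.restrict (Ioo 0 S)).prod volume := by
    rw [Measure.volume_eq_prod, ← Measure.prod_restrict, Measure.restrict_univ]
  rw [e] at hqm ⊢
  have hmk := hqm.ae_eq_mk
  have h1 := Measure.ae_ae_of_ae_prod hmk
  have hms : MeasurableSet {p : ℝ × ℝ | |hqm.mk _ p| ≤ Q} :=
    measurableSet_le hqm.stronglyMeasurable_mk.measurable.abs measurable_const
  have h2 : ∀ᵐ t ∂(volume.restrict (Ioo 0 S)), ∀ᵐ x, |hqm.mk _ (t, x)| ≤ Q := by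
    filter_upwards [h1, hb] with t ht1 ht2
    filter_upwards [ht1, ht2] with x hx1 hx2
    rwa [← hx1]
  have h3 := (Measure.ae_prod_mem_iff_ae_ae_mem hms).2 h2
  filter_upwards [hmk, h3] with p hp1 hp2
  rw [hp1]; exact hp2

theorem MemCL1Loc.continuousOn_integral_mul {S Q R W P : ℝ} {q ψ : ℝ → ℝ → ℝ}
    (hq : MemCL1Loc S q) (hb : ∀ s ∈ Icc 0 S, ∀ᵐ x, |q s x| ≤ Q) (hψc : ∀ t, Continuous (ψ t))
    (hψ0 : ∀ t x, R < |x| → ψ t x = 0) (hψb : ∀ t x, |ψ t x| ≤ W)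
    (hψL : ∀ s t x, |ψ t x - ψ s x| ≤ P * |t - s|) :
    ContinuousOn (fun t => ∫ x, q t x * ψ t x) (Icc 0 S) := by
  intro s hs
  have hP : 0 ≤ P := by simpa using (abs_nonneg _).trans (hψL 0 1 0)
  have hW : 0 ≤ W := (abs_nonneg _).trans (hψb 0 0)
  have hQ : 0 ≤ Q := by
    obtain ⟨x, hx⟩ := (hb s hs).exists
    exact (abs_nonneg _).trans hx
  have e : ∀ t r : ℝ, ∫ x, q t x * ψ r x = ∫ x in Icc (-R) R, q t x * ψ r x := by
    intro t r
    rw [setIntegral_eq_integral_of_forall_compl_eq_zero]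
    intro x hx
    rw [hψ0 r x, mul_zero]
    by_contra hcon
    exact hx (abs_le.1 (not_lt.1 hcon))
  have hloc : ∀ t ∈ Icc 0 S, IntegrableOn (q t) (Icc (-R) R) := fun t ht =>
    (hq.locallyIntegrable t ht).integrableOn_isCompact isCompact_Icc
  have hmul : ∀ t ∈ Icc 0 S, ∀ r, IntegrableOn (fun x => q t x * ψ r x) (Icc (-R) R) :=
    fun t ht r => (hloc t ht).mul_bdd (c := W) (hψc r).aestronglyMeasurable (ae_of_all _ (hψb r))
  refine tendsto_iff_dist_tendsto_zero.2 ?_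
  have hlim : Tendsto (fun t => W * (∫ x in Icc (-R) R, |q t x - q s x|) +
      Q * (P * |t - s|) * (2 * |R|)) (𝓝[Icc 0 S] s) (𝓝 0) := by
    have h1 := (hq.tendsto R s hs).const_mul W
    have hc : Continuous fun t => Q * (P * |t - s|) * (2 * |R|) := by fun_prop
    have h2 := (hc.tendsto s).mono_left (nhdsWithin_le_nhds (s := Icc 0 S))
    have h3 := h1.add h2
    simpa using h3
  refine squeeze_zero' (Eventually.of_forall fun _ => dist_nonneg) ?_ hlim
  filter_upwards [self_mem_nhdsWithin] with t ht
  rw [Real.dist_eq, e t t, e s s, ← integral_sub (hmul t ht t) (hmul s hs s)]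
  refine (abs_integral_le_integral_abs).trans ?_
  have hi := ((hloc t ht).sub (hloc s hs)).abs
  have hc : IntegrableOn (fun _ : ℝ => Q * (P * |t - s|)) (Icc (-R) R) :=
    integrableOn_const (by simp)
  refine (integral_mono_of_nonneg (ae_of_all _ fun x => abs_nonneg _) ((hi.const_mul W).add hc)
    (ae_restrict_of_ae ?_)).trans ?_
  · filter_upwards [hb s hs] with x hx
    calc |q t x * ψ t x - q s x * ψ s x|
        = |(q t x - q s x) * ψ t x + q s x * (ψ t x - ψ s x)| := by ring_nf
      _ ≤ |q t x - q s x| * |ψ t x| + |q s x| * |ψ t x - ψ s x| := by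
          rw [← abs_mul, ← abs_mul]; exact abs_add_le _ _
      _ ≤ |q t x - q s x| * W + Q * (P * |t - s|) := by
          gcongr
          · exact hψb t x
          · exact hψL s t x
      _ = _ := by simp only [Pi.add_apply, Pi.sub_apply]; ring
  · rw [integral_add' (hi.const_mul W) hc, integral_const_mul, setIntegral_const, smul_eq_mul]
    refine add_le_add le_rfl ?_
    rw [mul_comm]
    refine mul_le_mul_of_nonneg_left ?_ (by positivity)
    rw [Measure.real, Real.volume_Icc, ENNReal.toReal_ofReal']
    exact max_le (by linarith [le_abs_self R]) (by positivity)

theorem IsLipschitzField.continuous_uncurry {K : NNReal} {C : ℝ} {μ : ℝ → ℝ → ℝ}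
    (h : IsLipschitzField K C μ) : Continuous fun p : ℝ × ℝ => μ p.1 p.2 := by
  rw [continuous_iff_continuousAt]
  rintro ⟨s, y⟩
  refine tendsto_iff_dist_tendsto_zero.2 ?_
  refine squeeze_zero (fun _ => dist_nonneg)
    (g := fun p : ℝ × ℝ => K * dist p.2 y + dist (μ p.1 y) (μ s y)) (fun p => ?_) ?_
  · exact (dist_triangle _ (μ p.1 y) _).trans (add_le_add ((h.lipschitz _).dist_le_mul _ _) le_rfl)
  · have h1 := h.continuous y
    have : Continuous fun p : ℝ × ℝ => K * dist p.2 y + dist (μ p.1 y) (μ s y) := by fun_prop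
    simpa using this.tendsto (s, y)

/-- The clamping of times to `[0, S]`. -/
def clampTime (S t : ℝ) : ℝ := max 0 (min t S)

theorem clampTime_mem {S : ℝ} (hS : 0 ≤ S) (t : ℝ) : clampTime S t ∈ Icc 0 S :=
  ⟨le_max_left _ _, max_le hS (min_le_right _ _)⟩

theorem clampTime_of_mem {S t : ℝ} (ht : t ∈ Icc 0 S) : clampTime S t = t := by
  rw [clampTime, min_eq_left ht.2, max_eq_right ht.1]

theorem lipschitzWith_clampTime (S : ℝ) : LipschitzWith 1 (clampTime S) :=
  (LipschitzWith.id.min_const S).const_max 0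

theorem abs_clampTime_sub_le (S s t : ℝ) : |clampTime S s - clampTime S t| ≤ |s - t| := by
  simpa [Real.dist_eq] using (lipschitzWith_clampTime S).dist_le_mul s t

/-- A trapezoidal cut-off function, equal to `1` on `[-1, a]` and to `0` outside
`[-2, a + h]`. -/
noncomputable def trapezoid (a h t : ℝ) : ℝ := max 0 (min 1 (min (t + 2) ((a + h - t) * h⁻¹)))

section Trapezoid

variable {a h t : ℝ}

theorem lipschitzWith_trapezoid (a h : ℝ) :
    LipschitzWith (max 1 (Real.nnabs h⁻¹)) (trapezoid a h) := by
  have h1 : LipschitzWith 1 fun t : ℝ => t + 2 :=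
    LipschitzWith.of_dist_le_mul fun x y => by simp
  have h2 : LipschitzWith (Real.nnabs h⁻¹) fun t : ℝ => (a + h - t) * h⁻¹ :=
    LipschitzWith.of_dist_le_mul fun x y => by
      rw [Real.dist_eq, ← sub_mul, abs_mul, Real.coe_nnabs, mul_comm, Real.dist_eq,
        abs_sub_comm x y]
      ring_nf
      exact le_rfl
  exact ((h1.min h2).const_min 1).const_max 0

theorem abs_trapezoid_le (a h t : ℝ) : |trapezoid a h t| ≤ 1 := by
  rw [abs_of_nonneg (le_max_left _ _)]
  exact max_le zero_le_one (min_le_left _ _)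

theorem trapezoid_eq_zero (hh : 0 < h) (ht : t ∉ Icc (-2) (a + h)) : trapezoid a h t = 0 := by
  refine max_eq_left ?_
  rcases not_and_or.1 ht with h1 | h1
  · exact (min_le_right _ _).trans ((min_le_left _ _).trans (by linarith))
  · refine (min_le_right _ _).trans ((min_le_right _ _).trans ?_)
    exact mul_nonpos_of_nonpos_of_nonneg (by linarith) (inv_nonneg.2 hh.le)

theorem trapezoid_eq_one (hh : 0 < h) (ht : t ∈ Icc (-1) a) : trapezoid a h t = 1 := by
  have h1 : 1 ≤ (a + h - t) * h⁻¹ := by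
    rw [← div_eq_mul_inv, one_le_div hh]; linarith [ht.2]
  rw [trapezoid, min_eq_left (le_min (by linarith [ht.1]) h1), max_eq_right zero_le_one]

theorem hasDerivAt_trapezoid (hh : 0 < h) (ha : 0 ≤ a) (ht : 0 < t) (hta : t ≠ a)
    (htb : t ≠ a + h) :
    HasDerivAt (trapezoid a h) ((Ioo a (a + h)).indicator (fun _ => -h⁻¹) t) t := by
  rcases lt_or_gt_of_ne hta with h1 | h1
  · rw [indicator_of_notMem fun hm => absurd hm.1 (not_lt.2 h1.le)]
    refine (hasDerivAt_const t (1 : ℝ)).congr_of_eventuallyEq ?_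
    filter_upwards [Ioo_mem_nhds ht h1] with s hs
    exact trapezoid_eq_one hh ⟨by linarith [hs.1], hs.2.le⟩
  rcases lt_or_gt_of_ne htb with h2 | h2
  · rw [indicator_of_mem (show t ∈ Ioo a (a + h) from ⟨h1, h2⟩)]
    have hd : HasDerivAt (fun s : ℝ => (a + h - s) * h⁻¹) (-h⁻¹) t := by
      simpa using ((hasDerivAt_id t).const_sub (a + h)).mul_const h⁻¹
    refine hd.congr_of_eventuallyEq ?_
    filter_upwards [Ioo_mem_nhds h1 h2] with s hs
    have e1 : (a + h - s) * h⁻¹ ≤ 1 := by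
      rw [← div_eq_mul_inv, div_le_one hh]; linarith [hs.1]
    have e2 : 0 ≤ (a + h - s) * h⁻¹ :=
      mul_nonneg (by linarith [hs.2]) (inv_nonneg.2 hh.le)
    rw [trapezoid, min_eq_right (a := s + 2) (by linarith [hs.1]), min_eq_right e1, max_eq_right e2]
  · rw [indicator_of_notMem fun hm => absurd hm.2 (not_lt.2 h2.le)]
    refine (hasDerivAt_const t (0 : ℝ)).congr_of_eventuallyEq ?_
    filter_upwards [Ioi_mem_nhds h2] with s hs
    exact trapezoid_eq_zero hh fun hm => absurd hm.2 (not_le.2 hs)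

end Trapezoid

section Pullback

variable {a M K L : NNReal} {C R S : ℝ} {v A B G : ℝ → ℝ} {μ : ℝ → ℝ → ℝ} {Φ : ℝ → ℝ → ℝ → ℝ}

/-- Clamping the time keeps the exponential bounded by `exp (K * S)`, so the transported function is
Lipschitz on the whole plane. -/
theorem abs_pullback_sub_le (hμ : IsLipschitzField K C μ) (hΦ : IsFlow μ Φ) (hS : 0 ≤ S)
    (hG : LipschitzWith L G) (s t x y : ℝ) :
    |G (Φ (clampTime S s) 0 x) - G (Φ (clampTime S t) 0 y)| ≤
      L * Real.exp (K * S) * (|x - y| + C * |s - t|) := by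
  have h1 := hG.dist_le_mul (Φ (clampTime S s) 0 x) (Φ (clampTime S t) 0 y)
  rw [Real.dist_eq, Real.dist_eq] at h1
  rw [mul_assoc]
  refine h1.trans (mul_le_mul_of_nonneg_left ?_ L.2)
  refine (hΦ.abs_sub_initial_le hμ 0 _ _ x y).trans ?_
  have h2 := clampTime_mem hS s
  have h3 : |0 - clampTime S s| ≤ S := by
    rw [zero_sub, abs_neg, abs_of_nonneg h2.1]; exact h2.2
  have hC := hμ.C_nonneg
  exact mul_le_mul (Real.exp_le_exp.2 (mul_le_mul_of_nonneg_left h3 K.2))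
    (add_le_add le_rfl (mul_le_mul_of_nonneg_left (abs_clampTime_sub_le S s t) hC))
    (by positivity) (Real.exp_pos _).le

theorem pullback_eq_zero (hμ : IsLipschitzField K C μ) (hΦ : IsFlow μ Φ) (hS : 0 ≤ S)
    (hG0 : ∀ y, R < |y| → G y = 0) {t y : ℝ} (hy : R + C * S < |y|) :
    G (Φ (clampTime S t) 0 y) = 0 := by
  refine hG0 _ ?_
  have h1 := hΦ.abs_sub_self_le hμ (clampTime S t) 0 y
  have h2 := clampTime_mem hS t
  rw [zero_sub, abs_neg, abs_of_nonneg h2.1] at h1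
  have h3 : C * clampTime S t ≤ C * S := mul_le_mul_of_nonneg_left h2.2 hμ.C_nonneg
  have h4 : |y| ≤ |Φ (clampTime S t) 0 y| + |Φ (clampTime S t) 0 y - y| := by
    calc |y| = |Φ (clampTime S t) 0 y - (Φ (clampTime S t) 0 y - y)| := by ring_nf
      _ ≤ _ := abs_sub _ _
  linarith

/-- The function is constant along `r ↦ (r, Φ t r y)` near `r = t`, and the velocity of this curve
at `r = t` is `(1, μ t y)`. -/
theorem fderiv_pullback (hμ : IsLipschitzField K C μ) (hΦ : IsFlow μ Φ) {p : ℝ × ℝ}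
    (hp : p.1 ∈ Ioo 0 S)
    (hd : DifferentiableAt ℝ (fun p : ℝ × ℝ => G (Φ (clampTime S p.1) 0 p.2)) p) :
    fderiv ℝ (fun p : ℝ × ℝ => G (Φ (clampTime S p.1) 0 p.2)) p (1, 0) +
      μ p.1 p.2 * fderiv ℝ (fun p : ℝ × ℝ => G (Φ (clampTime S p.1) 0 p.2)) p (0, 1) = 0 := by
  set H : ℝ × ℝ → ℝ := fun p => G (Φ (clampTime S p.1) 0 p.2) with hH
  obtain ⟨t, y⟩ := p
  have hcurve : HasDerivAt (fun r => (r, Φ t r y)) ((1 : ℝ), μ t y) t := by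
    have := hΦ.hasDerivAt t t y
    rw [hΦ.self] at this
    exact (hasDerivAt_id t).prodMk this
  have hd' : HasFDerivAt H (fderiv ℝ H (t, y)) (t, Φ t t y) := by
    rw [hΦ.self]; exact hd.hasFDerivAt
  have h1 := HasFDerivAt.comp_hasDerivAt t (f := fun r => (r, Φ t r y)) hd' hcurve
  have h2 : HasDerivAt (H ∘ fun r => (r, Φ t r y)) 0 t := by
    refine (hasDerivAt_const t (G (Φ t 0 y))).congr_of_eventuallyEq ?_
    filter_upwards [Ioo_mem_nhds hp.1 hp.2] with r hr
    simp only [hH, Function.comp_apply]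
    rw [clampTime_of_mem (Ioo_subset_Icc_self hr), hΦ.comp hμ]
  have h3 := h1.unique h2
  have e : ((1 : ℝ), μ t y) = ((1 : ℝ), (0 : ℝ)) + μ t y • ((0 : ℝ), (1 : ℝ)) := by simp
  rw [e, map_add, map_smul, smul_eq_mul] at h3
  exact h3

end Pullback

section Representation

variable {a M K : NNReal} {C N S Q : ℝ} {v A B q₀ : ℝ → ℝ} {μ : ℝ → ℝ → ℝ}
  {Φ : ℝ → ℝ → ℝ → ℝ} {q : ℝ → ℝ → ℝ}

/-- Testing a weak formulation against a trapezoid in time and a function transported by the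
flow. -/
theorem setIntegral_pullback (hc : Straightens a M v A B) (hμ : IsLipschitzField K C μ)
    (hΦ : IsFlow μ Φ) (hq0 : Measurable q₀) (hN : ∀ x, |q₀ x| ≤ N)
    (hqm : AEStronglyMeasurable (fun p : ℝ × ℝ => q p.1 p.2) (volume.restrict (Ioo 0 S ×ˢ univ)))
    (hqb : ∀ᵐ p ∂(volume.restrict (Ioo 0 S ×ˢ (univ : Set ℝ))), |q p.1 p.2| ≤ Q)
    (hweak : ∀ φ : ℝ × ℝ → ℝ, ContDiff ℝ 1 φ → HasCompactSupport φ →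
      tsupport φ ⊆ Ioo (-42) S ×ˢ univ →
      (∫ p in Ioo 0 S ×ˢ (univ : Set ℝ), q p.1 p.2 * (deriv (fun t => φ (t, p.2)) p.1
          + v p.2 * μ p.1 (A p.2) * deriv (fun x => φ (p.1, x)) p.2)) + ∫ x, φ (0, x) * q₀ x = 0)
    {L : NNReal} {G : ℝ → ℝ} (hG : LipschitzWith L G) {R W : ℝ} (hG0 : ∀ y, R < |y| → G y = 0)
    (hGW : ∀ y, |G y| ≤ W) {τ h : ℝ} (hτ : 0 ≤ τ) (hh : 0 < h) (hτh : τ + h < S) :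
    ∫ t in Ioo τ (τ + h), ∫ x, q t x * G (Φ (clampTime S t) 0 (A x)) =
      h * ∫ x, G (A x) * q₀ x := by
  have hS : 0 < S := by linarith
  have hW : 0 ≤ W := (abs_nonneg _).trans (hGW 0)
  have hC := hμ.C_nonneg
  set H : ℝ × ℝ → ℝ := fun p => G (Φ (clampTime S p.1) 0 p.2) with hH
  have hHb : ∀ p, |H p| ≤ W := fun p => hGW _
  have hHL : LipschitzWith (L * (Real.exp (K * S)).toNNReal * (1 + C.toNNReal)) H := by
    refine LipschitzWith.of_dist_le_mul fun p r => ?_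
    rw [Real.dist_eq, NNReal.coe_mul, NNReal.coe_mul, NNReal.coe_add, Real.coe_toNNReal _ hC,
      Real.coe_toNNReal _ (Real.exp_pos _).le, NNReal.coe_one, mul_assoc _ (1 + C)]
    refine (abs_pullback_sub_le hμ hΦ hS.le hG p.1 r.1 p.2 r.2).trans
      (mul_le_mul_of_nonneg_left ?_ (by positivity))
    have h1 : |p.1 - r.1| ≤ dist p r := by rw [Prod.dist_eq]; exact le_max_left _ _
    have h2 : |p.2 - r.2| ≤ dist p r := by rw [Prod.dist_eq]; exact le_max_right _ _
    have h3 := mul_le_mul_of_nonneg_left h1 hC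
    linarith
  set ψ : ℝ → ℝ → ℝ := fun t x => H (t, A x) with hψ
  have hpair : LipschitzWith (max 1 a) fun p : ℝ × ℝ => (p.1, A p.2) := by
    have := (LipschitzWith.prod_fst (α := ℝ) (β := ℝ)).prodMk
      (hc.lipschitz.comp (LipschitzWith.prod_snd (α := ℝ) (β := ℝ)))
    rw [mul_one] at this
    exact this
  have hψL := hHL.comp hpair
  set χ := trapezoid τ h
  set φ : ℝ × ℝ → ℝ := fun p => χ p.1 * ψ p.1 p.2 with hφ
  obtain ⟨P, hP⟩ : ∃ P : NNReal, LipschitzWith P φ := by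
    refine ⟨(max 1 (Real.nnabs h⁻¹)) * W.toNNReal +
      L * (Real.exp (K * S)).toNNReal * (1 + C.toNNReal) * max 1 a,
      LipschitzWith.of_dist_le_mul fun p r => ?_⟩
    · have h1 := (lipschitzWith_trapezoid τ h).dist_le_mul p.1 r.1
      have h2 := hψL.dist_le_mul p r
      have h3 : dist p.1 r.1 ≤ dist p r := le_max_left _ _
      rw [Real.dist_eq] at h1 h2 ⊢
      rw [NNReal.coe_add, NNReal.coe_mul, Real.coe_toNNReal _ hW, add_mul]
      calc |φ p - φ r| = |(χ p.1 - χ r.1) * ψ p.1 p.2 + χ r.1 * (ψ p.1 p.2 - ψ r.1 r.2)| := by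
            simp only [hφ]; ring_nf
        _ ≤ |χ p.1 - χ r.1| * |ψ p.1 p.2| + |χ r.1| * |ψ p.1 p.2 - ψ r.1 r.2| := by
            rw [← abs_mul, ← abs_mul]; exact abs_add_le _ _
        _ ≤ (max 1 (Real.nnabs h⁻¹) : NNReal) * dist p r * W + 1 * _ := by
            refine add_le_add (mul_le_mul (h1.trans ?_) (hHb _) (abs_nonneg _) (by positivity))
              (mul_le_mul (abs_trapezoid_le _ _ _) h2 (abs_nonneg _) zero_le_one)
            exact mul_le_mul_of_nonneg_left h3 (by positivity)
        _ = _ := by ring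
  set R₁ : ℝ := |B 0| + M * (R + C * S) with hR₁
  have hψ0 : ∀ t x, R₁ < |x| → ψ t x = 0 := by
    intro t x hx
    refine pullback_eq_zero hμ hΦ hS.le hG0 ?_
    by_contra hcon
    have h1 := hc.lipschitz_inv.dist_le_mul (A x) 0
    rw [hc.left_inv, Real.dist_eq, Real.dist_eq, sub_zero] at h1
    have h2 := mul_le_mul_of_nonneg_left (not_lt.1 hcon) M.2
    have h3 : |x| ≤ |B 0| + |x - B 0| := by
      calc |x| = |B 0 + (x - B 0)| := by ring_nf
        _ ≤ _ := abs_add_le _ _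
    exact absurd hx (not_lt.2 (h3.trans (add_le_add le_rfl (h1.trans h2))))
  have hsupp : Function.support φ ⊆ Icc (-2) (τ + h) ×ˢ Icc (-R₁) R₁ := by
    intro p hp
    refine ⟨?_, ?_⟩
    · by_contra hcon
      have h0 : χ p.1 = 0 := trapezoid_eq_zero hh hcon
      exact hp (by simp only [hφ]; rw [h0, zero_mul])
    · by_contra hcon
      refine hp ?_
      simp only [hφ]
      rw [hψ0 p.1 p.2 (not_le.1 fun h => hcon (abs_le.1 h)), mul_zero]
  have hcomp : IsCompact (Icc (-2) (τ + h) ×ˢ Icc (-R₁) R₁) := isCompact_Icc.prod isCompact_Icc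
  have hts : tsupport φ ⊆ Icc (-2) (τ + h) ×ˢ Icc (-R₁) R₁ :=
    closure_minimal hsupp hcomp.isClosed
  have hres := weak_formulation_lipschitz (q := fun p => q p.1 p.2)
    (b := fun p => v p.2 * μ p.1 (A p.2)) (D := M * C) (q₀ := q₀) hqm hqb
    ((hc.measurable.comp measurable_snd).mul (hμ.continuous_uncurry.measurable.comp
      (measurable_fst.prodMk
        (hc.lipschitz.continuous.measurable.comp measurable_snd)))).aestronglyMeasurable
    (ae_of_all _ fun p => by
      rw [abs_mul, abs_of_pos (hc.pos _)]
      exact mul_le_mul (hc.le _) (hμ.bound _ _) (abs_nonneg _) M.2)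
    hq0 hN hweak hP (hcomp.of_isClosed_subset (isClosed_tsupport _) hts)
    (hts.trans (prod_mono (Icc_subset_Ioo (by norm_num) hτh) (subset_univ _)))
  set c : ℝ → ℝ := (Ioo τ (τ + h)).indicator fun _ => -h⁻¹ with hcdef
  -- Rademacher in the plane gives differentiability almost everywhere on almost every time slice;
  -- within a slice, composition with the expanding map `A` preserves null sets.
  have hHd : ∀ᵐ p : ℝ × ℝ, DifferentiableAt ℝ H (p.1, A p.2) := by
    have h1 : ∀ᵐ p : ℝ × ℝ, DifferentiableAt ℝ H p := hHL.ae_differentiableAt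
    have hms : MeasurableSet {p : ℝ × ℝ | DifferentiableAt ℝ H p} :=
      measurableSet_of_differentiableAt ℝ H
    rw [Measure.volume_eq_prod] at h1 ⊢
    have h2 := Measure.ae_ae_of_ae_prod h1
    refine (Measure.ae_prod_iff_ae_ae (p := fun p : ℝ × ℝ => DifferentiableAt ℝ H (p.1, A p.2))
      (hpair.continuous.measurable hms)).2 ?_
    filter_upwards [h2] with t ht
    exact hc.expandsWith.ae_comp hc.lipschitz.continuous.measurable ht
  have hAd : ∀ᵐ p : ℝ × ℝ, HasDerivAt A (v p.2)⁻¹ p.2 := by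
    rw [Measure.volume_eq_prod]
    exact Measure.quasiMeasurePreserving_snd.ae hc.ae_hasDerivAt
  have hne : ∀ r : ℝ, ∀ᵐ p : ℝ × ℝ, p.1 ≠ r := fun r => by
    rw [Measure.volume_eq_prod]
    exact Measure.quasiMeasurePreserving_fst.ae (Measure.ae_ne volume r)
  have hms : MeasurableSet (Ioo 0 S ×ˢ (univ : Set ℝ)) := measurableSet_Ioo.prod MeasurableSet.univ
  -- Since `v * A' = 1`, the transport terms cancel and only the derivative of the time cut-off
  -- survives.
  have hcalc : ∀ᵐ p ∂(volume.restrict (Ioo 0 S ×ˢ (univ : Set ℝ))),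
      q p.1 p.2 * (fderiv ℝ φ p (1, 0) + v p.2 * μ p.1 (A p.2) * fderiv ℝ φ p (0, 1)) =
      c p.1 * (q p.1 p.2 * ψ p.1 p.2) := by
    refine (ae_restrict_iff' hms).2 ?_
    filter_upwards [hHd, hAd, hne τ, hne (τ + h)] with p hpH hpA hp1 hp2 hpS
    have hχd := hasDerivAt_trapezoid hh hτ hpS.1.1 hp1 hp2
    have hm1 : HasDerivAt (fun t : ℝ => (t, A p.2)) ((1 : ℝ), (0 : ℝ)) p.1 :=
      (hasDerivAt_id _).prodMk (hasDerivAt_const _ _)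
    have hm2 : HasDerivAt (fun x : ℝ => (p.1, A x)) ((0 : ℝ), (v p.2)⁻¹) p.2 :=
      (hasDerivAt_const _ _).prodMk hpA
    have hs1 := HasFDerivAt.comp_hasDerivAt p.1 (f := fun t : ℝ => (t, A p.2)) hpH.hasFDerivAt hm1
    have hs2 := HasFDerivAt.comp_hasDerivAt p.2 (f := fun x : ℝ => (p.1, A x)) hpH.hasFDerivAt hm2
    have hφd : DifferentiableAt ℝ φ p := by
      refine DifferentiableAt.mul (hχd.differentiableAt.comp p differentiableAt_fst) ?_
      exact DifferentiableAt.comp p (g := H) (f := fun p : ℝ × ℝ => (p.1, A p.2)) hpH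
        (differentiableAt_fst.prodMk (hpA.differentiableAt.comp p differentiableAt_snd))
    have d1 : deriv (fun t => φ (t, p.2)) p.1 = c p.1 * ψ p.1 p.2 +
        χ p.1 * fderiv ℝ H (p.1, A p.2) (1, 0) := (hχd.mul hs1).deriv
    have d2 : deriv (fun x => φ (p.1, x)) p.2 = _ := (hs2.const_mul (χ p.1)).deriv
    rw [← hφd.deriv_slice_fst, ← hφd.deriv_slice_snd, d1, d2]
    have hpde : fderiv ℝ H (p.1, A p.2) (1, 0) +
        μ p.1 (A p.2) * fderiv ℝ H (p.1, A p.2) (0, 1) = 0 :=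
      fderiv_pullback (G := G) (S := S) hμ hΦ (p := (p.1, A p.2)) hpS.1 hpH
    have e : ((0 : ℝ), (v p.2)⁻¹) = (v p.2)⁻¹ • ((0 : ℝ), (1 : ℝ)) := by simp
    rw [e, map_smul, smul_eq_mul]
    have hv := mul_inv_cancel₀ (hc.pos p.2).ne'
    have hfin : fderiv ℝ H (p.1, A p.2) (1, 0) + v p.2 * μ p.1 (A p.2) *
        ((v p.2)⁻¹ * fderiv ℝ H (p.1, A p.2) (0, 1)) = 0 := by
      linear_combination hpde + (μ p.1 (A p.2) * fderiv ℝ H (p.1, A p.2) (0, 1)) * hv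
    linear_combination (q p.1 p.2 * χ p.1) * hfin
  rw [integral_congr_ae hcalc] at hres
  have hcm : Measurable c := measurable_const.indicator measurableSet_Ioo
  have hint : IntegrableOn (fun p : ℝ × ℝ => c p.1 * (q p.1 p.2 * ψ p.1 p.2))
      (Ioo 0 S ×ˢ univ) := by
    refine integrableOn_strip (c := h⁻¹ * (|Q| * W)) (R := R₁) ?_ ?_ ?_
    · exact (hcm.comp measurable_fst).aestronglyMeasurable.mul
        (hqm.mul hψL.continuous.aestronglyMeasurable)
    · filter_upwards [hqb] with p hp
      rw [abs_mul, abs_mul]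
      refine mul_le_mul ?_ (mul_le_mul (hp.trans (le_abs_self _)) (hHb _) (abs_nonneg _)
        (abs_nonneg _)) (by positivity) (by positivity)
      by_cases hm : p.1 ∈ Ioo τ (τ + h)
      · rw [hcdef, indicator_of_mem hm, abs_neg, abs_of_pos (inv_pos.2 hh)]
      · rw [hcdef, indicator_of_notMem hm, abs_zero]; positivity
    · intro p _ hp
      rw [hψ0 _ _ hp, mul_zero, mul_zero]
  rw [Measure.volume_eq_prod] at hint hres
  rw [setIntegral_prod _ hint] at hres
  simp only [setIntegral_univ, integral_const_mul] at hres
  have e0 : ∫ x, φ (0, x) * q₀ x = ∫ x, G (A x) * q₀ x := by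
    refine integral_congr_ae (ae_of_all _ fun x => ?_)
    have h1 : χ 0 = 1 := trapezoid_eq_one hh ⟨by norm_num, hτ⟩
    simp only [hφ, hψ, hH]
    rw [h1, clampTime_of_mem ⟨le_rfl, hS.le⟩, hΦ.self, one_mul]
  have e1 : ∫ t in Ioo 0 S, c t * ∫ x, q t x * ψ t x =
      -h⁻¹ * ∫ t in Ioo τ (τ + h), ∫ x, q t x * ψ t x := by
    have : ∀ t, c t * ∫ x, q t x * ψ t x =
        (Ioo τ (τ + h)).indicator (fun t => -h⁻¹ * ∫ x, q t x * ψ t x) t := by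
      intro t
      by_cases hm : t ∈ Ioo τ (τ + h)
      · rw [hcdef, indicator_of_mem hm, indicator_of_mem hm]
      · rw [hcdef, indicator_of_notMem hm, indicator_of_notMem hm, zero_mul]
    simp only [this]
    rw [setIntegral_indicator measurableSet_Ioo, inter_eq_self_of_subset_right
      (Ioo_subset_Ioo hτ hτh.le), integral_const_mul]
  rw [e0, e1] at hres
  have hfinal : ∫ t in Ioo τ (τ + h), ∫ x, q t x * ψ t x = h * ∫ x, G (A x) * q₀ x := by
    field_simp at hres
    linarith
  exact hfinal

/-- Duality: functions of the initial label, transported by the flow, solve the adjoint equation, so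
their pairing with any weak solution is conserved. The conserved pairings at time `t` determine `q
t`. -/
theorem ae_eq_transportedDensity_of_weak (hc : Straightens a M v A B)
    (hμ : IsLipschitzField K C μ) (hΦ : IsFlow μ Φ) (hq0 : Measurable q₀) (hN : ∀ x, |q₀ x| ≤ N)
    (hS : 0 < S) (hqC : MemCL1Loc S q)
    (hqm : AEStronglyMeasurable (fun p : ℝ × ℝ => q p.1 p.2) (volume.restrict (Ioo 0 S ×ˢ univ)))
    (hqb : LinftyBound S Q q)
    (hweak : ∀ φ : ℝ × ℝ → ℝ, ContDiff ℝ 1 φ → HasCompactSupport φ →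
      tsupport φ ⊆ Ioo (-42) S ×ˢ univ →
      (∫ p in Ioo 0 S ×ˢ (univ : Set ℝ), q p.1 p.2 * (deriv (fun t => φ (t, p.2)) p.1
          + v p.2 * μ p.1 (A p.2) * deriv (fun x => φ (p.1, x)) p.2)) + ∫ x, φ (0, x) * q₀ x = 0) :
    ∀ t ∈ Icc 0 S, q t =ᵐ[volume] transportedDensity q₀ A B Φ t := by
  have hcons : ∀ (L : NNReal) (G : ℝ → ℝ), LipschitzWith L G → HasCompactSupport G →
      ∀ t ∈ Icc 0 S, ∫ x, q t x * G (Φ (clampTime S t) 0 (A x)) = ∫ x, G (A x) * q₀ x := by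
    intro L G hG hGc
    obtain ⟨R, hR⟩ := hGc.isCompact.isBounded.exists_norm_le
    have hG0 : ∀ y, R < |y| → G y = 0 := fun y hy =>
      image_eq_zero_of_notMem_tsupport fun h => absurd (hR y h) (not_le.2 hy)
    obtain ⟨W, hW⟩ := hG.continuous.bounded_above_of_compact_support hGc
    set I : ℝ → ℝ := fun t => ∫ x, q t x * G (Φ (clampTime S t) 0 (A x)) with hI
    set I₀ := ∫ x, G (A x) * q₀ x with hI₀
    have hcont : ContinuousOn I (Icc 0 S) := by
      refine hqC.continuousOn_integral_mul (R := |B 0| + M * (R + C * S)) (W := W)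
        (P := L * Real.exp (K * S) * C)
        (ψ := fun t x => G (Φ (clampTime S t) 0 (A x))) (hqC.ae_abs_le hS hqb) ?_ ?_ ?_ ?_
      · intro t
        exact hG.continuous.comp ((hΦ.continuous hμ _ _).comp hc.lipschitz.continuous)
      · intro t x hx
        refine pullback_eq_zero hμ hΦ hS.le hG0 ?_
        by_contra hcon
        have h1 := hc.lipschitz_inv.dist_le_mul (A x) 0
        rw [hc.left_inv, Real.dist_eq, Real.dist_eq, sub_zero] at h1
        have h2 := mul_le_mul_of_nonneg_left (not_lt.1 hcon) M.2
        have h3 : |x| ≤ |B 0| + |x - B 0| := by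
          calc |x| = |B 0 + (x - B 0)| := by ring_nf
            _ ≤ _ := abs_add_le _ _
        exact absurd hx (not_lt.2 (h3.trans (add_le_add le_rfl (h1.trans h2))))
      · exact fun t x => hW _
      · intro s t x
        refine (abs_pullback_sub_le hμ hΦ hS.le hG t s (A x) (A x)).trans_eq ?_
        rw [sub_self, abs_zero, zero_add]; ring
    -- The average of `I` over `(τ, τ + h)` equals `I₀` for every small `h`; continuity of `I`
    -- identifies the limit. The endpoint `S` is excluded because `τ + h < S` is needed, and is
    -- reached by continuity below.
    have hIco : ∀ τ ∈ Ico 0 S, I τ = I₀ := by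
      intro τ hτ
      refine eq_of_forall_dist_le fun ε hε => ?_
      obtain ⟨δ, hδ, hδI⟩ := Metric.continuousWithinAt_iff.1
        (hcont τ (Ico_subset_Icc_self hτ)) ε hε
      set h := min (δ / 2) ((S - τ) / 2)
      have hh : 0 < h := lt_min (half_pos hδ) (half_pos (sub_pos.2 hτ.2))
      have hh1 : h ≤ δ / 2 := min_le_left _ _
      have hh2 : h ≤ (S - τ) / 2 := min_le_right _ _
      have hτh : τ + h < S := by linarith [hτ.2]
      have key := setIntegral_pullback hc hμ hΦ hq0 hN hqm (hqb.ae_strip hqm) hweak hG hG0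
        hW hτ.1 hh hτh
      have hsub : Icc τ (τ + h) ⊆ Icc 0 S := Icc_subset_Icc hτ.1 hτh.le
      have hii : IntegrableOn I (Ioo τ (τ + h)) :=
        ((hcont.mono hsub).integrableOn_compact isCompact_Icc).mono_set Ioo_subset_Icc_self
      have hb := norm_setIntegral_le_of_norm_le_const (μ := volume) (s := Ioo τ (τ + h))
        (f := fun t => I t - I τ) (C := ε) (by simp) (fun t ht => by
          have := hδI (hsub (Ioo_subset_Icc_self ht)) (by
            rw [Real.dist_eq, abs_of_pos (sub_pos.2 ht.1)]; linarith [ht.2])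
          exact this.le)
      have hvol : volume.real (Ioo τ (τ + h)) = h := by
        rw [Measure.real, Real.volume_Ioo, add_sub_cancel_left, ENNReal.toReal_ofReal hh.le]
      rw [integral_sub hii (integrableOn_const (by simp)), setIntegral_const, hvol, smul_eq_mul,
        key, ← mul_sub, norm_mul, Real.norm_eq_abs, abs_of_pos hh, mul_comm] at hb
      rw [dist_comm, Real.dist_eq]
      exact le_of_mul_le_mul_right hb hh
    intro t ht
    rcases eq_or_lt_of_le ht.2 with rfl | hlt
    · have h1 : Tendsto I (𝓝[Ico 0 t] t) (𝓝 (I t)) :=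
        (hcont t ht).mono_left (nhdsWithin_mono _ Ico_subset_Icc_self)
      have h2 : Tendsto I (𝓝[Ico 0 t] t) (𝓝 I₀) :=
        tendsto_const_nhds.congr' (by
          filter_upwards [self_mem_nhdsWithin] with s hs using (hIco s hs).symm)
      have : (𝓝[Ico 0 t] t).NeBot := by
        rw [← mem_closure_iff_nhdsWithin_neBot, closure_Ico hS.ne]; exact ht
      exact tendsto_nhds_unique h1 h2
    · exact hIco t ⟨ht.1, hlt⟩
  intro t ht
  refine ae_eq_of_integral_contDiff_smul_eq (hqC.locallyIntegrable t ht)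
    ((memCL1Loc_transportedDensity hc hμ hΦ hq0 hN S).locallyIntegrable t ht) fun g hg hgc => ?_
  obtain ⟨L, hL⟩ := hg.lipschitzWith_of_hasCompactSupport hgc (by simp)
  -- The label function `g ∘ B ∘ Φ 0 t` is the one whose transport at time `t` is `g`.
  have hGL := (hL.comp hc.lipschitz_inv).comp (hΦ.lipschitz hμ 0 t)
  have hGc : HasCompactSupport ((g ∘ B) ∘ Φ 0 t) := by
    have hcl : Topology.IsClosedEmbedding (B ∘ Φ 0 t) := by
      have hexp := hc.expandsWith_inv.comp (hΦ.expandsWith hμ 0 t)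
      exact hexp.antilipschitz.isClosedEmbedding
        (hc.lipschitz_inv.comp (hΦ.lipschitz hμ 0 t)).uniformContinuous
    exact hgc.comp_isClosedEmbedding hcl
  have h1 := hcons _ _ hGL hGc t ht
  simp only [Function.comp_apply, clampTime_of_mem ht, hΦ.inverse hμ, hc.left_inv] at h1
  have h2 := integral_transportedDensity_mul hc hμ hΦ q₀ g t
  simp only [smul_eq_mul]
  calc ∫ x, g x * q t x = ∫ x, q t x * g x := by simp_rw [mul_comm]
    _ = ∫ x, g (B (Φ 0 t (A x))) * q₀ x := h1
    _ = ∫ x, q₀ x * g (charCurve A B Φ t x) := by simp_rw [mul_comm, charCurve]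
    _ = ∫ x, transportedDensity q₀ A B Φ t x * g x := h2.symm
    _ = _ := by simp_rw [mul_comm]

end Representation

-- The nonlocal term `γ * q`

theorem realConv_eq_integral_sub (γ f : ℝ → ℝ) (x : ℝ) :
    realConv γ f x = ∫ ξ, γ (x - ξ) * f ξ := by
  rw [realConv, convolution_def, ← integral_sub_left_eq_self _ volume x]
  simp

theorem expandsWith_const_sub (x : ℝ) : ExpandsWith 1 fun ξ : ℝ => x - ξ :=
  ⟨zero_le_one, fun y z => by
    rw [one_mul, sub_sub_sub_cancel_left, abs_sub_comm]⟩

theorem exists_measurable_bounded_ae_eq {f : ℝ → ℝ} {Q : ℝ} (hf : AEStronglyMeasurable f)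
    (hQ : 0 ≤ Q) (hb : ∀ᵐ x, |f x| ≤ Q) :
    ∃ f', Measurable f' ∧ (∀ x, |f' x| ≤ Q) ∧ f' =ᵐ[volume] f := by
  refine ⟨fun x => max (-Q) (min (hf.mk f x) Q),
    measurable_const.max (hf.stronglyMeasurable_mk.measurable.min measurable_const),
    fun x => abs_le.2 ⟨le_max_left _ _, max_le (by linarith) (min_le_right _ _)⟩, ?_⟩
  filter_upwards [hb, hf.ae_eq_mk] with x hx hm
  have := abs_le.1 hx
  rw [← hm, min_eq_left this.2, max_eq_right this.1]

theorem realConv_congr_ae {γ γ' f f' : ℝ → ℝ} (hγ : γ =ᵐ[volume] γ') (hf : f =ᵐ[volume] f') :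
    realConv γ f = realConv γ' f' := by
  funext x
  rw [realConv_eq_integral_sub, realConv_eq_integral_sub]
  refine integral_congr_ae ?_
  have h1 := (expandsWith_const_sub x).ae_comp (by fun_prop) hγ
  filter_upwards [h1, hf] with ξ h1 h2
  rw [h1, h2]

section Conv

variable {γ f : ℝ → ℝ} {G κ Q : ℝ}

theorem IsBVKernel.abs_realConv_le (hγ : IsBVKernel γ G κ) (hf : AEStronglyMeasurable f)
    (hQ : 0 ≤ Q) (hb : ∀ᵐ x, |f x| ≤ Q) (x : ℝ) : |realConv γ f x| ≤ Q * ∫ y, |γ y| := by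
  obtain ⟨f', hm, hb', he⟩ := exists_measurable_bounded_ae_eq hf hQ hb
  rw [← realConv_congr_ae (ae_eq_refl γ) he, realConv_eq_integral_sub]
  have := hγ.abs_integral_comp_le (expandsWith_const_sub x) (by fun_prop) hb'
  rwa [one_mul] at this

theorem IsBVKernel.abs_realConv_sub_le (hγ : IsBVKernel γ G κ) (hf : AEStronglyMeasurable f)
    (hQ : 0 ≤ Q) (hb : ∀ᵐ x, |f x| ≤ Q) (x y : ℝ) :
    |realConv γ f x - realConv γ f y| ≤ Q * κ * |x - y| := by
  obtain ⟨f', hm, hb', he⟩ := exists_measurable_bounded_ae_eq hf hQ hb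
  rw [← realConv_congr_ae (ae_eq_refl γ) he, realConv_eq_integral_sub, realConv_eq_integral_sub]
  have := hγ.abs_integral_comp_sub_le (δ := |x - y|) (expandsWith_const_sub x) (by fun_prop)
    (expandsWith_const_sub y) (by fun_prop) (abs_nonneg _) (fun z => by ring_nf; exact le_rfl) hb' hm
  rwa [one_mul, ← mul_assoc] at this

/-- For a continuous compactly supported kernel this is `L¹_loc` continuity of `q`. The general
kernel is an `L¹` limit of such kernels, with an error uniform in time because `q` is bounded. -/
theorem MemCL1Loc.continuousOn_realConv {S : ℝ} {q : ℝ → ℝ → ℝ} (hq : MemCL1Loc S q)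
    (hγ : Integrable γ) (hQ : 0 ≤ Q) (hb : ∀ s ∈ Icc 0 S, ∀ᵐ x, |q s x| ≤ Q) (x : ℝ) :
    ContinuousOn (fun t => realConv γ (q t) x) (Icc 0 S) := by
  refine continuousOn_of_uniform_approx_of_continuousOn fun u hu => ?_
  obtain ⟨ε, hε, hεu⟩ := Metric.mem_uniformity_dist.1 hu
  obtain ⟨g, hgc, hg, hgcont, hgi⟩ := hγ.exists_hasCompactSupport_integral_sub_le
    (show 0 < ε / (2 * (Q + 1)) by positivity)
  refine ⟨fun t => ∫ ξ, q t ξ * g (x - ξ), ?_, fun t ht => hεu ?_⟩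
  · obtain ⟨R, hR⟩ := hgc.isCompact.isBounded.exists_norm_le
    obtain ⟨W, hW⟩ := hgcont.bounded_above_of_compact_support hgc
    refine hq.continuousOn_integral_mul (R := |x| + R) (W := W) (P := 0)
      (ψ := fun _ ξ => g (x - ξ)) hb (fun _ => by fun_prop) (fun _ ξ hξ => ?_)
      (fun _ ξ => hW _) (fun _ _ _ => by simp)
    refine image_eq_zero_of_notMem_tsupport fun h => absurd (hR _ h) (not_le.2 ?_)
    have := abs_sub_abs_le_abs_sub ξ x
    rw [abs_sub_comm] at this
    rw [Real.norm_eq_abs]; linarith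
  · have hm := (hq.locallyIntegrable t ht).aestronglyMeasurable
    have hcomp : ∀ {k : ℝ → ℝ}, Integrable k → Integrable fun ξ => k (x - ξ) * q t ξ := fun hk =>
      (hk.comp_sub_left x).mul_bdd (c := Q) hm (hb t ht)
    rw [realConv_eq_integral_sub, Real.dist_eq]
    simp_rw [mul_comm (q t _)]
    rw [← integral_sub (hcomp hγ) (hcomp hgi)]
    refine (abs_integral_le_integral_abs).trans_lt ?_
    have h1 : ∫ ξ, |γ (x - ξ) * q t ξ - g (x - ξ) * q t ξ| ≤ ∫ ξ, Q * |γ (x - ξ) - g (x - ξ)| := by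
      refine integral_mono_of_nonneg (ae_of_all _ fun _ => abs_nonneg _)
        (((hγ.sub hgi).abs.comp_sub_left x).const_mul Q) ?_
      filter_upwards [hb t ht] with ξ hξ
      rw [← sub_mul, abs_mul, mul_comm]
      exact mul_le_mul_of_nonneg_right hξ (abs_nonneg _)
    rw [integral_const_mul, integral_sub_left_eq_self (fun y => |γ y - g y|)] at h1
    refine h1.trans_lt ?_
    have h2 : Q * ∫ y, |γ y - g y| ≤ Q * (ε / (2 * (Q + 1))) := mul_le_mul_of_nonneg_left hg hQ
    refine h2.trans_lt ?_
    rw [mul_div_assoc', div_lt_iff₀ (by positivity)]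
    nlinarith

end Conv

-- Characteristic flows of weak solutions

/-- `X t z` is the position at time `t ∈ [0, S]` of the characteristic starting at `z` of the
nonlocal conservation law, in a medium straightened by `A`. -/
structure IsCharFlow (S c D b : ℝ) (γ q₀ V A : ℝ → ℝ) (X : ℝ → ℝ → ℝ) : Prop where
  continuous : ∀ t, Continuous (X t)
  expandsWith : ∀ t ∈ Icc 0 S, ExpandsWith c (X t)
  zero : ∀ z, X 0 z = z
  abs_sub_le : ∀ t ∈ Icc 0 S, ∀ z, |X t z - z| ≤ D
  abs_conv_le : ∀ t ∈ Icc 0 S, ∀ z, |∫ ζ, γ (X t z - X t ζ) * q₀ ζ| ≤ b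
  hasDerivAt : ∀ z, ∀ t ∈ Ico 0 S,
    HasDerivWithinAt (fun t => A (X t z)) (V (∫ ζ, γ (X t z - X t ζ) * q₀ ζ)) (Ici t) t
  continuousOn : ∀ z, ContinuousOn (fun t => A (X t z)) (Icc 0 S)

theorem LinftyBound.nonneg {S Q : ℝ} {q : ℝ → ℝ → ℝ} (hS : 0 < S) (hq : LinftyBound S Q q) :
    0 ≤ Q := by
  have : NeZero ((volume : Measure ℝ).restrict (Ioo 0 S)) :=
    ⟨by rw [Ne, Measure.restrict_eq_zero, Real.volume_Ioo]; simpa using hS⟩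
  obtain ⟨t, ht⟩ := hq.exists
  obtain ⟨x, hx⟩ := ht.exists
  exact (abs_nonneg _).trans hx

/-- Freezing `w = γ * q` makes the equation linear, with a Lipschitz straightened field, so `q` is
the density transported by that field. Inserting `g = γ (X t z - ·)` in the transport identity
expresses `w` through `X` and `q₀` alone. The constants depend only on bounds for the data and the
solution, so they are common to a family. -/
theorem IsWeakSolution.exists_charFlow {a M LV : NNReal} {S Q G κ C N : ℝ}
    {γ q₀ v V A B : ℝ → ℝ} {q : ℝ → ℝ → ℝ} (hq : IsWeakSolution S γ q₀ v V q)
    (hQ : LinftyBound S Q q) (hS : 0 < S) (hc : Straightens a M v A B) (hγ : IsBVKernel γ G κ)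
    (hq0 : Measurable q₀) (hN : ∀ x, |q₀ x| ≤ N)
    (hVL : LipschitzOnWith LV V (Icc (-(Q * ∫ y, |γ y|)) (Q * ∫ y, |γ y|)))
    (hVC : ∀ x ∈ Icc (-(Q * ∫ y, |γ y|)) (Q * ∫ y, |γ y|), |V x| ≤ C) :
    ∃ X, IsCharFlow S (M * Real.exp (LV * (Q * κ * M) * S) * a) (M * C * S) (Q * ∫ y, |γ y|)
        γ q₀ V A X ∧
      ∀ t ∈ Icc 0 S, ∀ g : ℝ → ℝ, ∫ x, q t x * g x = ∫ z, q₀ z * g (X t z) := by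
  have hQ0 := hQ.nonneg hS
  have hb := hq.memCL1Loc.ae_abs_le hS hQ
  have hm := fun t (ht : t ∈ Icc 0 S) => (hq.memCL1Loc.locallyIntegrable t ht).aestronglyMeasurable
  set b := Q * ∫ y, |γ y| with hbdef
  have hb0 : -b ≤ b := by
    have : 0 ≤ b := mul_nonneg hQ0 (integral_nonneg fun _ => abs_nonneg _)
    linarith
  have hcl := fun t => clampTime_mem hS.le t
  -- Clamping extends the field continuously to all times, as a global flow requires.
  set w : ℝ → ℝ → ℝ := fun t x => realConv γ (q (clampTime S t)) x with hw
  have hwb : ∀ t x, w t x ∈ Icc (-b) b := fun t x =>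
    abs_le.1 (hγ.abs_realConv_le (hm _ (hcl t)) hQ0 (hb _ (hcl t)) x)
  set K : NNReal := LV * ((Q * κ).toNNReal * M)
  have hK : (K : ℝ) = LV * (Q * κ * M) := by
    rw [NNReal.coe_mul, NNReal.coe_mul, Real.coe_toNNReal _ (mul_nonneg hQ0 hγ.nonneg)]
  set μ : ℝ → ℝ → ℝ := fun t y => V (w t (B y)) with hμdef
  have hμ : IsLipschitzField K C μ := by
    refine ⟨fun t => ?_, fun t y => hVC _ (hwb t _), fun y => ?_⟩
    · have hwL : LipschitzWith (Q * κ).toNNReal (w t) := LipschitzWith.of_dist_le_mul fun x y => by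
        rw [Real.coe_toNNReal _ (mul_nonneg hQ0 hγ.nonneg)]
        exact hγ.abs_realConv_sub_le (hm _ (hcl t)) hQ0 (hb _ (hcl t)) x y
      have := hVL.comp ((hwL.comp hc.lipschitz_inv).lipschitzOnWith (s := univ))
        (fun y _ => hwb t (B y))
      exact lipschitzOnWith_univ.1 this
    · refine hVL.continuousOn.comp_continuous ?_ fun t => hwb t _
      exact (hq.memCL1Loc.continuousOn_realConv hγ.integrable hQ0 hb (B y)).comp_continuous
        (lipschitzWith_clampTime S).continuous hcl
  obtain ⟨Φ, hΦ⟩ := hμ.exists_flow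
  have hae := ae_eq_transportedDensity_of_weak hc hμ hΦ hq0 hN hS hq.memCL1Loc
    hq.aestronglyMeasurable hQ fun φ hφ hφc hφs => by
      have hms : MeasurableSet (Ioo 0 S ×ˢ (univ : Set ℝ)) :=
        measurableSet_Ioo.prod MeasurableSet.univ
      refine Eq.trans (congrArg (· + ∫ x, φ (0, x) * q₀ x) ?_) (hq.weak φ hφ hφc hφs)
      refine setIntegral_congr_fun hms fun p hp => ?_
      simp only [hμdef, hw]
      rw [clampTime_of_mem (Ioo_subset_Icc_self hp.1), hc.left_inv]
  have hrep : ∀ t ∈ Icc 0 S, ∀ g : ℝ → ℝ,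
      ∫ x, q t x * g x = ∫ z, q₀ z * g (charCurve A B Φ t z) := by
    intro t ht g
    rw [← integral_transportedDensity_mul hc hμ hΦ q₀ g t]
    refine integral_congr_ae ?_
    filter_upwards [hae t ht] with x hx
    rw [hx]
  have hwX : ∀ t ∈ Icc 0 S, ∀ z, ∫ ζ, γ (charCurve A B Φ t z - charCurve A B Φ t ζ) * q₀ ζ =
      w t (charCurve A B Φ t z) := by
    intro t ht z
    simp only [hw]
    rw [clampTime_of_mem ht, realConv_eq_integral_sub]
    have := hrep t ht fun x => γ (charCurve A B Φ t z - x)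
    simp_rw [mul_comm (γ _)]
    exact this.symm
  refine ⟨charCurve A B Φ, ⟨fun t => ?_, fun t ht => ?_, charCurve_zero hc hΦ, fun t ht z => ?_,
    fun t ht z => ?_, fun z t ht => ?_, fun z => ?_⟩, hrep⟩
  · exact (continuous_charCurve hc hμ hΦ).comp (by fun_prop : Continuous fun z : ℝ => (t, z))
  · have h1 := expandsWith_charCurve hc hμ hΦ t
    rw [hK, abs_of_nonneg ht.1] at h1
    have hle : M * Real.exp (LV * (Q * κ * M) * t) * a ≤ M * Real.exp (LV * (Q * κ * M) * S) * a := by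
      have : 0 ≤ LV * (Q * κ * M) := hK ▸ K.2
      have := mul_le_mul_of_nonneg_left ht.2 this
      gcongr
    exact ⟨h1.1.trans hle, fun x y => (h1.2 x y).trans
      (mul_le_mul_of_nonneg_right hle (abs_nonneg _))⟩
  · have h1 := abs_charCurve_sub_le hc hμ hΦ t 0 z
    rw [charCurve_zero hc hΦ, sub_zero, abs_of_nonneg ht.1] at h1
    exact h1.trans (mul_le_mul_of_nonneg_left ht.2 (mul_nonneg M.2 hμ.C_nonneg))
  · rw [hwX t ht]; exact abs_le.2 (hwb t _)
  · rw [hwX t (Ico_subset_Icc_self ht)]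
    have := (hΦ.hasDerivAt 0 t (A z)).hasDerivWithinAt (s := Ici t)
    simpa only [charCurve, hc.right_inv] using this
  · simp only [charCurve, hc.right_inv]
    exact (hΦ.continuous_time 0 (A z)).continuousOn

/-- Gronwall, with `(exp (K t) - 1) / K` replaced by the larger `t * exp (K t)`, which also covers
`K = 0`. -/
theorem IsFlow.abs_sub_le_of_abs_field_sub_le {K : NNReal} {C ε : ℝ} {μ μ' : ℝ → ℝ → ℝ}
    {Φ Φ' : ℝ → ℝ → ℝ → ℝ} (hΦ : IsFlow μ Φ) (hΦ' : IsFlow μ' Φ') (hμ : IsLipschitzField K C μ)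
    (hε : ∀ t y, |μ t y - μ' t y| ≤ ε) {t : ℝ} (ht : 0 ≤ t) (y : ℝ) :
    |Φ 0 t y - Φ' 0 t y| ≤ ε * t * Real.exp (K * t) := by
  have hε0 : 0 ≤ ε := (abs_nonneg _).trans (hε 0 0)
  have h := dist_le_of_approx_trajectories_ODE (v := μ) (K := K) (f := fun t => Φ 0 t y)
    (g := fun t => Φ' 0 t y) (f' := fun t => μ t (Φ 0 t y)) (g' := fun t => μ' t (Φ' 0 t y))
    (a := 0) (b := t) (δ := 0) (εf := 0) (εg := ε) hμ.lipschitz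
    (hΦ.continuous_time 0 y).continuousOn (fun t _ => (hΦ.hasDerivAt 0 t y).hasDerivWithinAt)
    (fun _ _ => by simp)
    (hΦ'.continuous_time 0 y).continuousOn (fun t _ => (hΦ'.hasDerivAt 0 t y).hasDerivWithinAt)
    (fun s _ => by rw [Real.dist_eq, abs_sub_comm]; exact hε _ _)
    (by simp [hΦ.self, hΦ'.self]) t ⟨ht, le_rfl⟩
  rw [Real.dist_eq, zero_add, sub_zero] at h
  refine h.trans ?_
  rcases eq_or_ne (K : ℝ) 0 with hK | hK
  · rw [hK, gronwallBound_K0]; simp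
  · simp only [gronwallBound_of_K_ne_0 hK, zero_mul, zero_add]
    have hK0 : 0 < (K : ℝ) := lt_of_le_of_ne K.2 hK.symm
    have h1 : Real.exp (K * t) - 1 ≤ K * t * Real.exp (K * t) := by
      have h2 := Real.add_one_le_exp (-(K * t))
      have h3 := mul_le_mul_of_nonneg_right h2 (Real.exp_pos (K * t)).le
      rw [← Real.exp_add, neg_add_cancel, Real.exp_zero] at h3
      linarith
    calc ε / K * (Real.exp (K * t) - 1) ≤ ε / K * (K * t * Real.exp (K * t)) :=
          mul_le_mul_of_nonneg_left h1 (by positivity)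
      _ = _ := by field_simp

-- Local existence by contraction

theorem Real.exp_le_two {x : ℝ} (h0 : 0 ≤ x) (h : x ≤ 1 / 4) : Real.exp x ≤ 2 := by
  refine (Real.exp_bound_div_one_sub_of_interval h0 (by linarith)).trans ?_
  rw [div_le_iff₀ (by linarith)]; linarith

section Existence

variable {a M LV : NNReal} {S T G κ C N c : ℝ} {γ q₀ v V A B : ℝ → ℝ}

/-- The bounded continuous functions of time and space that are bounded by `b` and `L`-Lipschitz
in space. -/
def lipschitzBall (b L : ℝ) : Set (BoundedContinuousFunction (ℝ × ℝ) ℝ) :=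
  {w | (∀ p, |w p| ≤ b) ∧ ∀ t x y, |w (t, x) - w (t, y)| ≤ L * |x - y|}

theorem isClosed_lipschitzBall (b L : ℝ) : IsClosed (lipschitzBall b L) := by
  have hc : ∀ p : ℝ × ℝ, Continuous fun w : BoundedContinuousFunction (ℝ × ℝ) ℝ => w p := fun p =>
    continuous_eval_const p
  simp only [lipschitzBall, ofPred_and, ofPred_forall]
  refine (isClosed_iInter fun p => isClosed_le (hc p).abs continuous_const).inter
    (isClosed_iInter fun t => isClosed_iInter fun x => isClosed_iInter fun y =>
      isClosed_le ((hc _).sub (hc _)).abs continuous_const)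

theorem isLipschitzField_of_mem_lipschitzBall {b : ℝ} {L : NNReal} (hc : Straightens a M v A B)
    (hVL : LipschitzOnWith LV V (Icc (-b) b)) (hVC : ∀ x ∈ Icc (-b) b, |V x| ≤ C)
    {w : BoundedContinuousFunction (ℝ × ℝ) ℝ} (hw : w ∈ lipschitzBall b L) :
    IsLipschitzField (LV * (L * M)) C fun t y => V (w (t, B y)) := by
  have hmem : ∀ p, w p ∈ Icc (-b) b := fun p => abs_le.1 (hw.1 p)
  refine ⟨fun t => ?_, fun t y => hVC _ (hmem _), fun y => ?_⟩
  · have hwL : LipschitzWith L fun x => w (t, x) := LipschitzWith.of_dist_le_mul fun x y =>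
      hw.2 t x y
    exact lipschitzOnWith_univ.1 (hVL.comp ((hwL.comp hc.lipschitz_inv).lipschitzOnWith
      (s := univ)) fun y _ => hmem (t, B y))
  · exact hVL.continuousOn.comp_continuous (w.continuous.comp (by fun_prop)) fun t => hmem _

/-- On a short horizon the expansion constant does not depend on the field. The radius and the
Lipschitz bound of the ball in the fixed point argument can therefore be fixed beforehand, which
removes the circularity. -/
theorem expandsWith_charCurve_of_le {K : NNReal} {μ : ℝ → ℝ → ℝ} {Φ : ℝ → ℝ → ℝ → ℝ}
    (hc : Straightens a M v A B) (hμ : IsLipschitzField K C μ) (hΦ : IsFlow μ Φ)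
    (hS : 0 ≤ S) (hK : K * S ≤ 1 / 4) (t : ℝ) :
    ExpandsWith (2 * (M * a)) (charCurve A B Φ (clampTime S t)) := by
  have h1 := expandsWith_charCurve hc hμ hΦ (clampTime S t)
  have ht := clampTime_mem hS t
  have he : Real.exp (K * |clampTime S t|) ≤ 2 := by
    rw [abs_of_nonneg ht.1]
    exact Real.exp_le_two (mul_nonneg K.2 ht.1) ((mul_le_mul_of_nonneg_left ht.2 K.2).trans hK)
  have hle : M * Real.exp (K * |clampTime S t|) * a ≤ 2 * (M * a) := by
    calc M * Real.exp (K * |clampTime S t|) * a ≤ M * 2 * a := by gcongr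
      _ = _ := by ring
  exact ⟨by positivity, fun x y => (h1.2 x y).trans
      (mul_le_mul_of_nonneg_right hle (abs_nonneg _))⟩

/-- Local existence: a fixed point argument for the nonlocal term. -/
theorem exists_isWeakSolution {K : NNReal} (hc : Straightens a M v A B) (hγ : IsBVKernel γ G κ)
    (hq0 : Measurable q₀) (hN : ∀ x, |q₀ x| ≤ N) (hcdef : c = 2 * (M * a))
    (hVL : LipschitzOnWith LV V (Icc (-(N * (c * ∫ y, |γ y|))) (N * (c * ∫ y, |γ y|))))
    (hVC : ∀ x ∈ Icc (-(N * (c * ∫ y, |γ y|))) (N * (c * ∫ y, |γ y|)), |V x| ≤ C)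
    (hS : 0 < S) (hK : K = LV * ((N * (c * κ)).toNNReal * M)) (hKS : K * S ≤ 1 / 4) :
    ∃ q, IsWeakSolution S γ q₀ v V q ∧ LinftyBound S (N * c) q := by
  have hN0 : 0 ≤ N := (abs_nonneg _).trans (hN 0)
  have hc0 : 0 ≤ c := by rw [hcdef]; positivity
  have hL0 : 0 ≤ N * (c * κ) := mul_nonneg hN0 (mul_nonneg hc0 hγ.nonneg)
  set b := N * (c * ∫ y, |γ y|)
  set L := (N * (c * κ)).toNNReal with hL
  have hLc : (L : ℝ) = N * (c * κ) := Real.coe_toNNReal _ hL0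
  set 𝒲 := lipschitzBall b L
  have hfield : ∀ w : 𝒲, IsLipschitzField K C fun t y => V (w.1 (t, B y)) := fun w =>
    hK ▸ isLipschitzField_of_mem_lipschitzBall hc hVL hVC w.2
  choose Φ hΦ using fun w => (hfield w).exists_flow
  have hexp : ∀ w t, ExpandsWith c (charCurve A B (Φ w) (clampTime S t)) := fun w t =>
    hcdef ▸ expandsWith_charCurve_of_le hc (hfield w) (hΦ w) hS.le hKS t
  have hXm : ∀ w t, Measurable (charCurve A B (Φ w) t) := fun w t =>
    ((continuous_charCurve hc (hfield w) (hΦ w)).comp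
      (by fun_prop : Continuous fun z : ℝ => (t, z))).measurable
  have hexp' : ∀ w t x, ExpandsWith c fun z => x - charCurve A B (Φ w) (clampTime S t) z :=
    fun w t x => (hexp w t).const_sub x
  have hXm' : ∀ w t x, Measurable fun z => x - charCurve A B (Φ w) (clampTime S t) z :=
    fun w t x => (hXm w _).const_sub x
  -- The convolution of `γ` with the density transported by the field of `w`, written in labels so
  -- that no density is needed.
  set F : 𝒲 → ℝ × ℝ → ℝ := fun w p =>
    ∫ z, γ (p.2 - charCurve A B (Φ w) (clampTime S p.1) z) * q₀ z with hF
  have hC0 : 0 ≤ C := by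
    have hb0 : 0 ≤ b := mul_nonneg hN0 (mul_nonneg hc0 (integral_nonneg fun _ => abs_nonneg _))
    exact (abs_nonneg _).trans (hVC 0 ⟨by linarith, hb0⟩)
  have hFb : ∀ w p, |F w p| ≤ b := fun w p =>
    hγ.abs_integral_comp_le (hexp' w p.1 p.2) (hXm' w p.1 p.2) hN
  have hFsub : ∀ w w' p r δ, 0 ≤ δ → (∀ z, |p.2 - charCurve A B (Φ w) (clampTime S p.1) z -
      (r.2 - charCurve A B (Φ w') (clampTime S r.1) z)| ≤ δ) → |F w p - F w' r| ≤ L * δ := by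
    intro w w' p r δ hδ h
    have := hγ.abs_integral_comp_sub_le (hexp' w p.1 p.2) (hXm' w p.1 p.2) (hexp' w' r.1 r.2)
      (hXm' w' r.1 r.2) hδ h hN hq0
    rw [hLc, mul_assoc, mul_assoc]
    rwa [mul_assoc] at this
  have hFL : ∀ w p r, |F w p - F w r| ≤ L * (|p.2 - r.2| + M * C * |p.1 - r.1|) := by
    intro w p r
    refine hFsub w w p r _ (by positivity) fun z => ?_
    have h1 := abs_charCurve_sub_le hc (hfield w) (hΦ w) (clampTime S p.1) (clampTime S r.1) z
    have h2 := mul_le_mul_of_nonneg_left (abs_clampTime_sub_le S p.1 r.1)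
      (by positivity : 0 ≤ M * C)
    calc _ = |(p.2 - r.2) - (charCurve A B (Φ w) (clampTime S p.1) z -
          charCurve A B (Φ w) (clampTime S r.1) z)| := by ring_nf
      _ ≤ _ := (abs_sub _ _).trans (add_le_add le_rfl (h1.trans h2))
  have hFc : ∀ w, Continuous (F w) := by
    intro w
    rw [continuous_iff_continuousAt]
    intro r
    refine tendsto_iff_dist_tendsto_zero.2 (squeeze_zero (fun _ => dist_nonneg)
      (g := fun p : ℝ × ℝ => L * (|p.2 - r.2| + M * C * |p.1 - r.1|)) (fun p => hFL w p r) ?_)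
    have : Continuous fun p : ℝ × ℝ => L * (|p.2 - r.2| + M * C * |p.1 - r.1|) := by fun_prop
    simpa using this.tendsto r
  let 𝒯 : 𝒲 → 𝒲 := fun w =>
    ⟨BoundedContinuousFunction.ofNormedAddCommGroup (F w) (hFc w) b (hFb w), hFb w,
      fun t x y => (hFL w (t, x) (t, y)).trans_eq (by simp)⟩
  -- The flows differ by at most `LV * dist * S * 2`; the map `B` contributes `M` and the kernel
  -- `L`. The total factor is `2 * K * S ≤ 1 / 2`.
  have hcontr : ContractingWith (1 / 2) 𝒯 := by
    refine ⟨by rw [← NNReal.coe_lt_coe]; norm_num, LipschitzWith.of_dist_le_mul fun w w' => ?_⟩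
    have hd : 0 ≤ dist w w' := dist_nonneg
    rw [Subtype.dist_eq]
    refine (BoundedContinuousFunction.dist_le (by positivity)).2 fun p => ?_
    have hww : ∀ p, |w.1 p - w'.1 p| ≤ dist w w' := fun p =>
      BoundedContinuousFunction.dist_coe_le_dist (f := w.1) (g := w'.1) p
    have hdiff : ∀ t y, |V (w.1 (t, B y)) - V (w'.1 (t, B y))| ≤ LV * dist w w' := fun t y =>
      (hVL.dist_le_mul _ (abs_le.1 (w.2.1 _)) _ (abs_le.1 (w'.2.1 _))).trans
        (mul_le_mul_of_nonneg_left (hww _) LV.2)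
    have ht := clampTime_mem hS.le p.1
    have hX : ∀ z, |charCurve A B (Φ w) (clampTime S p.1) z -
        charCurve A B (Φ w') (clampTime S p.1) z| ≤ M * (LV * dist w w' * S * 2) := by
      intro z
      have h1 := (hΦ w).abs_sub_le_of_abs_field_sub_le (hΦ w') (hfield w) hdiff ht.1
        (A z)
      have h2 := hc.lipschitz_inv.dist_le_mul (Φ w 0 (clampTime S p.1) (A z))
        (Φ w' 0 (clampTime S p.1) (A z))
      rw [Real.dist_eq, Real.dist_eq] at h2
      refine h2.trans (mul_le_mul_of_nonneg_left (h1.trans ?_) M.2)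
      have h4 : Real.exp (K * clampTime S p.1) ≤ 2 := Real.exp_le_two (mul_nonneg K.2 ht.1)
        ((mul_le_mul_of_nonneg_left ht.2 K.2).trans hKS)
      have h5 := ht.2
      have h6 := ht.1
      gcongr
    have h1 := hFsub w w' p p (M * (LV * dist w w' * S * 2)) (by positivity) fun z => by
      rw [sub_sub_sub_cancel_left, abs_sub_comm]; exact hX z
    refine h1.trans ?_
    have hKc : (K : ℝ) = LV * (L * M) := by rw [hK]; push_cast; ring
    rw [hKc] at hKS
    calc L * (M * (LV * dist w w' * S * 2)) = 2 * (LV * (L * M) * S) * dist w w' := by ring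
      _ ≤ 2 * (1 / 4) * dist w w' := by gcongr
      _ = _ := by push_cast; norm_num
  have : CompleteSpace 𝒲 := (isClosed_lipschitzBall b L).completeSpace_coe
  have : Nonempty 𝒲 := by
    refine ⟨⟨0, fun p => ?_, fun t x y => ?_⟩⟩
    · simpa using mul_nonneg hN0 (mul_nonneg hc0 (integral_nonneg fun _ => abs_nonneg _))
    · simpa using mul_nonneg L.2 (abs_nonneg _)
  obtain ⟨w, hw⟩ : ∃ w, 𝒯 w = w := ⟨_, hcontr.fixedPoint_isFixedPt⟩
  have hwF : ∀ p, w.1 p = F w p := fun p => by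
    conv_lhs => rw [← hw]
    rfl
  have hμ := hfield w
  -- At the fixed point the frozen nonlocal term is that of the transported density itself, so the
  -- linear weak formulation is the nonlinear one.
  have hconv : ∀ t ∈ Icc 0 S, ∀ x,
      realConv γ (transportedDensity q₀ A B (Φ w) t) x = w.1 (t, x) := by
    intro t ht x
    rw [hwF, realConv_eq_integral_sub]
    simp only [hF]
    rw [clampTime_of_mem ht]
    have := integral_transportedDensity_mul hc hμ (hΦ w) q₀ (fun ξ => γ (x - ξ)) t
    simp_rw [mul_comm (γ _)]
    exact this
  have hbd : LinftyBound S (N * c) (transportedDensity q₀ A B (Φ w)) := by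
    refine (ae_restrict_iff' measurableSet_Ioo).2 (ae_of_all _ fun t ht => ae_of_all _ fun x => ?_)
    refine (abs_transportedDensity_le hc hμ (hΦ w) hN t x).trans ?_
    have h4 : Real.exp (K * t) ≤ 2 := Real.exp_le_two (mul_nonneg K.2 ht.1.le)
      ((mul_le_mul_of_nonneg_left ht.2.le K.2).trans hKS)
    rw [abs_of_pos ht.1, hcdef]
    calc N * M * Real.exp (K * t) * a ≤ N * M * 2 * a := by gcongr
      _ = _ := by ring
  refine ⟨transportedDensity q₀ A B (Φ w), ⟨memCL1Loc_transportedDensity hc hμ (hΦ w) hq0 hN S,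
    (measurable_transportedDensity hc hμ (hΦ w) hq0).aestronglyMeasurable, ⟨_, hbd⟩, ?_⟩, hbd⟩
  intro φ hφ hφc hφs
  have hms : MeasurableSet (Ioo 0 S ×ˢ (univ : Set ℝ)) :=
    measurableSet_Ioo.prod MeasurableSet.univ
  refine Eq.trans (congrArg (· + ∫ x, φ (0, x) * q₀ x) ?_)
    (weak_transportedDensity hc hμ (hΦ w) hμ.continuous_uncurry.measurable hq0 hN hS hφ hφc hφs)
  refine setIntegral_congr_fun hms fun p hp => ?_
  rw [hconv _ (Ioo_subset_Icc_self hp.1), hc.left_inv]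

end Existence

-- Stability of characteristics

theorem MeasureTheory.Integrable.exists_setIntegral_tail_le {γ : ℝ → ℝ} (hγ : Integrable γ)
    {ε : ℝ} (hε : 0 < ε) : ∃ r, ∫ y in {y | r < |y|}, |γ y| ≤ ε := by
  have h := tendsto_setIntegral_of_antitone (μ := volume) (f := fun y => |γ y|)
    (s := fun n : ℕ => {y : ℝ | (n : ℝ) < |y|})
    (fun n => measurableSet_lt measurable_const measurable_id.abs)
    (fun m n hmn y (hy : (n : ℝ) < |y|) =>
      show (m : ℝ) < |y| from (Nat.cast_le.2 hmn).trans_lt hy) ⟨0, hγ.abs.integrableOn⟩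
  have he : ⋂ n : ℕ, {y : ℝ | (n : ℝ) < |y|} = ∅ := by
    refine eq_empty_of_forall_notMem fun y hy => ?_
    obtain ⟨n, hn⟩ := exists_nat_ge |y|
    exact absurd (mem_iInter.1 hy n) (not_lt.2 hn)
  rw [he, Measure.restrict_empty, integral_zero_measure] at h
  obtain ⟨n, hn⟩ := (h.eventually (ge_mem_nhds hε)).exists
  exact ⟨n, hn⟩

section Conv

variable {γ f f' F F' : ℝ → ℝ} {G κ c N D R R' δ r τ ρ : ℝ}

/-- The nonlocal term depends continuously on the characteristics and on the initial datum,
locally in space up to the tails of the kernel. -/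
theorem IsBVKernel.abs_integral_sub_integral_le (hγ : IsBVKernel γ G κ) (hF : ExpandsWith c F)
    (hF' : ExpandsWith c F') (hFc : Continuous F) (hFc' : Continuous F')
    (hFD : ∀ z, |F z - z| ≤ D) (hFD' : ∀ z, |F' z - z| ≤ D) (hf : Measurable f)
    (hf' : Measurable f') (hN : ∀ z, |f z| ≤ N) (hN' : ∀ z, |f' z| ≤ N) (hδ : 0 ≤ δ)
    (hclose : ∀ z, |z| ≤ R' → |F z - F' z| ≤ δ) (hr : r = R' - R - 2 * D)
    (hτ : ∫ y in {y | r < |y|}, |γ y| ≤ τ) (hρ : ∫ x in Icc (-R') R', |f x - f' x| ≤ ρ)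
    {z : ℝ} (hz : |z| ≤ R) :
    |(∫ ζ, γ (F z - F ζ) * f ζ) - ∫ ζ, γ (F' z - F' ζ) * f' ζ| ≤
      N * (c * κ * (|F z - F' z| + δ)) + G * ρ + 2 * N * c * τ := by
  have hN0 : 0 ≤ N := (abs_nonneg _).trans (hN 0)
  have hG0 : 0 ≤ G := (abs_nonneg _).trans (hγ.bound 0)
  have hc0 := hF.1
  set E := Icc (-R') R' with hE
  set k : ℝ → ℝ := {y : ℝ | r < |y|}.indicator fun y => |γ y| with hk
  have hkm : MeasurableSet {y : ℝ | r < |y|} := measurableSet_lt measurable_const measurable_id.abs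
  have hki : Integrable k := hγ.integrable.abs.indicator hkm
  have hk0 : ∀ y, 0 ≤ k y := fun y => indicator_nonneg (fun _ _ => abs_nonneg _) y
  have hexp := hF.const_sub (F z)
  have hexp' := hF'.const_sub (F' z)
  have hm : Measurable fun ζ => F z - F ζ := hFc.measurable.const_sub _
  have hm' : Measurable fun ζ => F' z - F' ζ := hFc'.measurable.const_sub _
  have i1 : Integrable fun ζ => γ (F z - F ζ) := hexp.integrable_comp hm hγ.integrable
  have i2 : Integrable fun ζ => γ (F' z - F' ζ) := hexp'.integrable_comp hm' hγ.integrable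
  have j1 : Integrable fun ζ => γ (F z - F ζ) * f ζ :=
    i1.mul_bdd (c := N) hf.aestronglyMeasurable (ae_of_all _ hN)
  have j2 : Integrable fun ζ => γ (F' z - F' ζ) * f' ζ :=
    i2.mul_bdd (c := N) hf'.aestronglyMeasurable (ae_of_all _ hN')
  have k1 : Integrable fun ζ => k (F z - F ζ) := hexp.integrable_comp hm hki
  have k2 : Integrable fun ζ => k (F' z - F' ζ) := hexp'.integrable_comp hm' hki
  have l1 : Integrable fun ζ => N * |γ (F z - F ζ) - γ (F' z - F' ζ)| :=
    (i1.sub i2).abs.const_mul N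
  have l2 : IntegrableOn (fun ζ => G * |f ζ - f' ζ|) E := by
    refine Integrable.const_mul (Measure.integrableOn_of_bounded (M := 2 * N) (by simp [hE])
      (hf.sub hf').abs.aestronglyMeasurable (ae_of_all _ fun x => ?_)) G
    rw [Real.norm_eq_abs, abs_abs]
    refine (abs_sub (f x) (f' x)).trans ?_
    linarith [hN x, hN' x]
  set bound : ℝ → ℝ := fun ζ =>
    E.indicator (fun ζ => N * |γ (F z - F ζ) - γ (F' z - F' ζ)| + G * |f ζ - f' ζ|) ζ +
      (N * k (F z - F ζ) + N * k (F' z - F' ζ)) with hbound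
  have hEi : IntegrableOn (fun ζ => N * |γ (F z - F ζ) - γ (F' z - F' ζ)| + G * |f ζ - f' ζ|) E :=
    l1.integrableOn.add l2
  have b1 := (integrable_indicator_iff (measurableSet_Icc (a := -R') (b := R'))).2 hEi
  have b2 : Integrable fun ζ => N * k (F z - F ζ) + N * k (F' z - F' ζ) :=
    (k1.const_mul N).add (k2.const_mul N)
  have hpt : ∀ ζ, |γ (F z - F ζ) * f ζ - γ (F' z - F' ζ) * f' ζ| ≤ bound ζ := by
    intro ζ
    simp only [hbound]
    have n1 := hk0 (F z - F ζ)
    have n2 := hk0 (F' z - F' ζ)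
    by_cases hζ : ζ ∈ E
    · rw [indicator_of_mem hζ]
      -- On the bounded set the kernel difference is estimated by the variation of `γ`, the datum
      -- difference by `sup |γ|` times an `L¹` norm.
      have e : γ (F z - F ζ) * f ζ - γ (F' z - F' ζ) * f' ζ =
          (γ (F z - F ζ) - γ (F' z - F' ζ)) * f ζ + γ (F' z - F' ζ) * (f ζ - f' ζ) := by ring
      rw [e]
      refine (abs_add_le _ _).trans ?_
      rw [abs_mul, abs_mul, mul_comm _ |f ζ|]
      have h1 := mul_le_mul_of_nonneg_right (hN ζ) (abs_nonneg (γ (F z - F ζ) - γ (F' z - F' ζ)))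
      have h2 := mul_le_mul_of_nonneg_right (hγ.bound (F' z - F' ζ)) (abs_nonneg (f ζ - f' ζ))
      have h3 := mul_nonneg hN0 n1
      have h4 := mul_nonneg hN0 n2
      linarith
    · rw [indicator_of_notMem hζ, zero_add]
      have hζ' : R' < |ζ| := not_le.1 fun h => hζ (abs_le.1 h)
      -- Points with `|z| ≤ R` and `|ζ| > R'` remain more than `R' - R - 2 D = r` apart after
      -- displacements of at most `D`, so only the tail of `γ` is seen.
      have far : ∀ {H : ℝ → ℝ}, (∀ z, |H z - z| ≤ D) → r < |H z - H ζ| := by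
        intro H hH
        have h1 : |ζ| ≤ |H z - H ζ| + |H z - z| + |H ζ - ζ| + |z| := by
          calc |ζ| = |-(H z - H ζ) + (H z - z) - (H ζ - ζ) + z| := by ring_nf
            _ ≤ |-(H z - H ζ) + (H z - z) - (H ζ - ζ)| + |z| := abs_add_le _ _
            _ ≤ |-(H z - H ζ) + (H z - z)| + |H ζ - ζ| + |z| := by gcongr; exact abs_sub _ _
            _ ≤ |-(H z - H ζ)| + |H z - z| + |H ζ - ζ| + |z| := by gcongr; exact abs_add_le _ _
            _ = _ := by rw [abs_neg]
        linarith [hH z, hH ζ]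
      have e1 : k (F z - F ζ) = |γ (F z - F ζ)| :=
        indicator_of_mem (s := {y : ℝ | r < |y|}) (far hFD) _
      have e2 : k (F' z - F' ζ) = |γ (F' z - F' ζ)| :=
        indicator_of_mem (s := {y : ℝ | r < |y|}) (far hFD') _
      rw [e1, e2]
      refine (abs_sub _ _).trans ?_
      rw [abs_mul, abs_mul, mul_comm N, mul_comm N]
      exact add_le_add (mul_le_mul_of_nonneg_left (hN ζ) (abs_nonneg _))
        (mul_le_mul_of_nonneg_left (hN' ζ) (abs_nonneg _))
  have hkc : ∀ {H : ℝ → ℝ}, ExpandsWith c (fun ζ => H z - H ζ) →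
      Measurable (fun ζ => H z - H ζ) → ∫ ζ, N * k (H z - H ζ) ≤ N * (c * τ) := by
    intro H hH hHm
    rw [integral_const_mul]
    refine mul_le_mul_of_nonneg_left ?_ hN0
    have h1 := hH.integral_abs_comp_le hHm hki
    simp_rw [abs_of_nonneg (hk0 _)] at h1
    refine h1.trans (mul_le_mul_of_nonneg_left ?_ hc0)
    rw [hk, integral_indicator hkm]
    exact hτ
  rw [← integral_sub j1 j2]
  refine abs_integral_le_integral_abs.trans ?_
  refine (integral_mono (j1.sub j2).abs (b1.add b2) hpt).trans ?_
  rw [integral_add' b1 b2, integral_indicator measurableSet_Icc,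
    integral_add l1.integrableOn l2, integral_add (k1.const_mul N) (k2.const_mul N),
    integral_const_mul, integral_const_mul]
  have t1 := hγ.setIntegral_abs_comp_sub_le hexp hm hm' (measurableSet_Icc (a := -R') (b := R'))
    (δ := |F z - F' z| + δ) (by positivity) fun ζ hζ => by
      calc |F z - F ζ - (F' z - F' ζ)| = |(F z - F' z) - (F ζ - F' ζ)| := by ring_nf
        _ ≤ _ := (abs_sub _ _).trans (add_le_add le_rfl (hclose ζ (abs_le.2 hζ)))
  have t2 := mul_le_mul_of_nonneg_left t1 hN0
  have t3 := mul_le_mul_of_nonneg_left hρ hG0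
  have t4 := hkc hexp hm
  have t5 := hkc hexp' hm'
  linarith

end Conv

section Stability

variable {M LV : NNReal} {S c D b G κ N d η R R' r τ ρ α ω σ Λ k : ℝ}
  {γ q₀ q₀' V V' A A' B : ℝ → ℝ} {X X' : ℝ → ℝ → ℝ}

/-- One step of the comparison of two characteristic flows. -/
theorem IsCharFlow.abs_sub_le_half (hX : IsCharFlow S c D b γ q₀ V A X)
    (hX' : IsCharFlow S c D b γ q₀' V' A' X') (hγ : IsBVKernel γ G κ) (hM : 0 < M)
    (hB : LipschitzWith M B) (hBA : ∀ x, B (A x) = x) (hS : 0 ≤ S)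
    (hq : Measurable q₀) (hq' : Measurable q₀') (hN : ∀ z, |q₀ z| ≤ N) (hN' : ∀ z, |q₀' z| ≤ N)
    (hVL : LipschitzOnWith LV V (Icc (-b) b)) (hω : ∀ x ∈ Icc (-b) b, |V x - V' x| ≤ ω)
    (hα : ∀ x, |x| ≤ R + D → |A x - A' x| ≤ α) (hr : r = R' - R - 2 * D)
    (hτ : ∫ y in {y | r < |y|}, |γ y| ≤ τ) (hρ : ∫ x in Icc (-R') R', |q₀ x - q₀' x| ≤ ρ)
    (hd : 0 ≤ d) (hη : 0 ≤ η) (hk : k = LV * (N * (c * κ))) (hΛ : Λ = 3 * (k * M) + 1)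
    (hclose : ∀ t ∈ Icc 0 S, ∀ z, |z| ≤ R' → |X t z - X' t z| ≤ d * Real.exp (Λ * t) + η)
    (hσ : k * (M * α + η) + LV * (G * ρ + 2 * N * c * τ) + ω < σ) (hασ : α ≤ σ) :
    ∀ t ∈ Icc 0 S, ∀ z, |z| ≤ R →
      |X t z - X' t z| ≤ d / 2 * Real.exp (Λ * t) + 2 * M * σ * Real.exp (Λ * S) := by
  have hM' : (0 : ℝ) < M := hM
  have hN0 : 0 ≤ N := (abs_nonneg _).trans (hN 0)
  have hc0 : 0 ≤ c := (hX.expandsWith 0 ⟨le_rfl, hS⟩).1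
  have hk0 : 0 ≤ k := by
    have := hγ.nonneg
    rw [hk]; positivity
  have hΛ0 : 0 ≤ Λ := by rw [hΛ]; positivity
  have hD0 : 0 ≤ D := (abs_nonneg _).trans (hX.abs_sub_le 0 ⟨le_rfl, hS⟩ 0)
  intro t ht z hz
  have hα0 : 0 ≤ α := (abs_nonneg _).trans (hα z (by linarith))
  have hσ0 : 0 ≤ σ := hα0.trans hασ
  have hXX : ∀ s ∈ Icc 0 S, |X s z - X' s z| ≤ M * |A (X s z) - A' (X' s z)| + M * α := by
    intro s hs
    have h1 := hB.dist_le_mul (A (X s z)) (A (X' s z))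
    rw [hBA, hBA, Real.dist_eq, Real.dist_eq] at h1
    refine h1.trans ?_
    rw [← mul_add]
    refine mul_le_mul_of_nonneg_left ?_ hM'.le
    have h2 := hX'.abs_sub_le s hs z
    have h3 : |X' s z| ≤ R + D := by
      calc |X' s z| = |z + (X' s z - z)| := by ring_nf
        _ ≤ _ := (abs_add_le _ _).trans (add_le_add hz h2)
    have h4 := hα _ h3
    rw [abs_sub_comm] at h4
    calc |A (X s z) - A (X' s z)| = |(A (X s z) - A' (X' s z)) + (A' (X' s z) - A (X' s z))| := by
          ring_nf
      _ ≤ _ := (abs_add_le _ _).trans (add_le_add le_rfl h4)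
  -- Amplitude of the barrier `p * exp (Λ s)` in straightened coordinates; returning through `B`
  -- multiplies it by `M`, which gives the halved `d / 2`.
  set p : ℝ := d / (2 * M) + σ with hp
  have hp0 : 0 ≤ p := by positivity
  have hbd : ∀ s, HasDerivAt (fun s => p * Real.exp (Λ * s)) (p * (Real.exp (Λ * s) * Λ)) s :=
    fun s => by
      have := ((hasDerivAt_id s).const_mul Λ).exp.const_mul p
      simpa using this
  have key := image_norm_le_of_norm_deriv_right_lt_deriv_boundary
    (f := fun s => A (X s z) - A' (X' s z))
    (f' := fun s => V (∫ ζ, γ (X s z - X s ζ) * q₀ ζ) - V' (∫ ζ, γ (X' s z - X' s ζ) * q₀' ζ))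
    (a := 0) (b := S) ((hX.continuousOn z).sub (hX'.continuousOn z))
    (fun s hs => (hX.hasDerivAt z s hs).sub (hX'.hasDerivAt z s hs))
    (B := fun s => p * Real.exp (Λ * s)) (B' := fun s => p * (Real.exp (Λ * s) * Λ))
    (by
      rw [hX.zero, hX'.zero, mul_zero, Real.exp_zero, mul_one, Real.norm_eq_abs]
      have : 0 ≤ d / (2 * M) := by positivity
      linarith [hα z (by linarith)]) hbd ?_ ht
  · simp only [Real.norm_eq_abs] at key
    refine (hXX t ht).trans ?_
    have h1 := mul_le_mul_of_nonneg_left key hM'.le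
    have h2 : Real.exp (Λ * t) ≤ Real.exp (Λ * S) :=
      Real.exp_le_exp.2 (mul_le_mul_of_nonneg_left ht.2 hΛ0)
    have h3 : 1 ≤ Real.exp (Λ * S) := Real.one_le_exp (mul_nonneg hΛ0 hS)
    have e : M * (p * Real.exp (Λ * t)) = d / 2 * Real.exp (Λ * t) + M * σ * Real.exp (Λ * t) := by
      rw [hp]; field_simp
    have h4 := mul_le_mul_of_nonneg_left h2 (by positivity : 0 ≤ M * σ)
    have h5 : M * α ≤ M * σ * Real.exp (Λ * S) := by
      calc M * α ≤ M * σ := by gcongr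
        _ ≤ _ := le_mul_of_one_le_right (by positivity) h3
    linarith
  · intro s hs heq
    have hs' := Ico_subset_Icc_self hs
    simp only [Real.norm_eq_abs] at heq ⊢
    have hw := abs_le.1 (hX.abs_conv_le s hs' z)
    have hw' := abs_le.1 (hX'.abs_conv_le s hs' z)
    set w := ∫ ζ, γ (X s z - X s ζ) * q₀ ζ
    set w' := ∫ ζ, γ (X' s z - X' s ζ) * q₀' ζ
    have h1 : |V w - V' w'| ≤ LV * |w - w'| + ω := by
      calc |V w - V' w'| = |(V w - V w') + (V w' - V' w')| := by ring_nf
        _ ≤ _ := (abs_add_le _ _).trans (add_le_add (hVL.dist_le_mul _ hw _ hw') (hω _ hw'))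
    have h2 := hγ.abs_integral_sub_integral_le (hX.expandsWith s hs') (hX'.expandsWith s hs')
      (hX.continuous s) (hX'.continuous s) (hX.abs_sub_le s hs') (hX'.abs_sub_le s hs') hq hq'
      hN hN' (by positivity) (hclose s hs') hr hτ hρ hz
    have h3 := hXX s hs'
    rw [heq] at h3
    have he : 1 ≤ Real.exp (Λ * s) := Real.one_le_exp (mul_nonneg hΛ0 hs.1)
    set e := Real.exp (Λ * s)
    have h4 := mul_le_mul_of_nonneg_left h2 LV.2
    have h5 := mul_le_mul_of_nonneg_left h3 hk0
    have e1 : k * M * (d / (2 * M)) = k * d / 2 := by field_simp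
    -- The three copies of `k * M` in `Λ` have distinct roles: one absorbs the error at the point
    -- itself, two absorb the a priori error `d * e` of the other characteristics. The remaining `p
    -- * e ≥ σ` absorbs the data errors and makes the inequality at contact strict.
    have h6 : p * (e * Λ) = k * (M * (p * e)) + k * d * e + 2 * (k * M) * σ * e + p * e := by
      rw [hΛ, hp]
      linear_combination (2 * e) * e1
    have h7 : σ ≤ p * e := by
      have : σ ≤ p := by
        have : 0 ≤ d / (2 * M) := by positivity
        linarith
      exact this.trans (le_mul_of_one_le_right hp0 he)
    have h8 : 0 ≤ 2 * (k * M) * σ * e := by positivity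
    rw [h6]
    have e2 : LV * (N * (c * κ * (|X s z - X' s z| + (d * e + η))) + G * ρ + 2 * N * c * τ) =
        k * |X s z - X' s z| + k * (d * e) + k * η + LV * (G * ρ + 2 * N * c * τ) := by
      rw [hk]; ring
    have e3 : k * (M * (p * e) + M * α) = k * (M * (p * e)) + k * (M * α) := by ring
    have e4 : k * (M * α + η) = k * (M * α) + k * η := by ring
    have e5 : k * (d * e) = k * d * e := by ring
    have h9 : LV * |w - w'| ≤
      LV * (N * (c * κ * (|X s z - X' s z| + (d * e + η))) + G * ρ + 2 * N * c * τ) := h4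
    linarith

end Stability

section Stability

variable {ι : Type*} {l : Filter ι} {M LV : NNReal} {S c D b G κ N : ℝ}
  {γ q₀ V A B : ℝ → ℝ} {X : ℝ → ℝ → ℝ} {q₀' V' A' : ι → ℝ → ℝ} {X' : ι → ℝ → ℝ → ℝ}

/-- Characteristic flows are stable, locally uniformly, under convergence of the data. -/
theorem IsCharFlow.eventually_abs_sub_le (hX : IsCharFlow S c D b γ q₀ V A X)
    (hX' : ∀ᶠ i in l, IsCharFlow S c D b γ (q₀' i) (V' i) (A' i) (X' i)) (hγ : IsBVKernel γ G κ)
    (hM : 0 < M) (hB : LipschitzWith M B) (hBA : ∀ x, B (A x) = x) (hS : 0 ≤ S)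
    (hq : Measurable q₀) (hN : ∀ z, |q₀ z| ≤ N)
    (hq' : ∀ᶠ i in l, Measurable (q₀' i) ∧ ∀ z, |q₀' i z| ≤ N)
    (hVL : LipschitzOnWith LV V (Icc (-b) b))
    (hV : ∀ ω > 0, ∀ᶠ i in l, ∀ x ∈ Icc (-b) b, |V x - V' i x| ≤ ω)
    (hA : ∀ R, ∀ α > 0, ∀ᶠ i in l, ∀ x, |x| ≤ R → |A x - A' i x| ≤ α)
    (hq0 : ∀ R, Tendsto (fun i => ∫ x in Icc (-R) R, |q₀ x - q₀' i x|) l (𝓝 0)) :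
    ∀ R, ∀ η > 0, ∀ᶠ i in l, ∀ t ∈ Icc 0 S, ∀ z, |z| ≤ R → |X t z - X' i t z| ≤ η := by
  have hN0 : 0 ≤ N := (abs_nonneg _).trans (hN 0)
  have hG0 : 0 ≤ G := (abs_nonneg _).trans (hγ.bound 0)
  have hκ := hγ.nonneg
  have hc0 : 0 ≤ c := (hX.expandsWith 0 ⟨le_rfl, hS⟩).1
  have hD0 : 0 ≤ D := (abs_nonneg _).trans (hX.abs_sub_le 0 ⟨le_rfl, hS⟩ 0)
  obtain ⟨k, hk⟩ : ∃ k : ℝ, k = LV * (N * (c * κ)) := ⟨_, rfl⟩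
  obtain ⟨Λ, hΛ⟩ : ∃ Λ : ℝ, Λ = 3 * (k * M) + 1 := ⟨_, rfl⟩
  have hk0 : 0 ≤ k := by rw [hk]; positivity
  have hΛ0 : 0 ≤ Λ := by rw [hΛ]; positivity
  have hM' : (0 : ℝ) < M := hM
  -- The radius and `η` stay universally quantified: stage `n + 1` on radius `R` uses stage `n` on
  -- the larger radius `r + R + 2 * D`, where `r` cuts off the tail of `γ`. Stage 0 is the
  -- displacement bound.
  have claim : ∀ n : ℕ, ∀ R, ∀ η > 0, ∀ᶠ i in l, ∀ t ∈ Icc 0 S, ∀ z, |z| ≤ R →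
      |X t z - X' i t z| ≤ 2 * D / 2 ^ n * Real.exp (Λ * t) + η := by
    intro n
    induction n with
    | zero =>
      intro R η hη
      filter_upwards [hX'] with i hi t ht z _
      have h1 := hX.abs_sub_le t ht z
      have h2 := hi.abs_sub_le t ht z
      have h3 : 1 ≤ Real.exp (Λ * t) := Real.one_le_exp (mul_nonneg hΛ0 ht.1)
      have h4 : |X t z - X' i t z| ≤ 2 * D := by
        calc |X t z - X' i t z| = |(X t z - z) - (X' i t z - z)| := by ring_nf
          _ ≤ _ := (abs_sub _ _).trans (by linarith)
      rw [pow_zero, div_one]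
      have h5 := le_mul_of_one_le_right (by positivity : 0 ≤ 2 * D) h3
      linarith
    | succ n ih =>
      intro R η hη
      -- Makes the additive error `2 * M * σ * exp (Λ * S)` equal to `η`.
      set σ : ℝ := η / (2 * M * Real.exp (Λ * S)) with hσ
      have hσ0 : 0 < σ := by positivity
      -- Sum of the coefficients of all small parameters when each equals `ε`; then `ε * Q < ε * (Q
      -- + 1) = σ`.
      set Q : ℝ := k * M + k + LV * (G + 2 * N * c) + 1 with hQ
      have hQ0 : 1 ≤ Q := by
        have : 0 ≤ k * M + k + LV * (G + 2 * N * c) := by positivity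
        linarith
      set ε : ℝ := σ / (Q + 1) with hε
      have hε0 : 0 < ε := by positivity
      have hεσ : ε * (Q + 1) = σ := by rw [hε]; field_simp
      obtain ⟨r, hr⟩ := hγ.integrable.exists_setIntegral_tail_le hε0
      have hρ := (hq0 (r + R + 2 * D)).eventually (ge_mem_nhds hε0)
      filter_upwards [hX', hq', hV ε hε0, hA (R + D) ε hε0, hρ, ih (r + R + 2 * D) ε hε0]
        with i hXi hqi hVi hAi hρi hci
      have := hX.abs_sub_le_half hXi hγ hM hB hBA hS hq hqi.1 hN hqi.2 hVL hVi hAi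
        (R' := r + R + 2 * D) (by ring) hr hρi (by positivity) hε0.le hk hΛ hci (σ := σ)
        (by rw [← hεσ, hQ]; linarith) (by nlinarith)
      intro t ht z hz
      refine (this t ht z hz).trans_eq ?_
      have e : 2 * M * σ * Real.exp (Λ * S) = η := by rw [hσ]; field_simp
      rw [e, pow_succ]
      ring
  intro R η hη
  obtain ⟨n, hn⟩ : ∃ n : ℕ, 2 * D / 2 ^ n * Real.exp (Λ * S) ≤ η / 2 := by
    have h1 : Tendsto (fun n : ℕ => 2 * D * (1 / 2 : ℝ) ^ n * Real.exp (Λ * S)) atTop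
        (𝓝 (2 * D * 0 * Real.exp (Λ * S))) :=
      ((tendsto_pow_atTop_nhds_zero_of_lt_one (by norm_num) (by norm_num)).const_mul _).mul_const _
    rw [mul_zero, zero_mul] at h1
    obtain ⟨n, hn⟩ := (h1.eventually (ge_mem_nhds (half_pos hη))).exists
    refine ⟨n, le_trans (le_of_eq ?_) hn⟩
    rw [one_div, inv_pow, div_eq_mul_inv]
  filter_upwards [claim n R (η / 2) (half_pos hη)] with i hi t ht z hz
  refine (hi t ht z hz).trans ?_
  have h2 : Real.exp (Λ * t) ≤ Real.exp (Λ * S) :=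
    Real.exp_le_exp.2 (mul_le_mul_of_nonneg_left ht.2 hΛ0)
  have h3 := mul_le_mul_of_nonneg_left h2 (by positivity : 0 ≤ 2 * D / 2 ^ n)
  linarith

/-- Weak stability of the densities transported by characteristic flows. -/
theorem IsCharFlow.eventually_abs_integral_sub_le (hX : IsCharFlow S c D b γ q₀ V A X)
    (hX' : ∀ᶠ i in l, IsCharFlow S c D b γ (q₀' i) (V' i) (A' i) (X' i)) (hγ : IsBVKernel γ G κ)
    (hM : 0 < M) (hB : LipschitzWith M B) (hBA : ∀ x, B (A x) = x) (hS : 0 ≤ S)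
    (hq : Measurable q₀) (hN : ∀ z, |q₀ z| ≤ N)
    (hq' : ∀ᶠ i in l, Measurable (q₀' i) ∧ ∀ z, |q₀' i z| ≤ N)
    (hVL : LipschitzOnWith LV V (Icc (-b) b))
    (hV : ∀ ω > 0, ∀ᶠ i in l, ∀ x ∈ Icc (-b) b, |V x - V' i x| ≤ ω)
    (hA : ∀ R, ∀ α > 0, ∀ᶠ i in l, ∀ x, |x| ≤ R → |A x - A' i x| ≤ α)
    (hq0 : ∀ R, Tendsto (fun i => ∫ x in Icc (-R) R, |q₀ x - q₀' i x|) l (𝓝 0))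
    {g : ℝ → ℝ} (hg : Continuous g) (hgc : HasCompactSupport g) :
    ∀ η > 0, ∀ᶠ i in l, ∀ t ∈ Icc 0 S,
      |(∫ z, q₀ z * g (X t z)) - ∫ z, q₀' i z * g (X' i t z)| ≤ η := by
  intro η hη
  have hN0 : 0 ≤ N := (abs_nonneg _).trans (hN 0)
  have hD0 : 0 ≤ D := (abs_nonneg _).trans (hX.abs_sub_le 0 ⟨le_rfl, hS⟩ 0)
  obtain ⟨R₀, hR₀⟩ := hgc.isCompact.isBounded.exists_norm_le
  obtain ⟨W, hW⟩ := hg.bounded_above_of_compact_support hgc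
  have hW0 : 0 ≤ W := (norm_nonneg _).trans (hW 0)
  have hunif := hgc.uniformContinuous_of_continuous hg
  set R := max R₀ 0 + D with hR
  have hR0 : 0 ≤ R := by positivity
  set ε := η / (2 * (N + W) * (R + 1) + 1) with hε
  have hε0 : 0 < ε := by positivity
  have hεη : ε * (2 * (N + W) * (R + 1) + 1) = η := by rw [hε]; field_simp
  obtain ⟨δ, hδ, hgδ⟩ := Metric.uniformContinuous_iff.1 hunif ε hε0
  filter_upwards [hX', hq', hX.eventually_abs_sub_le hX' hγ hM hB hBA hS hq hN hq' hVL hV hA hq0 R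
    (δ / 2) (half_pos hδ), (hq0 R).eventually (ge_mem_nhds hε0)] with i hXi hqi hci hρi t ht
  -- Displacements of at most `D` confine both integrals to one fixed interval of labels.
  have hsupp : ∀ {Y : ℝ → ℝ}, (∀ z, |Y z - z| ≤ D) → ∀ z, z ∉ Icc (-R) R → g (Y z) = 0 := by
    intro Y hY z hz
    refine image_eq_zero_of_notMem_tsupport fun h => hz (abs_le.1 ?_)
    have h1 := hR₀ _ h
    rw [Real.norm_eq_abs] at h1
    calc |z| = |Y z - (Y z - z)| := by ring_nf
      _ ≤ _ := (abs_sub _ _).trans (add_le_add (h1.trans (le_max_left _ _)) (hY z))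
  have hvol : volume (Icc (-R) R) ≠ ⊤ := by simp
  have hint : ∀ {f Y : ℝ → ℝ}, Measurable f → (∀ z, |f z| ≤ N) → Continuous Y →
      (∀ z, |Y z - z| ≤ D) → IntegrableOn (fun z => f z * g (Y z)) (Icc (-R) R) ∧
        ∫ z, f z * g (Y z) = ∫ z in Icc (-R) R, f z * g (Y z) := by
    intro f Y hf hfN hYc hYD
    refine ⟨Measure.integrableOn_of_bounded (M := N * W) hvol
      (hf.mul (hg.comp hYc).measurable).aestronglyMeasurable (ae_of_all _ fun z => ?_),
      (setIntegral_eq_integral_of_forall_compl_eq_zero fun z hz => ?_).symm⟩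
    · rw [norm_mul]
      exact mul_le_mul (hfN z) (hW _) (norm_nonneg _) hN0
    · rw [hsupp hYD z hz, mul_zero]
  obtain ⟨a1, a2⟩ := hint hq hN (hX.continuous t) (hX.abs_sub_le t ht)
  obtain ⟨b1, b2⟩ := hint hqi.1 hqi.2 (hXi.continuous t) (hXi.abs_sub_le t ht)
  have hdi : IntegrableOn (fun z => |q₀ z - q₀' i z|) (Icc (-R) R) := by
    refine Measure.integrableOn_of_bounded (M := 2 * N) hvol
      (hq.sub hqi.1).abs.aestronglyMeasurable (ae_of_all _ fun z => ?_)
    rw [Real.norm_eq_abs, abs_abs]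
    refine (abs_sub (q₀ z) (q₀' i z)).trans ?_
    linarith [hN z, hqi.2 z]
  have hci' : IntegrableOn (fun _ : ℝ => N * ε) (Icc (-R) R) := integrableOn_const hvol
  rw [a2, b2, ← integral_sub a1 b1]
  refine abs_integral_le_integral_abs.trans ?_
  refine (setIntegral_mono_on (a1.sub b1).abs (hci'.add (hdi.const_mul W)) measurableSet_Icc
    fun z hz => ?_).trans ?_
  · have h1 : |g (X t z) - g (X' i t z)| ≤ ε :=
      (hgδ (lt_of_le_of_lt (hci t ht z (abs_le.2 hz)) (half_lt_self hδ))).le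
    calc |q₀ z * g (X t z) - q₀' i z * g (X' i t z)|
        = |q₀ z * (g (X t z) - g (X' i t z)) + g (X' i t z) * (q₀ z - q₀' i z)| := by ring_nf
      _ ≤ |q₀ z| * |g (X t z) - g (X' i t z)| + |g (X' i t z)| * |q₀ z - q₀' i z| := by
        rw [← abs_mul, ← abs_mul]; exact abs_add_le _ _
      _ ≤ N * ε + W * |q₀ z - q₀' i z| :=
        add_le_add (mul_le_mul (hN z) h1 (abs_nonneg _) hN0)
          (mul_le_mul_of_nonneg_right (hW _) (abs_nonneg _))
  · rw [integral_add' hci' (hdi.const_mul W), integral_const_mul W, setIntegral_const, Measure.real,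
      Real.volume_Icc, ENNReal.toReal_ofReal (by linarith), smul_eq_mul]
    have h1 := mul_le_mul_of_nonneg_left hρi hW0
    have h2 : 0 ≤ N * ε := by positivity
    have h3 : 0 ≤ W * ε := by positivity
    have h4 : 0 ≤ W * ε * R := by positivity
    rw [← hεη]
    linarith

end Stability

/-! ### The standard mollifier -/

/-- Gives smoothness of the bump across `|x| = 1`. -/
theorem stdBump_eq_expNegInvGlue (x : ℝ) : stdBump x = expNegInvGlue (1 - x ^ 2) := by
  have h : |x| < 1 ↔ 0 < 1 - x ^ 2 := by rw [sub_pos, ← sq_lt_one_iff_abs_lt_one]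
  by_cases hx : |x| < 1
  · rw [stdBump, if_pos hx, expNegInvGlue, if_neg (not_le.2 (h.1 hx)), one_div]
  · rw [stdBump, if_neg hx, expNegInvGlue, if_pos (not_lt.1 fun h' => hx (h.2 h'))]

theorem contDiff_stdBump : ContDiff ℝ (⊤ : ℕ∞) stdBump := by
  rw [show stdBump = fun x => expNegInvGlue (1 - x ^ 2) from funext stdBump_eq_expNegInvGlue]
  exact expNegInvGlue.contDiff.comp (by fun_prop)

theorem stdBump_nonneg (x : ℝ) : 0 ≤ stdBump x := by
  rw [stdBump_eq_expNegInvGlue]; exact expNegInvGlue.nonneg _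

theorem stdBump_le_one (x : ℝ) : stdBump x ≤ 1 := by
  rw [stdBump]
  split_ifs with h
  · refine Real.exp_le_one_iff.2 ?_
    have : 0 < 1 - x ^ 2 := by rw [sub_pos]; exact (sq_lt_one_iff_abs_lt_one x).2 h
    rw [neg_nonpos]; positivity
  · exact zero_le_one

theorem stdBump_eq_zero {x : ℝ} (h : 1 ≤ |x|) : stdBump x = 0 := if_neg (not_lt.2 h)

theorem hasCompactSupport_stdBump : HasCompactSupport stdBump :=
  HasCompactSupport.of_support_subset_isCompact (isCompact_Icc (a := -1) (b := 1)) fun _ hx =>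
    abs_le.1 (not_lt.1 fun h => hx (stdBump_eq_zero h.le))

theorem integral_stdBump_pos : 0 < ∫ y, stdBump y := by
  refine contDiff_stdBump.continuous.integral_pos_of_hasCompactSupport_nonneg_nonzero
    hasCompactSupport_stdBump stdBump_nonneg (x := 0) ?_
  rw [stdBump, if_pos (by simp)]
  exact (Real.exp_pos _).ne'

section Mollifier

variable {ε : ℝ}

theorem contDiff_stdMollifier (ε : ℝ) : ContDiff ℝ (⊤ : ℕ∞) (stdMollifier ε) := by
  have := contDiff_stdBump.comp (contDiff_id.div_const (n := (⊤ : ℕ∞)) (𝕜 := ℝ) ε)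
  exact contDiff_const.mul (this.div_const _)

theorem stdMollifier_nonneg (hε : 0 < ε) (x : ℝ) : 0 ≤ stdMollifier ε x :=
  mul_nonneg (inv_nonneg.2 hε.le) (div_nonneg (stdBump_nonneg _) integral_stdBump_pos.le)

theorem stdMollifier_eq_zero (hε : 0 < ε) {x : ℝ} (h : ε ≤ |x|) : stdMollifier ε x = 0 := by
  rw [stdMollifier, stdBump_eq_zero, zero_div, mul_zero]
  rwa [abs_div, abs_of_pos hε, one_le_div hε]

theorem stdMollifier_le (hε : 0 < ε) (x : ℝ) :
    stdMollifier ε x ≤ ε⁻¹ * (1 / ∫ y, stdBump y) := by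
  have := integral_stdBump_pos
  have h1 := stdBump_le_one (x / ε)
  rw [stdMollifier]
  gcongr

theorem hasCompactSupport_stdMollifier (hε : 0 < ε) : HasCompactSupport (stdMollifier ε) :=
  HasCompactSupport.of_support_subset_isCompact (isCompact_Icc (a := -ε) (b := ε)) fun _ hx =>
    abs_le.1 (not_lt.1 fun h => hx (stdMollifier_eq_zero hε h.le))

theorem integral_stdMollifier (hε : 0 < ε) : ∫ x, stdMollifier ε x = 1 := by
  simp only [stdMollifier]
  rw [integral_const_mul, Measure.integral_comp_div (fun y => stdBump y / ∫ y, stdBump y),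
    integral_div, div_self integral_stdBump_pos.ne', abs_of_pos hε, smul_eq_mul, mul_one,
    inv_mul_cancel₀ hε.ne']

theorem integrable_stdMollifier (hε : 0 < ε) : Integrable (stdMollifier ε) :=
  (contDiff_stdMollifier ε).continuous.integrable_of_hasCompactSupport
    (hasCompactSupport_stdMollifier hε)

theorem mollify_eq_integral (ε : ℝ) (f : ℝ → ℝ) (x : ℝ) :
    mollify ε f x = ∫ ξ, stdMollifier ε (x - ξ) * f ξ := realConv_eq_integral_sub _ _ _

theorem mollify_congr_ae {f f' : ℝ → ℝ} (h : f =ᵐ[volume] f') (ε : ℝ) :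
    mollify ε f = mollify ε f' := realConv_congr_ae (ae_eq_refl _) h

/-- A mollification deviates from a constant no more than the function does nearby. -/
theorem abs_mollify_sub_le (hε : 0 < ε) {f : ℝ → ℝ} (hf : AEStronglyMeasurable f) {x c δ : ℝ}
    (h : ∀ᵐ ξ, |ξ - x| < ε → |f ξ - c| ≤ δ) : |mollify ε f x - c| ≤ δ := by
  have hi : Integrable fun ξ => stdMollifier ε (x - ξ) :=
    (integrable_stdMollifier hε).comp_sub_left x
  have h1 : ∫ ξ, stdMollifier ε (x - ξ) = 1 := by
    rw [integral_sub_left_eq_self (stdMollifier ε), integral_stdMollifier hε]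
  have hb : ∀ᵐ ξ, ‖stdMollifier ε (x - ξ) * (f ξ - c)‖ ≤ stdMollifier ε (x - ξ) * δ := by
    filter_upwards [h] with ξ hξ
    rw [Real.norm_eq_abs, abs_mul, abs_of_nonneg (stdMollifier_nonneg hε _)]
    by_cases hx : |ξ - x| < ε
    · exact mul_le_mul_of_nonneg_left (hξ hx) (stdMollifier_nonneg hε _)
    · rw [stdMollifier_eq_zero hε (by rw [abs_sub_comm]; exact not_lt.1 hx)]; simp
  have hg : Integrable fun ξ => stdMollifier ε (x - ξ) * (f ξ - c) :=
    (hi.mul_const δ).mono' (hi.aestronglyMeasurable.mul (hf.sub aestronglyMeasurable_const)) hb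
  have e : mollify ε f x - c = ∫ ξ, stdMollifier ε (x - ξ) * (f ξ - c) := by
    have e1 : ∀ ξ, stdMollifier ε (x - ξ) * f ξ =
        stdMollifier ε (x - ξ) * (f ξ - c) + stdMollifier ε (x - ξ) * c := fun ξ => by ring
    rw [mollify_eq_integral]
    simp_rw [e1]
    rw [integral_add hg (hi.mul_const c), integral_mul_const, h1, one_mul, add_sub_cancel_right]
  rw [e, ← Real.norm_eq_abs]
  refine (norm_integral_le_of_norm_le (hi.mul_const δ) hb).trans_eq ?_
  rw [integral_mul_const, h1, one_mul]

theorem mollify_mem_Icc (hε : 0 < ε) {f : ℝ → ℝ} (hf : AEStronglyMeasurable f) {m M : ℝ}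
    (h : ∀ x, f x ∈ Icc m M) (x : ℝ) : mollify ε f x ∈ Icc m M := by
  have := abs_le.1 (abs_mollify_sub_le hε hf (x := x) (c := (m + M) / 2) (δ := (M - m) / 2)
    (ae_of_all _ fun ξ _ => abs_le.2 ⟨by linarith [(h ξ).1], by linarith [(h ξ).2]⟩))
  exact ⟨by linarith, by linarith⟩

theorem continuous_mollify (hε : 0 < ε) {f : ℝ → ℝ} (hf : LocallyIntegrable f) :
    Continuous (mollify ε f) :=
  (hasCompactSupport_stdMollifier hε).continuous_convolution_left _
    (contDiff_stdMollifier ε).continuous hf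

/-- The difference is the mollification at `x` of `f` minus its translate by `y - x`, so only values
within `ε` of the two points matter. -/
theorem abs_mollify_sub_mollify_le (hε : 0 < ε) {f : ℝ → ℝ} (hf : Continuous f) {x y δ : ℝ}
    (h : ∀ s, |s| < ε → |f (x + s) - f (y + s)| ≤ δ) : |mollify ε f x - mollify ε f y| ≤ δ := by
  have hi : ∀ z, Integrable fun ξ => stdMollifier ε (z - ξ) * f ξ := fun z => by
    refine Continuous.integrable_of_hasCompactSupport
      (((contDiff_stdMollifier ε).continuous.comp (by fun_prop)).mul hf) ?_
    refine HasCompactSupport.mul_right ?_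
    exact (hasCompactSupport_stdMollifier hε).comp_homeomorph (Homeomorph.subLeft z)
  have e : mollify ε f x - mollify ε f y =
      mollify ε (fun ξ => f ξ - f (ξ + (y - x))) x - 0 := by
    have h1 : ∫ ξ, stdMollifier ε (x - ξ) * f (ξ + (y - x)) = mollify ε f y := by
      rw [mollify_eq_integral,
        ← integral_add_right_eq_self (fun ξ => stdMollifier ε (y - ξ) * f ξ) (y - x)]
      congr 1; ext ξ; ring_nf
    have h2 : Integrable fun ξ => stdMollifier ε (x - ξ) * f (ξ + (y - x)) := by
      have := (hi y).comp_add_right (y - x)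
      refine this.congr (ae_of_all _ fun ξ => ?_)
      simp only; ring_nf
    rw [sub_zero, mollify_eq_integral ε (fun ξ => f ξ - f (ξ + (y - x)))]
    simp_rw [mul_sub]
    rw [integral_sub (hi x) h2, h1, mollify_eq_integral]
  rw [e]
  refine abs_mollify_sub_le hε (by fun_prop : Continuous _).aestronglyMeasurable
    (ae_of_all _ fun ξ hξ => ?_)
  have := h (ξ - x) hξ
  rw [sub_zero]
  convert this using 3 <;> ring_nf

theorem lipschitzOnWith_mollify (hε : 0 < ε) {f : ℝ → ℝ} (hf : Continuous f) {L : NNReal}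
    {b b' : ℝ} (hb : b + ε ≤ b') (hL : LipschitzOnWith L f (Icc (-b') b')) :
    LipschitzOnWith L (mollify ε f) (Icc (-b) b) := by
  refine LipschitzOnWith.of_dist_le_mul fun x hx y hy => ?_
  rw [Real.dist_eq]
  refine abs_mollify_sub_mollify_le hε hf fun s hs => ?_
  have hs' := abs_lt.1 hs
  have := hL.dist_le_mul (x + s) ⟨by linarith [hx.1], by linarith [hx.2]⟩ (y + s)
    ⟨by linarith [hy.1], by linarith [hy.2]⟩
  rwa [Real.dist_eq, dist_add_right] at this

theorem abs_sub_mollify_le (hε : 0 < ε) {f : ℝ → ℝ} (hf : Continuous f) {L : NNReal}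
    {b b' : ℝ} (hb : b + ε ≤ b') (hL : LipschitzOnWith L f (Icc (-b') b')) {x : ℝ}
    (hx : x ∈ Icc (-b) b) : |f x - mollify ε f x| ≤ L * ε := by
  rw [abs_sub_comm]
  refine abs_mollify_sub_le hε hf.aestronglyMeasurable (ae_of_all _ fun ξ hξ => ?_)
  have hs' := abs_lt.1 hξ
  have := hL.dist_le_mul ξ ⟨by linarith [hx.1], by linarith [hx.2]⟩ x
    ⟨by linarith [hx.1], by linarith [hx.2]⟩
  rw [Real.dist_eq, Real.dist_eq] at this
  exact this.trans (mul_le_mul_of_nonneg_left hξ.le L.2)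

/-- Convergence at Lebesgue points: the kernel is supported in a ball of volume `2 * ε` and bounded
by a constant over that volume. -/
theorem ae_tendsto_mollify {f : ℝ → ℝ} (hf : LocallyIntegrable f) :
    ∀ᵐ x, Tendsto (fun ε => mollify ε f x) (𝓝[>] 0) (𝓝 (f x)) := by
  filter_upwards [(Besicovitch.vitaliFamily (volume : Measure ℝ)).ae_tendsto_average_norm_sub hf]
    with x hx
  have h1 := hx.comp (Besicovitch.tendsto_filterAt volume x)
  have h2 := tendsto_integral_smul_of_tendsto_average_norm_sub (l := 𝓝[>] (0 : ℝ))
    (a := fun ε => Metric.closedBall x ε) (f := f) (c := f x)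
    (g := fun ε ξ => stdMollifier ε (x - ξ)) (2 * (1 / ∫ y, stdBump y)) h1
    (Eventually.of_forall fun ε => hf.integrableOn_isCompact (isCompact_closedBall x ε))
    (tendsto_const_nhds.congr' (by
      filter_upwards [self_mem_nhdsWithin] with ε hε
      rw [integral_sub_left_eq_self (stdMollifier ε), integral_stdMollifier hε]))
    (by
      filter_upwards [self_mem_nhdsWithin] with ε hε ξ hξ
      rw [Metric.mem_closedBall, dist_comm, Real.dist_eq]
      exact not_lt.1 fun h => hξ (stdMollifier_eq_zero hε h.le))
    (by
      filter_upwards [self_mem_nhdsWithin] with ε hε ξ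
      have hε' : (0 : ℝ) < ε := hε
      rw [abs_of_nonneg (stdMollifier_nonneg hε _), Measure.real, Real.volume_closedBall,
        ENNReal.toReal_ofReal (by positivity)]
      refine (stdMollifier_le hε _).trans_eq ?_
      have := integral_stdBump_pos.ne'
      field_simp)
  refine h2.congr fun ε => ?_
  rw [mollify_eq_integral]; rfl

theorem tendsto_setIntegral_abs_sub_mollify {f : ℝ → ℝ} {N : ℝ} (hf : Measurable f)
    (hN : ∀ x, |f x| ≤ N) (R : ℝ) :
    Tendsto (fun ε => ∫ x in Icc (-R) R, |f x - mollify ε f x|) (𝓝[>] 0) (𝓝 0) := by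
  have hl : LocallyIntegrable f := locallyIntegrable_of_bdd hf hN
  have h := tendsto_integral_filter_of_dominated_convergence (μ := volume.restrict (Icc (-R) R))
    (l := 𝓝[>] (0 : ℝ)) (F := fun ε x => |f x - mollify ε f x|) (f := fun _ => (0 : ℝ))
    (fun _ => 2 * N) (by
      filter_upwards [self_mem_nhdsWithin] with ε hε
      exact (hf.sub (continuous_mollify hε hl).measurable).abs.aestronglyMeasurable)
    (by
      filter_upwards [self_mem_nhdsWithin] with ε hε
      refine ae_of_all _ fun x => ?_
      rw [Real.norm_eq_abs, abs_abs]
      refine (abs_sub _ _).trans ?_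
      have := abs_le.2 (mollify_mem_Icc hε hf.aestronglyMeasurable (fun x => abs_le.1 (hN x)) x)
      linarith [hN x])
    (integrableOn_const (by simp))
    (by
      filter_upwards [ae_restrict_of_ae (ae_tendsto_mollify hl)] with x hx
      simpa using (hx.const_sub (f x)).abs)
  simpa using h

end Mollifier

-- Local Lipschitz bounds and stability for regular data

theorem MemLinftyLoc.aestronglyMeasurable {W : ℝ → ℝ} (hW : MemLinftyLoc W) :
    AEStronglyMeasurable W := by
  have h : (⋃ n : ℕ, Icc (-(n : ℝ)) n) = univ := by
    refine eq_univ_of_forall fun x => mem_iUnion.2 ?_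
    obtain ⟨n, hn⟩ := exists_nat_ge |x|
    exact ⟨n, abs_le.1 hn⟩
  have := aestronglyMeasurable_iUnion_iff.2 fun n : ℕ => (hW n).aestronglyMeasurable
  rwa [h, Measure.restrict_univ] at this

/-- Testing the weak derivative against `stdMollifier ε (x - ·)` shows that `mollify ε V` has
derivative `mollify ε W`. This is bounded on `[-b, b]` uniformly in `ε ≤ 1`, whence the margin 1,
and the Lipschitz bound passes to the limit by continuity of `V`. -/
theorem MemW1InftyLoc.exists_lipschitzOnWith {V : ℝ → ℝ} (hV : MemW1InftyLoc V) (b : ℝ) :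
    ∃ L : NNReal, LipschitzOnWith L V (Icc (-b) b) := by
  obtain ⟨W, hW, hVW⟩ := hV.weakDeriv
  obtain ⟨w, hw⟩ : ∃ w : NNReal, ∀ᵐ ξ, ξ ∈ Icc (-(b + 1)) (b + 1) → |W ξ| ≤ w := by
    have h1 := hW (b + 1)
    refine ⟨(eLpNorm W ⊤ (volume.restrict (Icc (-(b + 1)) (b + 1)))).toNNReal, ?_⟩
    rw [← ae_restrict_iff' measurableSet_Icc]
    have h2 := ae_le_eLpNormEssSup (f := W) (μ := volume.restrict (Icc (-(b + 1)) (b + 1)))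
    filter_upwards [h2] with ξ hξ
    rw [← eLpNorm_exponent_top] at hξ
    have := ENNReal.toReal_mono h1.2.ne hξ
    rwa [toReal_enorm, Real.norm_eq_abs] at this
  have hd : ∀ ε > 0, ∀ x, HasDerivAt (mollify ε V) (mollify ε W x) x := by
    intro ε hε x
    have h1 := (hasCompactSupport_stdMollifier hε).hasDerivAt_convolution_left
      (ContinuousLinearMap.mul ℝ ℝ) ((contDiff_stdMollifier ε).of_le (by simp))
      (hV.continuous.locallyIntegrable (μ := volume)) x
    have h2 : realConv (deriv (stdMollifier ε)) V x = mollify ε W x := by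
      have hφ : ContDiff ℝ (⊤ : ℕ∞) fun ξ => stdMollifier ε (x - ξ) :=
        (contDiff_stdMollifier ε).comp (contDiff_const.sub contDiff_id)
      have h3 := hVW _ hφ
        ((hasCompactSupport_stdMollifier hε).comp_homeomorph (Homeomorph.subLeft x))
      rw [realConv_eq_integral_sub, mollify_eq_integral]
      simp_rw [deriv_comp_const_sub, mul_neg, integral_neg, neg_inj] at h3
      simp_rw [mul_comm (deriv _ _), mul_comm (stdMollifier _ _)]
      exact h3
    rw [← h2]
    exact h1
  refine ⟨w, LipschitzOnWith.of_dist_le_mul fun x hx y hy => ?_⟩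
  have hlip : ∀ ε ∈ Ioc (0 : ℝ) 1, |mollify ε V x - mollify ε V y| ≤ w * |x - y| := by
    intro ε hε
    refine Convex.norm_image_sub_le_of_norm_hasDerivWithin_le (f := mollify ε V) (C := w)
      (f' := mollify ε W) (s := Icc (-b) b) (fun z _ => (hd ε hε.1 z).hasDerivWithinAt)
      (fun z hz => ?_) (convex_Icc _ _) hy hx
    have h1 := abs_mollify_sub_le hε.1 hW.aestronglyMeasurable (x := z) (c := 0) (δ := w) (by
      filter_upwards [hw] with ξ hξ hξz
      rw [sub_zero]
      have h1 := abs_lt.1 hξz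
      exact hξ ⟨by linarith [hz.1, hε.2], by linarith [hz.2, hε.2]⟩)
    rwa [sub_zero] at h1
  have hlim : ∀ z, Tendsto (fun ε => mollify ε V z) (𝓝[>] 0) (𝓝 (V z)) := by
    intro z
    refine Metric.tendsto_nhds.2 fun η hη => ?_
    obtain ⟨δ, hδ, hVδ⟩ := Metric.continuous_iff.1 hV.continuous z (η / 2) (half_pos hη)
    filter_upwards [Ioo_mem_nhdsGT hδ] with ε hε
    have := abs_mollify_sub_le hε.1 hV.continuous.aestronglyMeasurable (x := z) (c := V z)
      (δ := η / 2) (ae_of_all _ fun ξ hξ => (hVδ ξ (hξ.trans hε.2)).le)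
    rw [Real.dist_eq]
    linarith
  rw [Real.dist_eq, Real.dist_eq]
  refine le_of_tendsto ((hlim x).sub (hlim y)).abs ?_
  filter_upwards [Ioc_mem_nhdsGT (zero_lt_one' ℝ)] with ε hε using hlip ε hε

theorem LinftyBound.mono {S Q Q' : ℝ} {q : ℝ → ℝ → ℝ} (h : LinftyBound S Q q) (hQ : Q ≤ Q') :
    LinftyBound S Q' q := by
  filter_upwards [h] with t ht
  filter_upwards [ht] with x hx using hx.trans hQ

theorem IsWeakSolution.congr {S : ℝ} {γ γ' q₀ q₀' v v' V : ℝ → ℝ} {q : ℝ → ℝ → ℝ}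
    (h : IsWeakSolution S γ q₀ v V q) (hγ : γ =ᵐ[volume] γ') (hq : q₀ =ᵐ[volume] q₀')
    (hv : v =ᵐ[volume] v') : IsWeakSolution S γ' q₀' v' V q := by
  refine ⟨h.memCL1Loc, h.aestronglyMeasurable, h.bounded, fun φ hφ hφc hφs => ?_⟩
  refine Eq.trans (congrArg₂ (· + ·) (integral_congr_ae ?_) (integral_congr_ae ?_))
    (h.weak φ hφ hφc hφs)
  · have hv2 : ∀ᵐ p : ℝ × ℝ, v p.2 = v' p.2 := by
      rw [Measure.volume_eq_prod]
      exact Measure.quasiMeasurePreserving_snd.ae hv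
    filter_upwards [ae_restrict_of_ae hv2] with p hp
    rw [hp, realConv_congr_ae hγ (ae_eq_refl (q p.1))]
  · filter_upwards [hq] with x hx
    rw [hx]

/-- A family of pointwise bounds on the data of the conservation law. -/
structure IsRegularData (a M : NNReal) (N : ℝ) (q₀ v V : ℝ → ℝ) : Prop where
  measurable_datum : Measurable q₀
  datum_le : ∀ x, |q₀ x| ≤ N
  measurable_velocity : Measurable v
  velocity_pos : ∀ x, 0 < v x
  velocity_le : ∀ x, v x ≤ M
  inv_velocity_le : ∀ x, (v x)⁻¹ ≤ a
  lipschitzOnWith : ∀ b, ∃ L : NNReal, LipschitzOnWith L V (Icc (-b) b)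

theorem exists_abs_le_of_lipschitzOnWith {V : ℝ → ℝ} {L : NNReal} {b : ℝ}
    (h : LipschitzOnWith L V (Icc (-b) b)) : ∃ C, ∀ x ∈ Icc (-b) b, |V x| ≤ C := by
  obtain ⟨C, hC⟩ := isCompact_Icc.exists_bound_of_continuousOn h.continuousOn
  exact ⟨C, hC⟩

section Data

variable {a M : NNReal} {N G κ S : ℝ} {γ q₀ v V : ℝ → ℝ}

/-- From `1/v - 1/v' = (v' - v) / (v v')`. Thus `L¹_loc` convergence of the velocities suffices for
locally uniform convergence of the straightening coordinates, even when the limit is discontinuous.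
-/
theorem abs_travelTime_sub_le {v' : ℝ → ℝ} {R : ℝ} (hv : Measurable v) (hv' : Measurable v')
    (hpos : ∀ x, 0 < v x) (hpos' : ∀ x, 0 < v' x) (hinv : ∀ x, (v x)⁻¹ ≤ a)
    (hinv' : ∀ x, (v' x)⁻¹ ≤ a) (hle : ∀ x, v x ≤ M) (hle' : ∀ x, v' x ≤ M) {x : ℝ}
    (hx : |x| ≤ R) :
    |travelTime v x - travelTime v' x| ≤ a * a * ∫ s in Icc (-R) R, |v s - v' s| := by
  have hi : ∀ {u : ℝ → ℝ}, Measurable u → (∀ x, 0 < u x) → (∀ x, (u x)⁻¹ ≤ a) →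
      IntervalIntegrable (fun s => (u s)⁻¹) volume 0 x := fun hu hup hua =>
    (intervalIntegrable_const (c := (a : ℝ))).mono_fun hu.inv.aestronglyMeasurable
      (ae_of_all _ fun s => by
        simp only [Real.norm_eq_abs]
        rw [abs_of_pos (inv_pos.2 (hup s))]
        exact (hua s).trans (le_abs_self _))
  have hR := abs_le.1 hx
  have hsub : Set.uIoc 0 x ⊆ Icc (-R) R := by
    intro s hs
    rcases mem_uIoc.1 hs with h | h
    · exact ⟨by linarith [h.1], by linarith [h.2]⟩
    · exact ⟨by linarith [h.1], by linarith [h.2]⟩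
  have hd : IntegrableOn (fun s => a * a * |v s - v' s|) (Icc (-R) R) := by
    refine Integrable.const_mul (Measure.integrableOn_of_bounded (M := M) (by simp)
      (hv.sub hv').abs.aestronglyMeasurable (ae_of_all _ fun s => ?_)) _
    rw [Real.norm_eq_abs, abs_abs]
    exact abs_sub_le_of_nonneg_of_le (hpos s).le (hle s) (hpos' s).le (hle' s)
  rw [travelTime, travelTime, ← intervalIntegral.integral_sub (hi hv hpos hinv)
    (hi hv' hpos' hinv'), ← integral_const_mul, ← Real.norm_eq_abs]
  refine intervalIntegral.norm_integral_le_integral_norm_uIoc.trans ?_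
  refine le_trans ?_ (setIntegral_mono_set hd (ae_of_all _ fun s => by positivity)
    hsub.eventuallyLE)
  refine setIntegral_mono_on ?_ (hd.mono_set hsub) measurableSet_uIoc fun s _ => ?_
  · exact ((intervalIntegrable_iff.1 (hi hv hpos hinv)).sub
      (intervalIntegrable_iff.1 (hi hv' hpos' hinv'))).norm
  · have e : (v s)⁻¹ - (v' s)⁻¹ = (v s)⁻¹ * (v' s)⁻¹ * (v' s - v s) := by
      have := (hpos s).ne'
      have := (hpos' s).ne'
      field_simp
    have h1 := inv_pos.2 (hpos s)
    have h2 := inv_pos.2 (hpos' s)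
    rw [e, Real.norm_eq_abs, abs_mul, abs_of_pos (mul_pos h1 h2), abs_sub_comm (v' s)]
    have h3 := hinv s
    have h4 := hinv' s
    gcongr

/-- Weak solutions depend continuously on the data, along any filter. -/
theorem IsRegularData.eventually_abs_integral_sub_le {ι : Type*} {l : Filter ι} {Q : ℝ}
    {q : ℝ → ℝ → ℝ} {q₀' v' V' : ι → ℝ → ℝ} {q' : ι → ℝ → ℝ → ℝ} {L : NNReal} {C : ℝ}
    (hγ : IsBVKernel γ G κ) (hS : 0 < S)
    (hdat : IsRegularData a M N q₀ v V) (hq : IsWeakSolution S γ q₀ v V q)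
    (hQ : LinftyBound S Q q)
    (hdat' : ∀ᶠ i in l, IsRegularData a M N (q₀' i) (v' i) (V' i))
    (hq' : ∀ᶠ i in l, IsWeakSolution S γ (q₀' i) (v' i) (V' i) (q' i) ∧ LinftyBound S Q (q' i))
    (hVL : LipschitzOnWith L V (Icc (-(Q * ∫ y, |γ y|)) (Q * ∫ y, |γ y|)))
    (hVC : ∀ x ∈ Icc (-(Q * ∫ y, |γ y|)) (Q * ∫ y, |γ y|), |V x| ≤ C)
    (hVL' : ∀ᶠ i in l, LipschitzOnWith L (V' i) (Icc (-(Q * ∫ y, |γ y|)) (Q * ∫ y, |γ y|)))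
    (hVC' : ∀ᶠ i in l, ∀ x ∈ Icc (-(Q * ∫ y, |γ y|)) (Q * ∫ y, |γ y|), |V' i x| ≤ C)
    (hV : ∀ ω > 0, ∀ᶠ i in l, ∀ x ∈ Icc (-(Q * ∫ y, |γ y|)) (Q * ∫ y, |γ y|), |V x - V' i x| ≤ ω)
    (hv : ∀ R, Tendsto (fun i => ∫ x in Icc (-R) R, |v x - v' i x|) l (𝓝 0))
    (hq0 : ∀ R, Tendsto (fun i => ∫ x in Icc (-R) R, |q₀ x - q₀' i x|) l (𝓝 0))
    {g : ℝ → ℝ} (hg : Continuous g) (hgc : HasCompactSupport g) :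
    ∀ η > 0, ∀ᶠ i in l, ∀ t ∈ Icc 0 S, |∫ x, (q t x - q' i t x) * g x| ≤ η := by
  intro η hη
  obtain ⟨B, hB⟩ := exists_straightens hdat.measurable_velocity hdat.velocity_pos
    hdat.velocity_le hdat.inv_velocity_le
  obtain ⟨X, hX, hXq⟩ := hq.exists_charFlow hQ hS hB hγ hdat.measurable_datum hdat.datum_le hVL hVC
  have hM : 0 < M := NNReal.coe_pos.1 ((hdat.velocity_pos 0).trans_le (hdat.velocity_le 0))
  -- The hypotheses hold only eventually; for the other indices `X` serves as a dummy value, so that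
  -- a choice over all `i` is possible.
  have hex : ∀ i, ∃ X' : ℝ → ℝ → ℝ, (IsRegularData a M N (q₀' i) (v' i) (V' i) →
      IsWeakSolution S γ (q₀' i) (v' i) (V' i) (q' i) ∧ LinftyBound S Q (q' i) →
      LipschitzOnWith L (V' i) (Icc (-(Q * ∫ y, |γ y|)) (Q * ∫ y, |γ y|)) →
      (∀ x ∈ Icc (-(Q * ∫ y, |γ y|)) (Q * ∫ y, |γ y|), |V' i x| ≤ C) →
      IsCharFlow S (M * Real.exp (L * (Q * κ * M) * S) * a) (M * C * S) (Q * ∫ y, |γ y|)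
        γ (q₀' i) (V' i) (travelTime (v' i)) X' ∧
      ∀ t ∈ Icc 0 S, ∀ g : ℝ → ℝ, ∫ x, q' i t x * g x = ∫ z, q₀' i z * g (X' t z)) := by
    intro i
    by_cases h : IsRegularData a M N (q₀' i) (v' i) (V' i) ∧
      (IsWeakSolution S γ (q₀' i) (v' i) (V' i) (q' i) ∧ LinftyBound S Q (q' i)) ∧
      LipschitzOnWith L (V' i) (Icc (-(Q * ∫ y, |γ y|)) (Q * ∫ y, |γ y|)) ∧
      (∀ x ∈ Icc (-(Q * ∫ y, |γ y|)) (Q * ∫ y, |γ y|), |V' i x| ≤ C)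
    · obtain ⟨h1, h2, h3, h4⟩ := h
      obtain ⟨B', hB'⟩ := exists_straightens h1.measurable_velocity h1.velocity_pos
        h1.velocity_le h1.inv_velocity_le
      obtain ⟨X', hX'⟩ := h2.1.exists_charFlow h2.2 hS hB' hγ h1.measurable_datum h1.datum_le h3 h4
      exact ⟨X', fun _ _ _ _ => hX'⟩
    · exact ⟨X, fun h1 h2 h3 h4 => absurd ⟨h1, h2, h3, h4⟩ h⟩
  choose X' hX' using hex
  have hflow : ∀ᶠ i in l, IsCharFlow S (M * Real.exp (L * (Q * κ * M) * S) * a) (M * C * S)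
      (Q * ∫ y, |γ y|) γ (q₀' i) (V' i) (travelTime (v' i)) (X' i) ∧
      ∀ t ∈ Icc 0 S, ∀ g : ℝ → ℝ, ∫ x, q' i t x * g x = ∫ z, q₀' i z * g (X' i t z) := by
    filter_upwards [hdat', hq', hVL', hVC'] with i h1 h2 h3 h4 using hX' i h1 h2 h3 h4
  have hA : ∀ R, ∀ α > 0, ∀ᶠ i in l, ∀ x, |x| ≤ R →
      |travelTime v x - travelTime (v' i) x| ≤ α := by
    intro R α hα
    have h1 : Tendsto (fun i => a * a * ∫ x in Icc (-R) R, |v x - v' i x|) l (𝓝 (a * a * 0)) :=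
      (hv R).const_mul _
    rw [mul_zero] at h1
    filter_upwards [h1.eventually (ge_mem_nhds hα), hdat'] with i hi hd x hx
    exact (abs_travelTime_sub_le hdat.measurable_velocity hd.measurable_velocity
      hdat.velocity_pos hd.velocity_pos hdat.inv_velocity_le hd.inv_velocity_le hdat.velocity_le
      hd.velocity_le hx).trans hi
  have key := hX.eventually_abs_integral_sub_le (hflow.mono fun i h => h.1) hγ hM
    hB.lipschitz_inv hB.left_inv hS.le hdat.measurable_datum hdat.datum_le
    (hdat'.mono fun i h => ⟨h.measurable_datum, h.datum_le⟩) hVL hV hA hq0 hg hgc η hη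
  filter_upwards [key, hflow, hq'] with i hi hfi hqi t ht
  have hint : ∀ {f : ℝ → ℝ}, LocallyIntegrable f → Integrable fun x => f x * g x := fun hf => by
    simpa [mul_comm] using hf.integrable_smul_left_of_hasCompactSupport hg hgc
  have h1 := hint (hq.memCL1Loc.locallyIntegrable t ht)
  have h2 := hint (hqi.1.memCL1Loc.locallyIntegrable t ht)
  simp_rw [sub_mul]
  rw [integral_sub h1 h2, hXq t ht, hfi.2 t ht]
  exact hi t ht

/-- Uniqueness is stability with unperturbed data: every pairing of the difference is at most `η`
for all `η > 0`. -/
theorem IsRegularData.ae_eq (hγ : IsBVKernel γ G κ) (hS : 0 < S)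
    (hdat : IsRegularData a M N q₀ v V) {q q' : ℝ → ℝ → ℝ} (hq : IsWeakSolution S γ q₀ v V q)
    (hq' : IsWeakSolution S γ q₀ v V q') : ∀ t ∈ Icc 0 S, q' t =ᵐ[volume] q t := by
  obtain ⟨Q₁, hQ₁⟩ := hq.bounded
  obtain ⟨Q₂, hQ₂⟩ := hq'.bounded
  set Q := max Q₁ Q₂
  have hQ := hQ₁.mono (le_max_left Q₁ Q₂)
  have hQ' := hQ₂.mono (le_max_right Q₁ Q₂)
  obtain ⟨L, hL⟩ := hdat.lipschitzOnWith (Q * ∫ y, |γ y|)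
  obtain ⟨C, hC⟩ := exists_abs_le_of_lipschitzOnWith hL
  have key : ∀ g : ℝ → ℝ, Continuous g → HasCompactSupport g → ∀ t ∈ Icc 0 S,
      ∫ x, (q t x - q' t x) * g x = 0 := by
    intro g hg hgc t ht
    refine abs_nonpos_iff.1 (le_of_forall_pos_le_add fun η hη => ?_)
    rw [zero_add]
    -- Along the pure filter on `Unit`, eventual truth is truth at the single index.
    have := IsRegularData.eventually_abs_integral_sub_le (l := (pure () : Filter Unit)) hγ hS hdat
      hq hQ (q₀' := fun _ => q₀) (v' := fun _ => v) (V' := fun _ => V) (q' := fun _ => q')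
      (Eventually.of_forall fun _ => hdat) (Eventually.of_forall fun _ => ⟨hq', hQ'⟩) hL hC
      (Eventually.of_forall fun _ => hL) (Eventually.of_forall fun _ => hC)
      (fun ω hω => Eventually.of_forall fun _ x _ => by simpa using hω.le)
      (fun R => by simp) (fun R => by simp) hg hgc η hη
    exact (eventually_pure.1 this) t ht
  intro t ht
  have l1 := hq.memCL1Loc.locallyIntegrable t ht
  have l2 := hq'.memCL1Loc.locallyIntegrable t ht
  refine ae_eq_of_integral_contDiff_smul_eq l2 l1 fun g hg hgc => ?_
  have h1 := key g hg.continuous hgc t ht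
  have i1 := l1.integrable_smul_left_of_hasCompactSupport hg.continuous hgc
  have i2 := l2.integrable_smul_left_of_hasCompactSupport hg.continuous hgc
  refine (sub_eq_zero.1 ?_).symm
  rw [← integral_sub i1 i2, ← h1]
  congr 1; ext x
  simp only [smul_eq_mul]; ring

theorem IsRegularData.exists_isUniqueWeakSolution {L K : NNReal} {C c : ℝ}
    (hγ : IsBVKernel γ G κ) (hdat : IsRegularData a M N q₀ v V) (hc : c = 2 * (M * a))
    (hVL : LipschitzOnWith L V (Icc (-(N * (c * ∫ y, |γ y|))) (N * (c * ∫ y, |γ y|))))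
    (hVC : ∀ x ∈ Icc (-(N * (c * ∫ y, |γ y|))) (N * (c * ∫ y, |γ y|)), |V x| ≤ C)
    (hS : 0 < S) (hK : K = L * ((N * (c * κ)).toNNReal * M)) (hKS : K * S ≤ 1 / 4) :
    ∃ q, IsUniqueWeakSolution S γ q₀ v V q ∧ LinftyBound S (N * c) q := by
  obtain ⟨B, hB⟩ := exists_straightens hdat.measurable_velocity hdat.velocity_pos
    hdat.velocity_le hdat.inv_velocity_le
  obtain ⟨q, hq, hb⟩ := exists_isWeakSolution hB hγ hdat.measurable_datum hdat.datum_le hc hVL hVC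
    hS hK hKS
  exact ⟨q, ⟨hq, fun q' hq' => hdat.ae_eq hγ hS hq hq'⟩, hb⟩

/-- Averaging preserves pointwise upper and lower bounds, so the constants `a`, `M`, `N` are the
same for all `ε`. -/
theorem IsRegularData.mollify (hdat : IsRegularData a M N q₀ v V) {m ε : ℝ} (hm : 0 < m)
    (hma : m⁻¹ ≤ a) (hmv : ∀ x, m ≤ v x) (hV : Continuous V) (hε : 0 < ε) :
    IsRegularData a M N (mollify ε q₀) (mollify ε v) (mollify ε V) := by
  have hv := mollify_mem_Icc hε hdat.measurable_velocity.aestronglyMeasurable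
    fun x => ⟨hmv x, hdat.velocity_le x⟩
  refine ⟨(continuous_mollify hε (locallyIntegrable_of_bdd hdat.measurable_datum
    hdat.datum_le)).measurable, fun x => abs_le.2 (mollify_mem_Icc hε
    hdat.measurable_datum.aestronglyMeasurable (fun x => abs_le.1 (hdat.datum_le x)) x),
    (continuous_mollify hε (locallyIntegrable_of_bdd (C := M) hdat.measurable_velocity
      fun x => ?_)).measurable,
    fun x => hm.trans_le (hv x).1, fun x => (hv x).2,
    fun x => (inv_anti₀ hm (hv x).1).trans hma, fun b => ?_⟩
  · rw [abs_of_pos (hdat.velocity_pos x)]; exact hdat.velocity_le x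
  · obtain ⟨L, hL⟩ := hdat.lipschitzOnWith (b + ε)
    exact ⟨L, lipschitzOnWith_mollify hε hV le_rfl hL⟩

end Data

-- Representatives, common horizon and conclusion

theorem exists_ae_eq_mem_Icc {f : ℝ → ℝ} (hf : AEStronglyMeasurable f) {m M : ℝ} (hmM : m ≤ M)
    (h : ∀ᵐ x, f x ∈ Icc m M) :
    ∃ f', Measurable f' ∧ (∀ x, f' x ∈ Icc m M) ∧ f =ᵐ[volume] f' := by
  refine ⟨fun x => max m (min (hf.mk f x) M),
    measurable_const.max (hf.stronglyMeasurable_mk.measurable.min measurable_const),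
    fun x => ⟨le_max_left _ _, max_le hmM (min_le_right _ _)⟩, ?_⟩
  filter_upwards [h, hf.ae_eq_mk] with x hx hm
  rw [← hm, min_eq_left hx.2, max_eq_right hx.1]

theorem MeasureTheory.MemLp.exists_ae_abs_le {f : ℝ → ℝ} (hf : MemLp f ⊤ volume) :
    ∃ N, 0 ≤ N ∧ ∀ᵐ x, |f x| ≤ N := by
  refine ⟨(eLpNorm f ⊤ volume).toReal, ENNReal.toReal_nonneg, ?_⟩
  have h2 := ae_le_eLpNormEssSup (f := f) (μ := (volume : Measure ℝ))
  filter_upwards [h2] with ξ hξ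
  rw [← eLpNorm_exponent_top] at hξ
  have := ENNReal.toReal_mono hf.2.ne hξ
  rwa [toReal_enorm, Real.norm_eq_abs] at this

theorem IsUniqueWeakSolution.congr {S : ℝ} {γ γ' q₀ q₀' v v' V : ℝ → ℝ} {q : ℝ → ℝ → ℝ}
    (h : IsUniqueWeakSolution S γ q₀ v V q) (hγ : γ =ᵐ[volume] γ') (hq : q₀ =ᵐ[volume] q₀')
    (hv : v =ᵐ[volume] v') : IsUniqueWeakSolution S γ' q₀' v' V q :=
  ⟨h.isWeakSolution.congr hγ hq hv, fun q' hq' =>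
    h.unique q' (hq'.congr hγ.symm hq.symm hv.symm)⟩

section Regular

variable {a M : NNReal} {N G κ S T m ε₀ : ℝ} {γ q₀ v V : ℝ → ℝ}

/-- The bounds on the field `V` and its mollifications. -/
theorem exists_uniform_bounds (hV : Continuous V)
    (hVL : ∀ b, ∃ L : NNReal, LipschitzOnWith L V (Icc (-b) b)) (hε₀ : 0 < ε₀) (b : ℝ) :
    ∃ (L : NNReal) (C : ℝ), LipschitzOnWith L V (Icc (-b) b) ∧ (∀ x ∈ Icc (-b) b, |V x| ≤ C) ∧
      ∀ ε ∈ Ioc 0 ε₀, LipschitzOnWith L (mollify ε V) (Icc (-b) b) ∧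
        (∀ x ∈ Icc (-b) b, |mollify ε V x| ≤ C) ∧
        ∀ x ∈ Icc (-b) b, |V x - mollify ε V x| ≤ L * ε := by
  -- Mollification at scale `ε ≤ ε₀` sees `V` up to distance `ε₀` beyond `[-b, b]`.
  obtain ⟨L, hL⟩ := hVL (b + ε₀)
  have hsub : Icc (-b) b ⊆ Icc (-(b + ε₀)) (b + ε₀) := Icc_subset_Icc (by linarith) (by linarith)
  obtain ⟨C, hC⟩ := exists_abs_le_of_lipschitzOnWith (hL.mono hsub)
  have hd : ∀ ε ∈ Ioc 0 ε₀, ∀ x ∈ Icc (-b) b, |V x - mollify ε V x| ≤ L * ε := fun ε hε x hx =>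
    abs_sub_mollify_le hε.1 hV (add_le_add le_rfl hε.2) hL hx
  have hLε : 0 ≤ L * ε₀ := by positivity
  refine ⟨L, C + L * ε₀, hL.mono hsub, fun x hx => (hC x hx).trans (by linarith),
    fun ε hε => ⟨lipschitzOnWith_mollify hε.1 hV (add_le_add le_rfl hε.2) hL, fun x hx => ?_,
      hd ε hε⟩⟩
  have h1 := hd ε hε x hx
  have h2 : L * ε ≤ L * ε₀ := mul_le_mul_of_nonneg_left hε.2 L.2
  calc |mollify ε V x| = |V x - (V x - mollify ε V x)| := by ring_nf
    _ ≤ _ := (abs_sub _ _).trans (add_le_add (hC x hx) (h1.trans h2))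

/-- The horizon of the contraction argument depends only on bounds shared by the data and all their
mollifications. -/
theorem IsRegularData.exists_common_horizon (hγ : IsBVKernel γ G κ)
    (hdat : IsRegularData a M N q₀ v V) (hm : 0 < m) (hma : m⁻¹ ≤ a) (hmv : ∀ x, m ≤ v x)
    (hV : Continuous V) (hT : 0 < T) (hε₀ : 0 < ε₀) :
    ∃ S ∈ Ioc 0 T, ∃ K : ℝ,
      (∃ q : ℝ → ℝ → ℝ, IsUniqueWeakSolution S γ q₀ v V q ∧ LinftyBound S K q) ∧
      ∀ ε ∈ Ioc 0 ε₀, ∃ q' : ℝ → ℝ → ℝ,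
        IsUniqueWeakSolution S γ (_root_.mollify ε q₀) (_root_.mollify ε v) (_root_.mollify ε V) q' ∧
          LinftyBound S K q' := by
  set c : ℝ := 2 * (M * a) with hc
  obtain ⟨L, C, hL, hC, hLC⟩ := exists_uniform_bounds hV hdat.lipschitzOnWith hε₀
    (N * (c * ∫ y, |γ y|))
  set K : NNReal := L * ((N * (c * κ)).toNNReal * M) with hK
  have hK0 : (0 : ℝ) ≤ K := K.2
  set S := min T (1 / (4 * (K + 1))) with hS
  have hS0 : 0 < S := lt_min hT (by positivity)
  have hKS : K * S ≤ 1 / 4 := by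
    calc K * S ≤ K * (1 / (4 * (K + 1))) := mul_le_mul_of_nonneg_left (min_le_right _ _) hK0
      _ ≤ 1 / 4 := by
        rw [mul_one_div, div_le_div_iff₀ (by positivity) (by norm_num)]; linarith
  refine ⟨S, ⟨hS0, min_le_left _ _⟩, N * c,
    hdat.exists_isUniqueWeakSolution hγ hc hL hC hS0 hK hKS, fun ε hε => ?_⟩
  exact (hdat.mollify hm hma hmv hV hε.1).exists_isUniqueWeakSolution hγ hc (hLC ε hε).1
    (hLC ε hε).2.1 hS0 hK hKS

theorem IsRegularData.eventually_abs_integral_sub_mollified_le (hγ : IsBVKernel γ G κ)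
    (hdat : IsRegularData a M N q₀ v V) (hm : 0 < m) (hma : m⁻¹ ≤ a) (hmv : ∀ x, m ≤ v x)
    (hV : Continuous V) (hS : 0 < S) (hε₀ : 0 < ε₀) {q : ℝ → ℝ → ℝ} {qε : ℝ → ℝ → ℝ → ℝ} {K : ℝ}
    (hq : IsWeakSolution S γ q₀ v V q)
    (hqε : ∀ ε ∈ Ioc 0 ε₀, IsWeakSolution S γ (_root_.mollify ε q₀) (_root_.mollify ε v)
      (_root_.mollify ε V) (qε ε) ∧ LinftyBound S K (qε ε))
    {g : ℝ → ℝ} (hg : Continuous g) (hgc : HasCompactSupport g) :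
    ∀ η > 0, ∀ᶠ ε in 𝓝[>] 0, ∀ t ∈ Icc 0 S, |∫ x, (q t x - qε ε t x) * g x| ≤ η := by
  obtain ⟨Q₁, hQ₁⟩ := hq.bounded
  -- One bound for `q` and all `qε`, hence one interval containing all values of the nonlocal terms.
  set Q := max Q₁ K
  obtain ⟨L, C, hL, hC, hLC⟩ := exists_uniform_bounds hV hdat.lipschitzOnWith hε₀
    (Q * ∫ y, |γ y|)
  have hev : ∀ᶠ ε in 𝓝[>] (0 : ℝ), ε ∈ Ioc 0 ε₀ := Ioc_mem_nhdsGT hε₀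
  refine hdat.eventually_abs_integral_sub_le (q₀' := fun ε => _root_.mollify ε q₀)
    (v' := fun ε => _root_.mollify ε v) (V' := fun ε => _root_.mollify ε V) hγ hS hq
    (hQ₁.mono (le_max_left _ _))
    (hev.mono fun ε hε => hdat.mollify hm hma hmv hV hε.1)
    (hev.mono fun ε hε => ⟨(hqε ε hε).1, (hqε ε hε).2.mono (le_max_right _ _)⟩) hL hC
    (hev.mono fun ε hε => (hLC ε hε).1) (hev.mono fun ε hε => (hLC ε hε).2.1) (fun ω hω => ?_)
    (tendsto_setIntegral_abs_sub_mollify (N := M) hdat.measurable_velocity fun x => ?_)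
    (tendsto_setIntegral_abs_sub_mollify hdat.measurable_datum hdat.datum_le) hg hgc
  · filter_upwards [hev, Ioc_mem_nhdsGT (show 0 < ω / (L + 1) by positivity)] with ε hε hεω x hx
    refine ((hLC ε hε).2.2 x hx).trans ?_
    have h1 := mul_le_mul_of_nonneg_left hεω.2 (by positivity : (0 : ℝ) ≤ L + 1)
    rw [mul_div_cancel₀ _ (by positivity)] at h1
    linarith [hε.1]
  · rw [abs_of_pos (hdat.velocity_pos x)]; exact hdat.velocity_le x

end Regular

/-- Pairings of weak solutions with `g` are continuous on the compact interval `[0, S]`. -/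
theorem IsWeakSolution.exists_isGreatest {S : ℝ} {γ q₀ q₀' v v' V V' : ℝ → ℝ} {q q' : ℝ → ℝ → ℝ}
    (hS : 0 < S) (hq : IsWeakSolution S γ q₀ v V q) (hq' : IsWeakSolution S γ q₀' v' V' q')
    {g : ℝ → ℝ} (hg : Continuous g) (hgc : HasCompactSupport g) :
    ∃ m, IsGreatest ((fun t => |∫ x, (q t x - q' t x) * g x|) '' Icc 0 S) m := by
  obtain ⟨R, hR⟩ := hgc.isCompact.isBounded.exists_norm_le
  obtain ⟨W, hW⟩ := hg.bounded_above_of_compact_support hgc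
  have hcont : ∀ {γ q₀ v V : ℝ → ℝ} {q : ℝ → ℝ → ℝ}, IsWeakSolution S γ q₀ v V q →
      ContinuousOn (fun t => ∫ x, q t x * g x) (Icc 0 S) := by
    intro γ q₀ v V q hq
    obtain ⟨Q, hQ⟩ := hq.bounded
    exact hq.memCL1Loc.continuousOn_integral_mul (R := R) (W := W) (P := 0) (ψ := fun _ x => g x)
      (hq.memCL1Loc.ae_abs_le hS hQ) (fun _ => hg) (fun _ x hx =>
        image_eq_zero_of_notMem_tsupport fun h => absurd (hR x h) (not_le.2 hx))
      (fun _ x => hW x) (fun _ _ _ => by simp)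
  have hint : ∀ {f : ℝ → ℝ}, LocallyIntegrable f → Integrable fun x => f x * g x := fun hf => by
    simpa [mul_comm] using hf.integrable_smul_left_of_hasCompactSupport hg hgc
  have h : ContinuousOn (fun t => |∫ x, (q t x - q' t x) * g x|) (Icc 0 S) := by
    refine ((hcont hq).sub (hcont hq')).abs.congr fun t ht => ?_
    simp_rw [sub_mul]
    rw [integral_sub (hint (hq.memCL1Loc.locallyIntegrable t ht))
      (hint (hq'.memCL1Loc.locallyIntegrable t ht))]
    rfl
  exact (isCompact_Icc.image_of_continuousOn h).exists_isGreatest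
    ((nonempty_Icc.2 hS.le).image _)

theorem mainTheorem6 (T vlow : ℝ) (hT : 0 < T) (hvlow : 0 < vlow)
    (q₀ γ V v : ℝ → ℝ)
    (hq₀ : MemLp q₀ ⊤ volume)
    (hγ : MemBV γ) (hγ_nonneg : ∀ᵐ x, 0 ≤ γ x)
    (hV : MemW1InftyLoc V)
    (hv : MemLp v ⊤ volume) (hv_low : ∀ᵐ x, vlow ≤ v x)
    (ε₀ : ℝ) (hε₀ : 0 < ε₀) :
    -- a common time horizon of existence, uniqueness and boundedness
    (∃ S ∈ Ioc 0 T, ∃ K : ℝ,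
      (∃ q : ℝ → ℝ → ℝ, IsUniqueWeakSolution S γ q₀ v V q ∧ LinftyBound S K q) ∧
      ∀ ε ∈ Ioc 0 ε₀, ∃ q' : ℝ → ℝ → ℝ,
        IsUniqueWeakSolution S γ (mollify ε q₀) (mollify ε v) (mollify ε V) q' ∧
          LinftyBound S K q') ∧
    -- convergence on every common, uniformly bounded time horizon of existence
    (∀ S ∈ Ioc 0 T, ∀ (q : ℝ → ℝ → ℝ) (qε : ℝ → ℝ → ℝ → ℝ) (K : ℝ),
      IsWeakSolution S γ q₀ v V q →
      (∀ ε ∈ Ioc 0 ε₀,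
        IsWeakSolution S γ (mollify ε q₀) (mollify ε v) (mollify ε V) (qε ε) ∧
          LinftyBound S K (qε ε)) →
      ∀ g : ℝ → ℝ, Continuous g → HasCompactSupport g →
        ∃ m : ℝ → ℝ,
          (∀ ε ∈ Ioc 0 ε₀,
            IsGreatest ((fun t => |∫ x, (q t x - qε ε t x) * g x|) '' Icc 0 S) (m ε)) ∧
          Tendsto m (𝓝[>] 0) (𝓝 0)) := by
  -- The data are replaced by representatives satisfying their bounds everywhere; weak solutions and
  -- mollifications do not see the change.
  obtain ⟨γ', hγγ', hbv⟩ := hγ.variation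
  obtain ⟨G, κ, hγ'⟩ := hbv.isBVKernel (hγ.integrable.congr hγγ'.symm)
  obtain ⟨N, hN, hqN⟩ := hq₀.exists_ae_abs_le
  obtain ⟨q₀', hq₀m, hq₀N, hq₀q⟩ := exists_ae_eq_mem_Icc hq₀.1 (by linarith : -N ≤ N)
    (hqN.mono fun x hx => abs_le.1 hx)
  obtain ⟨M, -, hvM⟩ := hv.exists_ae_abs_le
  have hvmem : ∀ᵐ x, v x ∈ Icc vlow M := by
    filter_upwards [hv_low, hvM] with x h1 h2 using ⟨h1, (le_abs_self _).trans h2⟩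
  have hM : vlow ≤ M := by
    obtain ⟨x, hx⟩ := hvmem.exists
    exact hx.1.trans hx.2
  obtain ⟨v', hvm, hvv, hve⟩ := exists_ae_eq_mem_Icc hv.1 hM hvmem
  have hM0 : 0 ≤ M := hvlow.le.trans hM
  have hdat : IsRegularData vlow⁻¹.toNNReal M.toNNReal N q₀' v' V :=
    ⟨hq₀m, fun x => abs_le.2 (hq₀N x), hvm, fun x => hvlow.trans_le (hvv x).1,
      fun x => by rw [Real.coe_toNNReal _ hM0]; exact (hvv x).2,
      fun x => by
        rw [Real.coe_toNNReal _ (inv_nonneg.2 hvlow.le)]; exact inv_anti₀ hvlow (hvv x).1,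
      hV.exists_lipschitzOnWith⟩
  have hma : vlow⁻¹ ≤ vlow⁻¹.toNNReal := Real.le_coe_toNNReal _
  have hmv : ∀ x, vlow ≤ v' x := fun x => (hvv x).1
  have eq1 : ∀ ε, mollify ε q₀ = mollify ε q₀' := mollify_congr_ae hq₀q
  have eq2 : ∀ ε, mollify ε v = mollify ε v' := mollify_congr_ae hve
  constructor
  · obtain ⟨S, hS, K, ⟨q, hq, hqK⟩, h⟩ := hdat.exists_common_horizon hγ' hvlow hma hmv
      hV.continuous hT hε₀
    refine ⟨S, hS, K, ⟨q, hq.congr hγγ' hq₀q.symm hve.symm, hqK⟩, fun ε hε => ?_⟩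
    obtain ⟨q', hq', hqK'⟩ := h ε hε
    rw [eq1, eq2]
    exact ⟨q', hq'.congr hγγ' (ae_eq_refl _) (ae_eq_refl _), hqK'⟩
  · intro S hS q qε K hq hqε g hg hgc
    have hgr : ∀ ε : ℝ, ∃ m : ℝ, ε ∈ Ioc 0 ε₀ →
        IsGreatest ((fun t => |∫ x, (q t x - qε ε t x) * g x|) '' Icc 0 S) m := by
      intro ε
      by_cases hε : ε ∈ Ioc 0 ε₀
      · obtain ⟨m, hm⟩ := hq.exists_isGreatest hS.1 (hqε ε hε).1 hg hgc
        exact ⟨m, fun _ => hm⟩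
      -- Outside `(0, ε₀]` the value is irrelevant to the limit.
      · exact ⟨0, fun h => absurd h hε⟩
    choose m hm using hgr
    refine ⟨m, hm, Metric.tendsto_nhds.2 fun η hη => ?_⟩
    have key := hdat.eventually_abs_integral_sub_mollified_le (qε := qε) (K := K) hγ' hvlow hma hmv
      hV.continuous hS.1 hε₀ (hq.congr hγγ'.symm hq₀q hve)
      (fun ε hε => by
        have := hqε ε hε
        rw [eq1, eq2] at this
        exact ⟨this.1.congr hγγ'.symm (ae_eq_refl _) (ae_eq_refl _), this.2⟩)
      hg hgc (η / 2) (half_pos hη)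
    filter_upwards [key, Ioc_mem_nhdsGT hε₀] with ε hε hε'
    -- The maximum is attained at some `t`, so the bound uniform in time applies to it.
    obtain ⟨t, ht, hmt⟩ := (hm ε hε').1
    have h1 := hε t ht
    simp only at hmt
    rw [hmt] at h1
    rw [dist_zero_right, Real.norm_eq_abs, ← hmt, abs_abs, hmt]
    linarith
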